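/- **Setting.** Let $d\ge 1$, let $\mathcal X\subset\mathbb R^d$ be non-empty, let $\sigma^2>0$, and let $f\sim\mathcal{GP}(0,k)$ be a centered Gaussian process on $\mathcal X$ whose kernel satisfies $\kappa\le k(x,x)\le 1$ for all $x\in\mathcal X$, for some constant $\kappa>0$. For $t=1,2,\dots$ a point $x_t\in\mathcal X$ is queried and $y_t=f(x_t)+\epsilon_t$ is observed, where $\epsilon_t\sim\mathcal N(0,\sigma^2)$ are i.i.d. and independent of $f$. With $\mathbf k_{t-1}(x)=(k(x,x_i))_{i<t}$, $\mathbf K=(k(x_i,x_j))_{i,j<t}$ and $\mathbf y_{t-1}=(y_i)_{i<t}$, the posterior mean and variance are $$\mu_{t-1}(x)=\mathbf k_{t-1}(x)^\top(\mathbf K+\sigma^2 I)^{-1}\mathbf y_{t-1},\qquad \sigma_{t-1}^2(x)=k(x,x)-\mathbf k_{t-1}(x)^\top(\mathbf K+\sigma^2 I)^{-1}\mathbf k_{t-1}(x).$$ For $m,b\in\mathbb R$ let $\mathrm{EI}(m,s,b)=s\,\tau\big((m-b)/s\big)$ if $s>0$ and $\mathrm{EI}(m,0,b)=\max\{m-b,0\}$,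 where $\tau(c)=c\,\Phi(c)+\phi(c)$ and $\Phi,\phi$ are the standard Gaussian distribution function and density. The maximum information gain $\gamma_T$ is the supremum over $a_1,\dots,a_T\in\mathcal X$ (repetitions allowed) of the Shannon mutual information between $(f(a_i)+\epsilon_i)_{i\le T}$ and $(f(a_i))_{i\le T}$. Let $x^*$ be a maximizer of $f$ over $\mathcal X$ and let $\mathrm{BCR}_T=\sum_{t=1}^T\mathbb E[f(x^*)-f(x_t)]$. **Theorem.** Assume one of the following. (i) $\mathcal X$ is finite, and $\beta_t=2\log\big(|\mathcal X|t^2/\sqrt{2\pi}+1\big)$. (ii) $\mathcal X\subset[0,r]^d$ is compact and convex, where $r>0$; almost every sample path of $f$ is differentiable on $\mathcal X$, and there are $a\ge1$, $b>0$ such that $L_j=\sup_{x\in\mathcal X}|\partial f/\partial x_j|$ satisfies $\Pr(L_j>c)\le a\exp(-(c/b)^2)$ for all $c>0$ and $j=1,\dots,d$; and $$\beta_t=2d\log\Big\lceil b\,d\,r\,t^2\big(\sqrt{\log(ad)}+\sqrt\pi/2\big)\Big\rceil+2\log\big(t^2/\sqrt{2\pi}+1\big).$$ Suppose that for all $t\ge1$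 $$x_t\in\operatorname*{arg\,max}_{x\in\mathcal X}\ \mathrm{EI}\big(\mu_{t-1}(x),\,\beta_t^{1/2}\sigma_{t-1}(x),\,\tilde\mu^{\max}_{t-1}\big),\qquad \tilde\mu^{\max}_{t-1}=\max_{i<t}\mu_{t-1}(x_i)\ (t\ge2),\quad \tilde\mu^{\max}_0=0,$$ where ties are broken by an arbitrary measurable rule that depends only on $y_1,\dots,y_{t-1}$ and on a random element independent of $(f,(\epsilon_i)_i)$. Then every $f(x^*)-f(x_t)$ is integrable, and there is a constant $C$ depending only on $\sigma^2$ and $\kappa$ with $$\mathrm{BCR}_T\le C\sqrt{\beta_T\,\gamma_T\,T\log T}\qquad\text{for all }T\ge2 .$$ In particular $\mathrm{BCR}_T=O\big(\sqrt{\beta_T\gamma_T T\log T}\big)$. -/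

import Mathlib

open MeasureTheory ProbabilityTheory Filter Topology
open scoped NNReal ENNReal

noncomputable section

namespace BayesOpt

/-! ### Gaussian process posterior -/

section Posterior

variable {X : Type*}

/-- The kernel vector `(k(z, x₁), …, k(z, xₙ))`. -/
def kernelVec (k : X → X → ℝ) {n : ℕ} (pts : Fin n → X) (z : X) : Fin n → ℝ :=
  fun i => k z (pts i)

/-- The kernel matrix `K = (k(xᵢ, xⱼ))ᵢⱼ`. -/
def kernelMat (k : X → X → ℝ) {n : ℕ} (pts : Fin n → X) : Matrix (Fin n) (Fin n) ℝ :=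
  Matrix.of fun i j => k (pts i) (pts j)

/-- Posterior mean `μₙ(z) = kₙ(z)ᵀ (K + v I)⁻¹ y` for noise variance `v`. -/
def postMean (k : X → X → ℝ) (v : ℝ≥0) {n : ℕ} (pts : Fin n → X) (y : Fin n → ℝ) (z : X) : ℝ :=
  kernelVec k pts z ⬝ᵥ
    Matrix.mulVec (kernelMat k pts + (v : ℝ) • (1 : Matrix (Fin n) (Fin n) ℝ))⁻¹ y

/-- Posterior variance `σₙ²(z) = k(z, z) - kₙ(z)ᵀ (K + v I)⁻¹ kₙ(z)` for noise variance `v`. -/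
def postVar (k : X → X → ℝ) (v : ℝ≥0) {n : ℕ} (pts : Fin n → X) (z : X) : ℝ :=
  k z z - kernelVec k pts z ⬝ᵥ
    Matrix.mulVec (kernelMat k pts + (v : ℝ) • (1 : Matrix (Fin n) (Fin n) ℝ))⁻¹
      (kernelVec k pts z)

/-- Posterior standard deviation `σₙ(z)`. -/
def postSd (k : X → X → ℝ) (v : ℝ≥0) {n : ℕ} (pts : Fin n → X) (z : X) : ℝ :=
  Real.sqrt (postVar k v pts z)

/-- The largest posterior mean among the evaluated points, `max_{i ≤ n} μₙ(xᵢ)`;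
it is `0` when nothing has been evaluated. -/
def evaluatedMeanMax (k : X → X → ℝ) (v : ℝ≥0) {n : ℕ} (pts : Fin n → X) (y : Fin n → ℝ) : ℝ :=
  if n = 0 then 0 else ⨆ i : Fin n, postMean k v pts y (pts i)

end Posterior

/-! ### Expected improvement -/

/-- `τ(c) = c Φ(c) + φ(c)`, with the standard Gaussian distribution function `Φ` and density `φ`. -/
def tau (c : ℝ) : ℝ :=
  c * cdf (gaussianReal 0 1) c + gaussianPDFReal 0 1 c

/-- Expected improvement `EI(m, s, b)` over the reference value `b`
for mean `m` and standard deviation `s`. -/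
def expImprovement (m s b : ℝ) : ℝ :=
  if 0 < s then s * tau ((m - b) / s) else max (m - b) 0

/-- The acquisition function `z ↦ EI(μₙ(z), β^{1/2} σₙ(z), max_{i ≤ n} μₙ(xᵢ))`. -/
def scaledEI {X : Type*} (k : X → X → ℝ) (v : ℝ≥0) (β : ℝ) {n : ℕ} (pts : Fin n → X)
    (y : Fin n → ℝ) (z : X) : ℝ :=
  expImprovement (postMean k v pts y z) (Real.sqrt β * postSd k v pts z)
    (evaluatedMeanMax k v pts y)

/-! ### The Bayesian model and the algorithm

Times are counted from `0` in the processes: `x n`, `ε n` and `obs f ε x n` are the `(n+1)`-st query,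
noise and observation. -/

section Model

variable {X Ω S : Type*} [MeasurableSpace Ω] [MeasurableSpace S]

/-- `f` is a centered Gaussian process with covariance kernel `k`. -/
structure IsCenteredGP (P : Measure Ω) (k : X → X → ℝ) (f : X → Ω → ℝ) : Prop where
  measurable : ∀ z, Measurable (f z)
  gaussian : IsGaussianProcess f P
  mean_zero : ∀ z, ∫ ω, f z ω ∂P = 0
  covariance : ∀ z z', cov[f z, f z'; P] = k z z'

/-- The objective `f ~ GP(0, k)`, noise variables `ε n ~ N(0, v)`, and a source `ξ` of randomness for
the algorithm (it may only be used to break ties); `f`, `ξ`, `ε 0`, `ε 1`, … are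
mutually independent. -/
structure IsModel (P : Measure Ω) (k : X → X → ℝ) (v : ℝ≥0) (f : X → Ω → ℝ) (ε : ℕ → Ω → ℝ)
    (ξ : Ω → S) : Prop where
  gp : IsCenteredGP P k f
  noise_measurable : ∀ n, Measurable (ε n)
  noise_law : ∀ n, P.map (ε n) = gaussianReal 0 v
  seed_measurable : Measurable ξ
  indep_noise : iIndepFun ε P
  indep_obj_seed : IndepFun (fun ω z => f z ω) ξ P
  indep_noise_rest : IndepFun (fun ω n => ε n ω) (fun ω => ((fun z => f z ω), ξ ω)) P

/-- The observation `y = f(x) + ε`. -/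
def obs (f : X → Ω → ℝ) (ε : ℕ → Ω → ℝ) (x : ℕ → Ω → X) (n : ℕ) (ω : Ω) : ℝ :=
  f (x n ω) ω + ε n ω

/-- The queries `x` are produced by maximizing the rescaled expected improvement: the `(n+1)`-st query
is a measurable function of the seed and of the first `n` observations, and it
maximizes the acquisition function given the first `n` queries and observations, with scale
parameter `β (n+1)`. -/
structure IsScaledEIRun [MeasurableSpace X] (P : Measure Ω) (k : X → X → ℝ) (v : ℝ≥0)
    (β : ℕ → ℝ) (f : X → Ω → ℝ) (ε : ℕ → Ω → ℝ) (ξ : Ω → S) (x : ℕ → Ω → X) : Prop where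
  adapted : ∀ n, ∃ π : S × (Fin n → ℝ) → X, Measurable π ∧
    ∀ᵐ ω ∂P, x n ω = π (ξ ω, fun i => obs f ε x i ω)
  argmax : ∀ n, ∀ᵐ ω ∂P, ∀ z,
    scaledEI k v (β (n + 1)) (fun i : Fin n => x i ω) (fun i => obs f ε x i ω) z ≤
      scaledEI k v (β (n + 1)) (fun i : Fin n => x i ω) (fun i => obs f ε x i ω) (x n ω)

/-- `xstar` is a (random) global maximizer of `f`. -/
def IsMaximizer (P : Measure Ω) (f : X → Ω → ℝ) (xstar : Ω → X) : Prop :=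
  ∀ᵐ ω ∂P, ∀ z, f z ω ≤ f (xstar ω) ω

/-- Bayesian cumulative regret `BCR_T = ∑_{t ≤ T} E[f(x*) - f(x_t)]`. -/
def bcr (P : Measure Ω) (f : X → Ω → ℝ) (xstar : Ω → X) (x : ℕ → Ω → X) (T : ℕ) : ℝ :=
  ∑ n ∈ Finset.range T, ∫ ω, (f (xstar ω) ω - f (x n ω) ω) ∂P

/-! ### Maximum information gain -/

/-- Shannon mutual information `I(Y; Z)`: the Kullback–Leibler divergence of the joint law from the
product of the marginal laws. -/
def mutualInfo {A B : Type*} [MeasurableSpace A] [MeasurableSpace B] (P : Measure Ω)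
    (Y : Ω → A) (Z : Ω → B) : ℝ≥0∞ :=
  InformationTheory.klDiv (P.map fun ω => (Y ω, Z ω)) ((P.map Y).prod (P.map Z))

/-- Maximum information gain `γ_T = sup_{a₁, …, a_T ∈ X} I(y_A; f_A)`, where `f_A = (f(aᵢ))ᵢ` and
`y_A = (f(aᵢ) + εᵢ)ᵢ`; the points `aᵢ` need not be distinct. -/
def maxInfoGain (P : Measure Ω) (f : X → Ω → ℝ) (ε : ℕ → Ω → ℝ) (T : ℕ) : ℝ :=
  (⨆ A : Fin T → X,
    mutualInfo P (fun ω (i : Fin T) => f (A i) ω + ε i ω) (fun ω i => f (A i) ω)).toReal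

end Model

/-! ### Continuous domains -/

/-- `X ⊆ [0, r]^d` is compact and convex, almost every sample path is differentiable on `X`
(`G ω x` is its gradient relative to `X`), and the suprema `L_j = sup_{x ∈ X} |∂f/∂x_j|` satisfy
`Pr(L_j > c) ≤ a exp(-(c/b)²)`. -/
structure SmoothDomain {d : ℕ} (X : Set (EuclideanSpace ℝ (Fin d))) {Ω : Type*}
    [MeasurableSpace Ω] (P : Measure Ω) (f : X → Ω → ℝ) (r a b : ℝ) : Prop where
  r_pos : 0 < r
  one_le_a : 1 ≤ a
  b_pos : 0 < b
  subset_cube : ∀ x ∈ X, ∀ j, x j ∈ Set.Icc 0 r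
  compact : IsCompact X
  convex : Convex ℝ X
  smooth : ∃ G : Ω → X → EuclideanSpace ℝ (Fin d),
    (∀ᵐ ω ∂P, ∀ x : X,
      (fun y : X => f y ω - f x ω - inner ℝ (G ω x) ((y : EuclideanSpace ℝ (Fin d)) - x))
        =o[𝓝 x] fun y : X => (y : EuclideanSpace ℝ (Fin d)) - x) ∧
    ∀ j : Fin d, ∀ c : ℝ, 0 < c →
      P {ω | ∃ x : X, c < |G ω x j|} ≤ ENNReal.ofReal (a * Real.exp (-(c / b) ^ 2))

/-- `β_t = 2 log(N t² / √(2π) + 1)` for a domain with `N` points. -/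
def betaFinite (N t : ℕ) : ℝ :=
  2 * Real.log (N * (t : ℝ) ^ 2 / Real.sqrt (2 * Real.pi) + 1)

/-- `β_t = 2 d log ⌈b d r t² (√(log(a d)) + √π / 2)⌉ + 2 log(t² / √(2π) + 1)`. -/
def betaContinuous (d : ℕ) (r a b : ℝ) (t : ℕ) : ℝ :=
  2 * d * Real.log
      (⌈b * d * r * (t : ℝ) ^ 2 * (Real.sqrt (Real.log (a * d)) + Real.sqrt Real.pi / 2)⌉₊ : ℝ)
    + 2 * Real.log ((t : ℝ) ^ 2 / Real.sqrt (2 * Real.pi) + 1)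

end BayesOpt

end

/-!
Write `μₙ`, `σₙ` for the posterior mean and standard deviation after `n` observations,
`Uₙ = μₙ + √β σₙ` for the upper confidence bound, `xₙ` for the query chosen from these observations
and `bₙ` for the reference value, the largest posterior mean at an evaluated point.

The scaled expected improvement at `z` is `√β σₙ(z) τ((μₙ(z) - bₙ) / (√β σₙ(z)))`, and
`τ(c) = E (c + Z)₊ ≥ P(Z ≥ 1) (c + 1)` for a standard Gaussian `Z`. So the improvement at `z` is at
least a constant times `Uₙ(z) - bₙ`, and the maximizer `xₙ` satisfies, for every `z`,
`Uₙ(z) - μₙ(xₙ) ≲ √β σₙ(xₙ) (1 + √(log n)) + (μₙ(xₙ) - bₙ)₊`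
(`IsCenteredGP.ucb_sub_postMean_le`). The factor `√(log n)` accounts for `μₙ(xₙ)` lying below `bₙ`:
comparing `xₙ` with the evaluated point where `bₙ` is attained, and whose posterior variance is
still at least of order `1 / n`, limits how far below it can be.

Three sums remain to be controlled.

* The terms `(μₙ(xₙ) - bₙ)₊` telescope in expectation. The larger of `μₙ(xₙ)` and `bₙ` is the
  posterior mean at a point that will have been evaluated one step later, and posterior means keep
  their expectation, so `E max(μₙ(xₙ), bₙ) ≤ E bₙ₊₁`
  (`IsGPModel.integral_max_le_integral_policyBest`). The total is at most `E max f ≲ √β`.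
* By the Cauchy–Schwarz inequality, `∑ σₙ(xₙ)` is at most `√(T ∑ σₙ(xₙ)²)`, and `∑ σₙ(xₙ)²` is
  bounded by the information gain of the queried points, because the information gain of a design is
  exactly `½ ∑ log(1 + σᵢ² / v)` (`IsNoisyModel.mutualInfo_eq`).
* The difference between `f(x*)` and the largest `Uₙ(z)` is controlled on a finite set `A` that
  discretizes the domain up to an error of mean at most `t⁻²`: given the data, `f(z)` is
  `N(μₙ(z), σₙ(z)²)`, so that `E (f(z) - Uₙ(z))₊ ≤ φ(√β)`, and `β` is chosen such that
  `|A| φ(√β) ≤ t⁻²` (`domain_properties`). For a domain in `ℝᵈ` the set `A` is a grid, and the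
  discretization error is governed by the Lipschitz constant of the paths, whose mean follows from
  the tail bound on the partial derivatives.

The probabilistic core is that the posterior formulas remain valid for adaptively chosen queries
(`IsNoisyModel.lintegral_posterior`). This is Bayes' formula: given the seed, the joint law of the
objective and the observations has as its density the same Gaussian likelihood as for a fixed
design (`IsNoisyModel.lintegral_policyHist`), and for a fixed design the residual
`f(z) - μₙ(z)` is a Gaussian variable independent of the observations. So that the value of a path
at a random point is measurable, a continuous path is encoded by its values on a dense sequence
(`denseEval`).
-/

noncomputable section

namespace BayesOpt

/-! ### The function `τ` and Gaussian tails -/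

lemma gaussianPDFReal_std (z : ℝ) :
    gaussianPDFReal 0 1 z = (√(2 * Real.pi))⁻¹ * Real.exp (-z ^ 2 / 2) := by
  simp [gaussianPDFReal]

lemma gaussianPDFReal_std_zero : gaussianPDFReal 0 1 0 = (√(2 * Real.pi))⁻¹ := by
  simp [gaussianPDFReal_std]

lemma gaussianPDFReal_std_le (z : ℝ) : gaussianPDFReal 0 1 z ≤ gaussianPDFReal 0 1 0 := by
  rw [gaussianPDFReal_std_zero, gaussianPDFReal_std]
  refine mul_le_of_le_one_right (by positivity) (Real.exp_le_one_iff.2 ?_)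
  nlinarith [sq_nonneg z]

lemma hasDerivAt_neg_gaussianPDFReal_std (z : ℝ) :
    HasDerivAt (fun z => -gaussianPDFReal 0 1 z) (gaussianPDFReal 0 1 z * z) z := by
  simp only [gaussianPDFReal_std]
  have h : HasDerivAt (fun z : ℝ => -z ^ 2 / 2) (-z) z := by
    have := ((hasDerivAt_pow 2 z).neg).div_const 2
    exact this.congr_deriv (by simp; ring)
  have := ((h.exp).const_mul (√(2 * Real.pi))⁻¹).neg
  exact this.congr_deriv (by ring)

lemma tendsto_neg_gaussianPDFReal_std_atTop :
    Tendsto (fun z => -gaussianPDFReal 0 1 z) atTop (𝓝 0) := by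
  have h1 : Tendsto (fun z : ℝ => -z ^ 2 / 2) atTop atBot := by
    have : Tendsto (fun z : ℝ => z ^ 2 / 2) atTop atTop :=
      (tendsto_pow_atTop two_ne_zero).atTop_div_const two_pos
    exact (tendsto_neg_atTop_atBot.comp this).congr fun z => by simp [neg_div]
  have h2 := ((Real.tendsto_exp_atBot.comp h1).const_mul (√(2 * Real.pi))⁻¹).neg
  simpa [gaussianPDFReal_std, Function.comp_def] using h2

lemma integrable_gaussianPDFReal_std_mul_id :
    Integrable (fun z => gaussianPDFReal 0 1 z * z) := by
  have h : Integrable (fun z : ℝ => z) (gaussianReal 0 1) :=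
    (memLp_id_gaussianReal 1).integrable le_rfl
  rw [gaussianReal_of_var_ne_zero _ one_ne_zero,
    integrable_withDensity_iff_integrable_smul' (by fun_prop)
      (Eventually.of_forall fun _ => gaussianPDF_lt_top)] at h
  simpa using h

/-- The partial first moment `∫_{z > a} z φ(z) dz = φ(a)` of the standard Gaussian. -/
lemma setIntegral_Ioi_gaussianPDFReal_std_mul_id (a : ℝ) :
    ∫ z in Set.Ioi a, gaussianPDFReal 0 1 z * z = gaussianPDFReal 0 1 a := by
  have := integral_Ioi_of_hasDerivAt_of_tendsto (a := a)
    (hasDerivAt_neg_gaussianPDFReal_std a).continuousAt.continuousWithinAt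
    (fun z _ => hasDerivAt_neg_gaussianPDFReal_std z)
    integrable_gaussianPDFReal_std_mul_id.integrableOn tendsto_neg_gaussianPDFReal_std_atTop
  simpa using this

lemma setIntegral_Ioi_gaussianPDFReal_std (c : ℝ) :
    ∫ z in Set.Ioi (-c), gaussianPDFReal 0 1 z = cdf (gaussianReal 0 1) c := by
  have h1 := gaussianReal_apply_eq_integral 0 one_ne_zero (Set.Ioi (-c))
  have h2 : gaussianReal 0 1 (Set.Ioi (-c)) = gaussianReal 0 1 (Set.Iic c) := by
    have hn := gaussianReal_map_neg (μ := 0) (v := 1)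
    have := nullSingletonClass_gaussianReal (μ := 0) (v := 1) one_ne_zero
    rw [neg_zero] at hn
    conv_lhs => rw [← hn, Measure.map_apply (by fun_prop) measurableSet_Ioi]
    rw [← measure_congr Iio_ae_eq_Iic]
    congr 1
    ext z; simp
  rw [cdf_eq_real, Measure.real, ← h2, h1, ENNReal.toReal_ofReal]
  exact integral_nonneg fun z => gaussianPDFReal_nonneg _ _ _

lemma integrable_max_add_gaussianReal (c : ℝ) :
    Integrable (fun z => max (c + z) 0) (gaussianReal 0 1) := by
  have h : Integrable (fun z : ℝ => z) (gaussianReal 0 1) :=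
    (memLp_id_gaussianReal 1).integrable le_rfl
  exact ((integrable_const c).add h).pos_part

/-- `τ(c) = E (c + Z)₊` for a standard Gaussian `Z`. -/
lemma tau_eq_integral (c : ℝ) : tau c = ∫ z, max (c + z) 0 ∂(gaussianReal 0 1) := by
  rw [integral_gaussianReal_eq_integral_smul one_ne_zero]
  have h1 : (fun z => gaussianPDFReal 0 1 z • max (c + z) 0) =
      Set.indicator (Set.Ioi (-c))
        (fun z => c * gaussianPDFReal 0 1 z + gaussianPDFReal 0 1 z * z) := by
    ext z
    by_cases hz : z ∈ Set.Ioi (-c)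
    · rw [Set.indicator_of_mem hz, max_eq_left (by linarith [Set.mem_Ioi.1 hz]), smul_eq_mul]
      ring
    · rw [Set.indicator_of_notMem hz, max_eq_right (by linarith [not_lt.1 (Set.mem_Ioi.not.1 hz)]),
        smul_zero]
  rw [h1, integral_indicator measurableSet_Ioi, integral_add
    ((integrable_gaussianPDFReal 0 1).const_mul c).integrableOn
    integrable_gaussianPDFReal_std_mul_id.integrableOn, integral_const_mul,
    setIntegral_Ioi_gaussianPDFReal_std, setIntegral_Ioi_gaussianPDFReal_std_mul_id, tau]
  simp [gaussianPDFReal_std]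

lemma tau_zero : tau 0 = gaussianPDFReal 0 1 0 := by simp [tau]

lemma tau_le_of_nonpos {c : ℝ} (hc : c ≤ 0) : tau c ≤ gaussianPDFReal 0 1 c := by
  have := mul_nonpos_of_nonpos_of_nonneg hc (cdf_nonneg (gaussianReal 0 1) c)
  unfold tau; linarith

lemma tau_le_of_nonneg {c : ℝ} (hc : 0 ≤ c) : tau c ≤ c + gaussianPDFReal 0 1 0 := by
  have := mul_le_of_le_one_right hc (cdf_le_one (gaussianReal 0 1) c)
  have := gaussianPDFReal_std_le c
  unfold tau; linarith

/-- The upper tail probability `P(Z ≥ 1)` of a standard Gaussian, which links `τ` to the upper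
confidence bound. -/
def upperTail : ℝ := (gaussianReal 0 1).real (Set.Ici 1)

lemma upperTail_pos : 0 < upperTail := by
  refine ENNReal.toReal_pos (fun h => ?_) (measure_ne_top _ _)
  have := gaussianReal_absolutelyContinuous' 0 one_ne_zero h
  simp at this

/-- On the event `Z ≥ 1` one has `(c + Z)₊ ≥ c + 1`. -/
lemma upperTail_mul_le_tau (c : ℝ) : upperTail * (c + 1) ≤ tau c := by
  rw [tau_eq_integral]
  have h1 : ∫ z, (Set.Ici (1 : ℝ)).indicator (fun _ => c + 1) z ∂(gaussianReal 0 1) =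
      upperTail * (c + 1) := by
    rw [integral_indicator_const _ measurableSet_Ici, smul_eq_mul, upperTail]
  rw [← h1]
  refine integral_mono ((integrable_const _).indicator measurableSet_Ici)
    (integrable_max_add_gaussianReal c) fun z => ?_
  by_cases hz : z ∈ Set.Ici (1 : ℝ)
  · simp only [Set.indicator_of_mem hz]
    exact le_max_of_le_left (by linarith [Set.mem_Ici.1 hz])
  · simp only [Set.indicator_of_notMem hz]
    exact le_max_right _ _

/-- The expected excess of a Gaussian variable with mean `m` and standard deviation `s` over
`m + w s`. -/
lemma lintegral_excess_le (m : ℝ) {s w : ℝ} (hs : 0 ≤ s) (hw : 0 ≤ w) :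
    ∫⁻ ζ, ENNReal.ofReal (m + s * ζ - (m + w * s)) ∂(gaussianReal 0 1) ≤
      ENNReal.ofReal (s * gaussianPDFReal 0 1 w) := by
  have h1 : ∀ ζ : ℝ, ENNReal.ofReal (m + s * ζ - (m + w * s)) =
      ENNReal.ofReal (s * max (-w + ζ) 0) := by
    intro ζ
    rw [mul_max_of_nonneg _ _ hs, mul_zero, ENNReal.ofReal_max, ENNReal.ofReal_zero,
      max_eq_left (zero_le)]
    congr 1; ring
  simp_rw [h1]
  rw [← ofReal_integral_eq_lintegral_ofReal ((integrable_max_add_gaussianReal _).const_mul s)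
    (Eventually.of_forall fun ζ => mul_nonneg hs (le_max_right _ _)), integral_const_mul,
    ← tau_eq_integral]
  refine ENNReal.ofReal_le_ofReal (mul_le_mul_of_nonneg_left ?_ hs)
  refine (tau_le_of_nonpos (neg_nonpos.2 hw)).trans_eq ?_
  simp [gaussianPDFReal_std]

/-! ### The posterior as linear regression -/

section PosteriorAlgebra

variable {X Ω : Type*} [MeasurableSpace Ω] {P : Measure Ω} {k : X → X → ℝ} {v : ℝ≥0}
  {f : X → Ω → ℝ} {n : ℕ}

/-- The coefficients `w` of the posterior mean `μₙ(z) = ∑ wᵢ yᵢ` as a linear form in the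
observations. -/
def postWeight (k : X → X → ℝ) (v : ℝ≥0) (pts : Fin n → X) (z : X) : Fin n → ℝ :=
  Matrix.mulVec (kernelMat k pts + (v : ℝ) • (1 : Matrix (Fin n) (Fin n) ℝ))⁻¹ (kernelVec k pts z)

namespace IsCenteredGP

lemma kernel_comm (h : IsCenteredGP P k f) (z z' : X) : k z z' = k z' z := by
  rw [← h.covariance, ← h.covariance, covariance_comm]

lemma memLp_two (h : IsCenteredGP P k f) (z : X) : MemLp (f z) 2 P :=
  (h.gaussian.hasGaussianLaw_eval z).memLp_two

lemma integrable (h : IsCenteredGP P k f) (z : X) : Integrable (f z) P :=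
  (h.gaussian.hasGaussianLaw_eval z).integrable

lemma integral_sq (h : IsCenteredGP P k f) (z : X) : ∫ ω, f z ω ^ 2 ∂P = k z z := by
  rw [← h.covariance z z, ProbabilityTheory.covariance]
  simp [h.mean_zero, sq]

/-- Covariance of a linear combination of values of the process with a square integrable
variable. -/
lemma cov_sub_sum (h : IsCenteredGP P k f) (w : Fin n → ℝ) (pts : Fin n → X) (z : X) {Y : Ω → ℝ}
    (hY : MemLp Y 2 P) :
    cov[fun ω => f z ω - ∑ i, w i * f (pts i) ω, Y; P] =
      cov[f z, Y; P] - ∑ i, w i * cov[f (pts i), Y; P] := by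
  have := h.gaussian.isProbabilityMeasure
  rw [covariance_fun_sub_left (h.memLp_two z)
    (memLp_finsetSum _ fun _ _ => (h.memLp_two _).const_mul _) hY,
    covariance_fun_sum_left (fun i => (h.memLp_two _).const_mul _) hY]
  simp_rw [covariance_const_mul_left]

lemma memLp_sub_sum (h : IsCenteredGP P k f) (w : Fin n → ℝ) (pts : Fin n → X) (z : X) :
    MemLp (fun ω => f z ω - ∑ i, w i * f (pts i) ω) 2 P :=
  (h.memLp_two z).sub (memLp_finsetSum _ fun _ _ => (h.memLp_two _).const_mul _)

lemma posSemidef_kernelMat (h : IsCenteredGP P k f) (pts : Fin n → X) :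
    (kernelMat k pts).PosSemidef := by
  have := h.gaussian.isProbabilityMeasure
  refine .of_dotProduct_mulVec_nonneg (Matrix.IsHermitian.ext fun i j => ?_) fun x => ?_
  · simp [kernelMat, h.kernel_comm (pts i)]
  · have hm : ∀ i, MemLp (fun ω => x i * f (pts i) ω) 2 P := fun i => (h.memLp_two _).const_mul _
    have h1 : star x ⬝ᵥ (kernelMat k pts).mulVec x =
        Var[fun ω => ∑ i, x i * f (pts i) ω; P] := by
      rw [← covariance_self (memLp_finsetSum _ fun i _ => hm i).aemeasurable,
        covariance_fun_sum_fun_sum hm hm]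
      simp only [covariance_const_mul_left, covariance_const_mul_right, h.covariance,
        dotProduct, Matrix.mulVec, kernelMat, Matrix.of_apply, Finset.mul_sum, Pi.star_apply,
        star_trivial]
      exact Finset.sum_congr rfl fun i _ => Finset.sum_congr rfl fun j _ => by ring
    rw [h1]
    exact variance_nonneg _ _

lemma posDef_noisyMat (h : IsCenteredGP P k f) (hv : 0 < v) (pts : Fin n → X) :
    (kernelMat k pts + (v : ℝ) • (1 : Matrix (Fin n) (Fin n) ℝ)).PosDef :=
  Matrix.PosDef.posSemidef_add (h.posSemidef_kernelMat pts)
    (Matrix.PosDef.one.smul (a := (v : ℝ)) (by exact_mod_cast hv))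

lemma noisyMat_mulVec_postWeight (h : IsCenteredGP P k f) (hv : 0 < v) (pts : Fin n → X) (z : X)
    (i : Fin n) :
    ∑ j, postWeight k v pts z j * k (pts j) (pts i) + v * postWeight k v pts z i =
      k z (pts i) := by
  have hu := (Matrix.isUnit_iff_isUnit_det _).1 (h.posDef_noisyMat hv pts).isUnit
  have h1 : (kernelMat k pts + (v : ℝ) • (1 : Matrix (Fin n) (Fin n) ℝ)).mulVec
      (postWeight k v pts z) = kernelVec k pts z := by
    rw [postWeight, Matrix.mulVec_mulVec, Matrix.mul_nonsing_inv _ hu, Matrix.one_mulVec]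
  have h2 := congrFun h1 i
  rw [Matrix.add_mulVec, Matrix.smul_mulVec, Matrix.one_mulVec] at h2
  simp only [Pi.add_apply, Pi.smul_apply, smul_eq_mul, kernelVec, Matrix.mulVec, dotProduct,
    kernelMat, Matrix.of_apply] at h2
  rw [← h2]
  congr 1
  exact Finset.sum_congr rfl fun j _ => by rw [mul_comm, h.kernel_comm]

lemma postMean_eq_sum (h : IsCenteredGP P k f) (hv : 0 < v) (pts : Fin n → X) (y : Fin n → ℝ)
    (z : X) : postMean k v pts y z = ∑ i, postWeight k v pts z i * y i := by
  have hH := (h.posDef_noisyMat hv pts).inv.isHermitian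
  rw [postMean, Matrix.dotProduct_mulVec, ← Matrix.mulVec_transpose]
  have ht := hH.eq
  rw [Matrix.conjTranspose_eq_transpose_of_trivial] at ht
  rw [ht]
  rfl

lemma postVar_eq (h : IsCenteredGP P k f) (pts : Fin n → X) (z : X) :
    postVar k v pts z = k z z - ∑ i, postWeight k v pts z i * k (pts i) z := by
  rw [postVar, postWeight, dotProduct]
  congr 1
  exact Finset.sum_congr rfl fun j _ => by rw [mul_comm, kernelVec, h.kernel_comm]

/-- The variance of the noise-free residual `f(z) - ∑ wᵢ f(xᵢ)`, together with the variance of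
`∑ wᵢ εᵢ`, is the posterior variance. -/
lemma variance_residual (h : IsCenteredGP P k f) (hv : 0 < v) (pts : Fin n → X) (z : X) :
    ∫ ω, (f z ω - ∑ i, postWeight k v pts z i * f (pts i) ω) ^ 2 ∂P +
      v * ∑ i, postWeight k v pts z i ^ 2 = postVar k v pts z := by
  have := h.gaussian.isProbabilityMeasure
  set w := postWeight k v pts z
  have hR := h.memLp_sub_sum w pts z
  have hmean : ∫ ω, (f z ω - ∑ i, w i * f (pts i) ω) ∂P = 0 := by
    rw [integral_sub (h.integrable z)
        (integrable_finsetSum _ fun i _ => (h.integrable _).const_mul _),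
      integral_finsetSum _ fun i _ => (h.integrable _).const_mul _]
    simp [integral_const_mul, h.mean_zero]
  have h1 : ∫ ω, (f z ω - ∑ i, w i * f (pts i) ω) ^ 2 ∂P =
      cov[fun ω => f z ω - ∑ i, w i * f (pts i) ω,
        fun ω => f z ω - ∑ i, w i * f (pts i) ω; P] := by
    rw [ProbabilityTheory.covariance]
    simp only [hmean, sub_zero, sq]
  have hc : ∀ x, cov[f x, fun ω => f z ω - ∑ i, w i * f (pts i) ω; P] =
      k z x - ∑ i, w i * k (pts i) x := fun x => by
    rw [covariance_comm, h.cov_sub_sum w pts z (h.memLp_two x)]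
    simp_rw [h.covariance]
  have hw : ∀ j, k z (pts j) - ∑ i, w i * k (pts i) (pts j) = v * w j := fun j => by
    rw [← h.noisyMat_mulVec_postWeight hv pts z j]; ring
  rw [h1, h.cov_sub_sum w pts z hR]
  simp_rw [hc, hw]
  rw [h.postVar_eq pts z, Finset.mul_sum]
  have : ∑ i, w i * (↑v * w i) = ∑ i, ↑v * w i ^ 2 := Finset.sum_congr rfl fun i _ => by ring
  rw [this]
  ring

lemma postVar_nonneg (h : IsCenteredGP P k f) (hv : 0 < v) (pts : Fin n → X) (z : X) :
    0 ≤ postVar k v pts z := by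
  rw [← h.variance_residual hv pts z]
  exact add_nonneg (integral_nonneg fun _ => sq_nonneg _)
    (mul_nonneg v.2 (Finset.sum_nonneg fun _ _ => sq_nonneg _))

lemma postVar_le (h : IsCenteredGP P k f) (hv : 0 < v) (pts : Fin n → X) (z : X) :
    postVar k v pts z ≤ k z z := by
  have := (h.posDef_noisyMat hv pts).inv.posSemidef.dotProduct_mulVec_nonneg (kernelVec k pts z)
  rw [star_trivial] at this
  unfold postVar
  linarith

/-- Noisy observation of `n` variables of variance at most `1` cannot reduce the variance of `f(z)`
below `k(z, z) v / (v + n)`: by the Cauchy–Schwarz inequality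
`(R + ∑ wᵢ fᵢ)² ≤ (1 + n / v) (R² + v ∑ wᵢ² fᵢ²)`. -/
lemma le_postVar (h : IsCenteredGP P k f) (hv : 0 < v) (hk : ∀ z, k z z ≤ 1) (pts : Fin n → X)
    (z : X) : k z z * v / (v + n) ≤ postVar k v pts z := by
  have := h.gaussian.isProbabilityMeasure
  have hv' : (0 : ℝ) < v := by exact_mod_cast hv
  set w := postWeight k v pts z with hw
  set R : Ω → ℝ := fun ω => f z ω - ∑ i, w i * f (pts i) ω with hR
  have key : ∀ ω, f z ω ^ 2 ≤ (1 + n / v) * (R ω ^ 2 + v * ∑ i, w i ^ 2 * f (pts i) ω ^ 2) := by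
    intro ω
    set S := ∑ i, w i * f (pts i) ω with hS
    set Q := ∑ i, w i ^ 2 * f (pts i) ω ^ 2 with hQ
    have hQ0 : 0 ≤ Q := Finset.sum_nonneg fun _ _ => by positivity
    have hSQ : S ^ 2 ≤ n * Q := by
      have := sq_sum_le_card_mul_sum_sq (s := Finset.univ) (f := fun i => w i * f (pts i) ω)
      simpa [mul_pow] using this
    have hf : f z ω = R ω + S := by simp [hR, hS]
    -- the arithmetic and geometric means of `v Q` and `n R² / v`
    have h1 : 2 * R ω * S ≤ v * Q + n / v * R ω ^ 2 := by
      refine le_of_sq_le_sq ?_ (by positivity)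
      have h2 : R ω ^ 2 * S ^ 2 ≤ R ω ^ 2 * (n * Q) := mul_le_mul_of_nonneg_left hSQ (sq_nonneg _)
      have h3 : 4 * (v * Q) * (n / v * R ω ^ 2) = 4 * (R ω ^ 2 * (n * Q)) := by field_simp
      nlinarith [sq_nonneg (v * Q - n / v * R ω ^ 2)]
    have h4 : (1 + n / v) * (R ω ^ 2 + v * Q) = R ω ^ 2 + n * Q + (v * Q + n / v * R ω ^ 2) := by
      field_simp; ring
    rw [hf, h4]
    nlinarith
  have hi : ∀ x, Integrable (fun ω => f x ω ^ 2) P := fun x => (h.memLp_two x).integrable_sq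
  have hiR : Integrable (fun ω => R ω ^ 2) P := (h.memLp_sub_sum w pts z).integrable_sq
  have hiS : Integrable (fun ω => ∑ i, w i ^ 2 * f (pts i) ω ^ 2) P :=
    integrable_finsetSum _ fun i _ => (hi _).const_mul _
  have h1 := integral_mono (hi z) ((hiR.add (hiS.const_mul v)).const_mul (1 + n / v)) key
  simp only [Pi.add_apply] at h1
  rw [h.integral_sq, integral_const_mul, integral_add hiR (hiS.const_mul v), integral_const_mul,
    integral_finsetSum _ fun i _ => (hi _).const_mul _] at h1
  simp_rw [integral_const_mul, h.integral_sq] at h1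
  have h2 : ∑ i, w i ^ 2 * k (pts i) (pts i) ≤ ∑ i, w i ^ 2 :=
    Finset.sum_le_sum fun i _ => mul_le_of_le_one_right (sq_nonneg _) (hk _)
  have h3 : k z z ≤ (1 + n / v) * postVar k v pts z := by
    rw [← h.variance_residual hv pts z]
    refine h1.trans (mul_le_mul_of_nonneg_left ?_ (by positivity))
    exact add_le_add_right (mul_le_mul_of_nonneg_left h2 hv'.le) _
  rw [div_le_iff₀ (by positivity)]
  calc k z z * v ≤ (1 + n / v) * postVar k v pts z * v := mul_le_mul_of_nonneg_right h3 hv'.le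
    _ = postVar k v pts z * (v + n) := by field_simp

end IsCenteredGP

end PosteriorAlgebra

section Measurability

variable {T X : Type*} [MeasurableSpace T] {n : ℕ}

lemma measurable_matrix_inv_apply {A : T → Matrix (Fin n) (Fin n) ℝ}
    (hA : ∀ i j, Measurable fun t => A t i j) (i j : Fin n) : Measurable fun t => (A t)⁻¹ i j := by
  have hA' : Measurable fun t (i j : Fin n) => A t i j :=
    measurable_pi_lambda _ fun i => measurable_pi_lambda _ fun j => hA i j
  have hM : Continuous fun M : Fin n → Fin n → ℝ => Matrix.of M := continuous_id
  have h1 : Measurable fun t => (A t).det := hM.matrix_det.measurable.comp hA'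
  have h2 : Measurable fun t => (A t).adjugate i j :=
    (hM.matrix_adjugate.matrix_elem i j).measurable.comp hA'
  simp_rw [Matrix.inv_def, Matrix.smul_apply, Ring.inverse_eq_inv', smul_eq_mul]
  exact h1.inv.mul h2

variable [MeasurableSpace X] {k : X → X → ℝ} {v : ℝ≥0}

lemma measurable_noisyMat_inv_apply (hk : Measurable (Function.uncurry k)) {pts : T → Fin n → X}
    (hp : ∀ i, Measurable fun t => pts t i) (i j : Fin n) :
    Measurable fun t =>
      (kernelMat k (pts t) + (v : ℝ) • (1 : Matrix (Fin n) (Fin n) ℝ))⁻¹ i j := by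
  refine measurable_matrix_inv_apply (fun i j => ?_) i j
  simp only [kernelMat, Matrix.add_apply, Matrix.of_apply]
  exact (hk.comp ((hp i).prodMk (hp j))).add_const _

lemma measurable_postMean (hk : Measurable (Function.uncurry k)) {pts : T → Fin n → X}
    (hp : ∀ i, Measurable fun t => pts t i) {y : T → Fin n → ℝ} (hy : Measurable y) {z : T → X}
    (hz : Measurable z) : Measurable fun t => postMean k v (pts t) (y t) (z t) := by
  have h1 := measurable_noisyMat_inv_apply (v := v) hk hp
  have h2 : ∀ i, Measurable fun t => k (z t) (pts t i) := fun i => hk.comp (hz.prodMk (hp i))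
  simp only [postMean, dotProduct, Matrix.mulVec, kernelVec]
  exact Finset.measurable_sum _ fun i _ => (h2 i).mul
    (Finset.measurable_sum _ fun j _ => (h1 i j).mul ((measurable_pi_apply j).comp hy))

lemma measurable_postVar (hk : Measurable (Function.uncurry k)) {pts : T → Fin n → X}
    (hp : ∀ i, Measurable fun t => pts t i) {z : T → X}
    (hz : Measurable z) : Measurable fun t => postVar k v (pts t) (z t) := by
  have h1 := measurable_noisyMat_inv_apply (v := v) hk hp
  have h2 : ∀ i, Measurable fun t => k (z t) (pts t i) := fun i => hk.comp (hz.prodMk (hp i))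
  have h3 : Measurable fun t => k (z t) (z t) := hk.comp (hz.prodMk hz)
  simp only [postVar, dotProduct, Matrix.mulVec, kernelVec]
  exact h3.sub (Finset.measurable_sum _ fun i _ => (h2 i).mul
    (Finset.measurable_sum _ fun j _ => (h1 i j).mul (h2 j)))

lemma measurable_postSd (hk : Measurable (Function.uncurry k)) {pts : T → Fin n → X}
    (hp : ∀ i, Measurable fun t => pts t i) {z : T → X}
    (hz : Measurable z) : Measurable fun t => postSd k v (pts t) (z t) :=
  (measurable_postVar hk hp hz).sqrt

end Measurability

/-! ### The law of adaptively collected data -/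

section AdaptiveLaw

variable {X E S Ω : Type*}

/-- The observations obtained when the query at time `n` is `π n` of the seed and of the earlier
observations, and `F z e` is the value at `z` of the objective encoded by `e`. -/
def policyObs (F : X → E → ℝ) (π : ∀ n : ℕ, S × (Fin n → ℝ) → X) (g : Ω → E) (ξ : Ω → S)
    (ε : ℕ → Ω → ℝ) (n : ℕ) (ω : Ω) : ℝ :=
  F (π n (ξ ω, fun i : Fin n => policyObs F π g ξ ε i ω)) (g ω) + ε n ω
termination_by n
decreasing_by exact i.2

/-- The queries that the policy `π` makes when it sees the seed `s` and the observations `y`. -/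
def policyDesign {n : ℕ} (π : ∀ n : ℕ, S × (Fin n → ℝ) → X) (s : S) (y : Fin n → ℝ) : Fin n → X :=
  fun i => π i (s, fun j => y (Fin.castLE i.2.le j))

/-- The Gaussian likelihood of the observations `y` at the points `a` for the objective encoded
by `e`. -/
def gaussLik (v : ℝ≥0) (F : X → E → ℝ) {n : ℕ} (a : Fin n → X) (y : Fin n → ℝ) (e : E) : ℝ≥0∞ :=
  ∏ i, gaussianPDF (F (a i) e) v (y i)

lemma policyDesign_snoc_castSucc {n : ℕ} (π : ∀ n : ℕ, S × (Fin n → ℝ) → X) (s : S) (y : Fin n → ℝ)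
    (u : ℝ) (i : Fin n) :
    policyDesign π s (Fin.snoc y u : Fin (n + 1) → ℝ) i.castSucc = policyDesign π s y i := by
  have : (fun j : Fin i => (Fin.snoc y u : Fin (n + 1) → ℝ)
      (Fin.castLE i.castSucc.2.le j)) = fun j => y (Fin.castLE i.2.le j) := by
    funext j
    exact Fin.snoc_castSucc (α := fun _ => ℝ) u y (Fin.castLE i.2.le j)
  exact congrArg (fun q => π i (s, q)) this

lemma policyDesign_snoc_last {n : ℕ} (π : ∀ n : ℕ, S × (Fin n → ℝ) → X) (s : S) (y : Fin n → ℝ)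
    (u : ℝ) :
    policyDesign π s (Fin.snoc y u : Fin (n + 1) → ℝ) (Fin.last n) = π n (s, y) := by
  have : (fun j : Fin n => (Fin.snoc y u : Fin (n + 1) → ℝ)
      (Fin.castLE (Fin.last n).2.le j)) = y := by
    funext j
    exact Fin.snoc_castSucc (α := fun _ => ℝ) u y j
  exact congrArg (fun q => π n (s, q)) this

lemma gaussLik_snoc {n : ℕ} (v : ℝ≥0) (F : X → E → ℝ) (π : ∀ n : ℕ, S × (Fin n → ℝ) → X) (s : S)
    (y : Fin n → ℝ) (u : ℝ) (e : E) :
    gaussLik v F (policyDesign π s (Fin.snoc y u : Fin (n + 1) → ℝ)) (Fin.snoc y u) e =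
      gaussLik v F (policyDesign π s y) y e * gaussianPDF (F (π n (s, y)) e) v u := by
  simp only [gaussLik, Fin.prod_univ_castSucc, policyDesign_snoc_castSucc, policyDesign_snoc_last,
    Fin.snoc_castSucc, Fin.snoc_last]

/-- The vector of the first `n` observations. -/
def policyHist (F : X → E → ℝ) (π : ∀ n : ℕ, S × (Fin n → ℝ) → X) (g : Ω → E) (ξ : Ω → S)
    (ε : ℕ → Ω → ℝ) (n : ℕ) (ω : Ω) : Fin n → ℝ :=
  fun i => policyObs F π g ξ ε i ω

lemma policyHist_succ (F : X → E → ℝ) (π : ∀ n : ℕ, S × (Fin n → ℝ) → X) (g : Ω → E) (ξ : Ω → S)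
    (ε : ℕ → Ω → ℝ) (n : ℕ) (ω : Ω) :
    policyHist F π g ξ ε (n + 1) ω = Fin.snoc (policyHist F π g ξ ε n ω)
      (F (π n (ξ ω, policyHist F π g ξ ε n ω)) (g ω) + ε n ω) := by
  funext i
  refine Fin.lastCases ?_ (fun i => ?_) i
  · rw [Fin.snoc_last]
    simp only [policyHist, Fin.val_last]
    rw [policyObs]
    rfl
  · rw [Fin.snoc_castSucc]
    rfl

lemma measurable_finSnoc (n : ℕ) :
    Measurable fun p : (Fin n → ℝ) × ℝ => (Fin.snoc p.1 p.2 : Fin (n + 1) → ℝ) := by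
  refine measurable_pi_lambda _ fun i => ?_
  refine Fin.lastCases ?_ (fun i => ?_) i
  · simpa using measurable_snd
  · simpa [Function.comp_def] using (measurable_pi_apply i).comp measurable_fst

variable [MeasurableSpace X] [MeasurableSpace E] [MeasurableSpace S]

lemma measurable_policyDesign {n : ℕ} {π : ∀ n : ℕ, S × (Fin n → ℝ) → X}
    (hπ : ∀ n, Measurable (π n)) (i : Fin n) :
    Measurable fun p : S × (Fin n → ℝ) => policyDesign π p.1 p.2 i := by
  refine (hπ i).comp (measurable_fst.prodMk (measurable_pi_lambda _ fun j => ?_))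
  exact (measurable_pi_apply _).comp measurable_snd

lemma measurable_gaussianPDF_comp {T : Type*} [MeasurableSpace T] {v : ℝ≥0} {m u : T → ℝ}
    (hm : Measurable m) (hu : Measurable u) : Measurable fun t => gaussianPDF (m t) v (u t) :=
  measurable_uncurry_gaussianPDF.comp (hm.prodMk (measurable_const.prodMk hu))

lemma measurable_gaussLik {T : Type*} [MeasurableSpace T] {v : ℝ≥0} {F : X → E → ℝ}
    (hF : Measurable (Function.uncurry F)) {n : ℕ} {a : T → Fin n → X}
    (ha : ∀ i, Measurable fun t => a t i) {y : T → Fin n → ℝ} (hy : Measurable y) {e : T → E}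
    (he : Measurable e) : Measurable fun t => gaussLik v F (a t) (y t) (e t) :=
  Finset.measurable_prod _ fun i _ => measurable_gaussianPDF_comp
    (hF.comp ((ha i).prodMk he)) ((measurable_pi_apply i).comp hy)

variable {F : X → E → ℝ} {π : ∀ n : ℕ, S × (Fin n → ℝ) → X}

/-- The first `n` observations are a function of the objective, the seed and the first `n` noise
variables. -/
lemma exists_policyHist_eq (hF : Measurable (Function.uncurry F)) (hπ : ∀ n, Measurable (π n))
    (n : ℕ) : ∃ Ψ : (E × S) × (Fin n → ℝ) → (Fin n → ℝ), Measurable Ψ ∧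
      ∀ (g : Ω → E) (ξ : Ω → S) (ε : ℕ → Ω → ℝ) (ω : Ω),
        policyHist F π g ξ ε n ω = Ψ ((g ω, ξ ω), fun i => ε i ω) := by
  induction n with
  | zero => exact ⟨fun _ => Fin.elim0, measurable_const, fun g ξ ε ω => funext fun i => i.elim0⟩
  | succ n ih =>
    obtain ⟨Ψ, hΨ, h⟩ := ih
    have hr : Measurable fun p : (E × S) × (Fin (n + 1) → ℝ) =>
        Ψ (p.1, fun i => p.2 i.castSucc) :=
      hΨ.comp (measurable_fst.prodMk (measurable_pi_lambda _ fun i =>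
        (measurable_pi_apply _).comp measurable_snd))
    refine ⟨fun p => Fin.snoc (Ψ (p.1, fun i => p.2 i.castSucc))
      (F (π n (p.1.2, Ψ (p.1, fun i => p.2 i.castSucc))) p.1.1 + p.2 (Fin.last n)), ?_, ?_⟩
    · refine (measurable_finSnoc n).comp (hr.prodMk (Measurable.add (hF.comp (Measurable.prodMk
        ((hπ n).comp (Measurable.prodMk (measurable_snd.comp measurable_fst) hr))
        (measurable_fst.comp measurable_fst))) ((measurable_pi_apply _).comp measurable_snd)))
    · intro g ξ ε ω
      rw [policyHist_succ, h]
      rfl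

variable [MeasurableSpace Ω]

/-- An objective encoded by a random element `g`, a seed `ξ` and independent centered Gaussian noise
variables of variance `v`: `g` and `ξ` are independent, the noise is independent of `g`, and each
noise variable is independent of `g`, `ξ` and the earlier noise. -/
structure IsNoisyModel (P : Measure Ω) (v : ℝ≥0) (g : Ω → E) (ξ : Ω → S) (ε : ℕ → Ω → ℝ) :
    Prop where
  measurable_obj : Measurable g
  measurable_seed : Measurable ξ
  measurable_noise : ∀ n, Measurable (ε n)
  noise_law : ∀ n, P.map (ε n) = gaussianReal 0 v
  indep_obj_seed : IndepFun g ξ P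
  iIndep_noise : iIndepFun ε P
  indep_obj_noise : IndepFun g (fun ω n => ε n ω) P
  indep_noise : ∀ n, IndepFun (fun ω => ((g ω, ξ ω), fun i : Fin n => ε i ω)) (ε n) P

variable {P : Measure Ω} {v : ℝ≥0} {g : Ω → E} {ξ : Ω → S} {ε : ℕ → Ω → ℝ}

namespace IsNoisyModel

lemma measurable_policyHist (h : IsNoisyModel P v g ξ ε) (hF : Measurable (Function.uncurry F))
    (hπ : ∀ n, Measurable (π n)) (n : ℕ) : Measurable (policyHist F π g ξ ε n) := by
  obtain ⟨Ψ, hΨ, he⟩ := exists_policyHist_eq (Ω := Ω) hF hπ n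
  rw [show policyHist F π g ξ ε n = fun ω => Ψ ((g ω, ξ ω), fun i => ε i ω) from
    funext fun ω => he g ξ ε ω]
  exact hΨ.comp ((h.measurable_obj.prodMk h.measurable_seed).prodMk
    (measurable_pi_lambda _ fun i => h.measurable_noise i))

variable [IsProbabilityMeasure P]

/-- Integrating out the last noise variable. -/
lemma lintegral_policyHist_noise (h : IsNoisyModel P v g ξ ε)
    (hF : Measurable (Function.uncurry F)) (hπ : ∀ n, Measurable (π n)) (n : ℕ)
    {H : ((E × S) × (Fin n → ℝ)) × ℝ → ℝ≥0∞} (hH : Measurable H) :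
    ∫⁻ ω, H (((g ω, ξ ω), policyHist F π g ξ ε n ω), ε n ω) ∂P =
      ∫⁻ ω, ∫⁻ η, H (((g ω, ξ ω), policyHist F π g ξ ε n ω), η) ∂(gaussianReal 0 v) ∂P := by
  obtain ⟨Ψ, hΨ, he⟩ := exists_policyHist_eq (Ω := Ω) hF hπ n
  have hi : IndepFun (fun ω => ((g ω, ξ ω), policyHist F π g ξ ε n ω)) (ε n) P := by
    have := (h.indep_noise n).comp (measurable_fst.prodMk hΨ) measurable_id
    refine this.congr (Eventually.of_forall fun ω => ?_) .rfl
    simp [he g ξ ε ω]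
  have hm : Measurable fun ω => ((g ω, ξ ω), policyHist F π g ξ ε n ω) :=
    (h.measurable_obj.prodMk h.measurable_seed).prodMk (h.measurable_policyHist hF hπ n)
  have hmap := (indepFun_iff_map_prod_eq_prod_map_map hm.aemeasurable
    (h.measurable_noise n).aemeasurable).1 hi
  rw [← lintegral_map (f := H) hH (hm.prodMk (h.measurable_noise n)), hmap, h.noise_law,
    lintegral_prod _ hH.aemeasurable, lintegral_map hH.lintegral_prod_right' hm]

/-- The joint law of the objective, the seed and the first `n` observations of an adaptive policy:
given the seed, it has the Gaussian likelihood at the queries of the policy as its density with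
respect to the product of the law of the objective and Lebesgue measure. -/
theorem lintegral_policyHist (h : IsNoisyModel P v g ξ ε) (hv : v ≠ 0)
    (hF : Measurable (Function.uncurry F)) (hπ : ∀ n, Measurable (π n)) (n : ℕ)
    {G : (E × S) × (Fin n → ℝ) → ℝ≥0∞} (hG : Measurable G) :
    ∫⁻ ω, G ((g ω, ξ ω), policyHist F π g ξ ε n ω) ∂P =
      ∫⁻ s, ∫⁻ y, ∫⁻ e, gaussLik v F (policyDesign π s y) y e * G ((e, s), y) ∂(P.map g)
        ∂volume ∂(P.map ξ) := by
  have := Measure.isProbabilityMeasure_map (μ := P) h.measurable_obj.aemeasurable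
  have := Measure.isProbabilityMeasure_map (μ := P) h.measurable_seed.aemeasurable
  induction n with
  | zero =>
    have hm := h.measurable_obj.prodMk h.measurable_seed
    have hmap := (indepFun_iff_map_prod_eq_prod_map_map h.measurable_obj.aemeasurable
      h.measurable_seed.aemeasurable).1 h.indep_obj_seed
    have hG' : Measurable fun p : E × S => G (p, default) := hG.comp (measurable_id.prodMk
      measurable_const)
    have h1 : ∀ ω, G ((g ω, ξ ω), policyHist F π g ξ ε 0 ω) = G ((g ω, ξ ω), default) :=
      fun ω => by rw [Subsingleton.elim (policyHist F π g ξ ε 0 ω) default]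
    simp_rw [h1]
    rw [← lintegral_map hG' hm, hmap, lintegral_prod_symm _ hG'.aemeasurable]
    refine lintegral_congr fun s => ?_
    rw [volume_pi, Measure.pi_of_empty, lintegral_dirac]
    simp only [gaussLik, Finset.univ_eq_empty, Finset.prod_empty, one_mul]
    exact lintegral_congr fun e => by rw [Subsingleton.elim (default : Fin 0 → ℝ)]
  | succ n ih =>
    -- integrate out the new observation `u` first
    have hmq : Measurable fun p : (E × S) × (Fin n → ℝ) => F (π n (p.1.2, p.2)) p.1.1 :=
      hF.comp (Measurable.prodMk ((hπ n).comp (Measurable.prodMk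
        (measurable_snd.comp measurable_fst) measurable_snd)) (measurable_fst.comp measurable_fst))
    have hGs : Measurable fun q : ((E × S) × (Fin n → ℝ)) × ℝ =>
        G (q.1.1, Fin.snoc q.1.2 q.2) :=
      hG.comp (Measurable.prodMk (measurable_fst.comp measurable_fst)
        ((measurable_finSnoc n).comp (Measurable.prodMk (measurable_snd.comp measurable_fst)
          measurable_snd)))
    have hpdf : Measurable fun q : ((E × S) × (Fin n → ℝ)) × ℝ =>
        gaussianPDF (F (π n (q.1.1.2, q.1.2)) q.1.1.1) v q.2 :=
      measurable_gaussianPDF_comp (hmq.comp measurable_fst) measurable_snd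
    have step1 : ∫⁻ ω, G ((g ω, ξ ω), policyHist F π g ξ ε (n + 1) ω) ∂P =
        ∫⁻ ω, (fun p : (E × S) × (Fin n → ℝ) => ∫⁻ u, gaussianPDF (F (π n (p.1.2, p.2)) p.1.1) v u *
          G (p.1, Fin.snoc p.2 u)) ((g ω, ξ ω), policyHist F π g ξ ε n ω) ∂P := by
      simp_rw [policyHist_succ]
      have hH : Measurable fun q : ((E × S) × (Fin n → ℝ)) × ℝ =>
          G (q.1.1, Fin.snoc q.1.2 (F (π n (q.1.1.2, q.1.2)) q.1.1.1 + q.2)) :=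
        hGs.comp (Measurable.prodMk measurable_fst ((hmq.comp measurable_fst).add measurable_snd))
      rw [h.lintegral_policyHist_noise hF hπ n hH]
      refine lintegral_congr fun ω => ?_
      set p : (E × S) × (Fin n → ℝ) := ((g ω, ξ ω), policyHist F π g ξ ε n ω) with hp
      have hGp : Measurable fun u : ℝ => G (p.1, Fin.snoc p.2 u) :=
        hGs.comp (measurable_const.prodMk measurable_id)
      have h1 := gaussianReal_map_const_add (μ := 0) (v := v) (F (π n (p.1.2, p.2)) p.1.1)
      rw [zero_add] at h1
      have h2 : ∫⁻ η, G (p.1, Fin.snoc p.2 (F (π n (p.1.2, p.2)) p.1.1 + η)) ∂(gaussianReal 0 v) =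
          ∫⁻ u, G (p.1, Fin.snoc p.2 u) ∂(gaussianReal (F (π n (p.1.2, p.2)) p.1.1) v) := by
        rw [← h1, lintegral_map hGp (by fun_prop)]
      rw [gaussianReal_of_var_ne_zero (F (π n (p.1.2, p.2)) p.1.1) hv,
        lintegral_withDensity_eq_lintegral_mul _ (measurable_gaussianPDF _ _) hGp] at h2
      exact h2
    have hint : Measurable fun p : (E × S) × (Fin n → ℝ) =>
        ∫⁻ u, gaussianPDF (F (π n (p.1.2, p.2)) p.1.1) v u * G (p.1, Fin.snoc p.2 u) :=
      (hpdf.mul hGs).lintegral_prod_right'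
    rw [step1, ih hint]
    -- split Lebesgue measure on the `n + 1` observations and swap the order of integration
    refine lintegral_congr fun s => ?_
    set Q : (Fin (n + 1) → ℝ) → ℝ≥0∞ := fun y => ∫⁻ e, gaussLik v F (policyDesign π s y) y e *
      G ((e, s), y) ∂(P.map g) with hQ
    have hlik : ∀ m, Measurable fun p : (Fin m → ℝ) × E =>
        gaussLik v F (policyDesign π s p.1) p.1 p.2 := fun m =>
      measurable_gaussLik hF (fun i => (measurable_policyDesign hπ i).comp
        (measurable_const.prodMk measurable_fst)) measurable_fst measurable_snd
    have hQm : Measurable Q :=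
      Measurable.lintegral_prod_right' (f := fun p : (Fin (n + 1) → ℝ) × E =>
        gaussLik v F (policyDesign π s p.1) p.1 p.2 * G ((p.2, s), p.1))
        ((hlik _).mul (hG.comp ((measurable_snd.prodMk measurable_const).prodMk measurable_fst)))
    have hvol := (volume_preserving_piFinSuccAbove (fun _ : Fin (n + 1) => ℝ) (Fin.last n)).symm
    rw [← hvol.lintegral_comp hQm]
    have hQm' : Measurable fun a : ℝ × (Fin n → ℝ) => Q
        ((MeasurableEquiv.piFinSuccAbove (fun _ : Fin (n + 1) => ℝ) (Fin.last n)).symm a) :=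
      hQm.comp hvol.measurable
    rw [Measure.volume_eq_prod, lintegral_prod_symm _ hQm'.aemeasurable]
    refine lintegral_congr fun y => ?_
    have hsn : ∀ u : ℝ, (MeasurableEquiv.piFinSuccAbove (fun _ : Fin (n + 1) => ℝ)
        (Fin.last n)).symm (u, y) = Fin.snoc y u := fun u => by
      exact Fin.insertNth_last' (β := ℝ) u y
    simp_rw [hsn, hQ, gaussLik_snoc]
    have hA : Measurable fun p : ℝ × E => gaussLik v F (policyDesign π s y) y p.2 :=
      measurable_gaussLik (a := fun _ => policyDesign π s y) (y := fun _ => y) hF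
        (fun _ => measurable_const) measurable_const measurable_snd
    have hB : Measurable fun p : ℝ × E => gaussianPDF (F (π n (s, y)) p.2) v p.1 :=
      measurable_gaussianPDF_comp (m := fun p : ℝ × E => F (π n (s, y)) p.2)
        (hF.comp (measurable_const.prodMk measurable_snd)) measurable_fst
    have hC : Measurable fun p : ℝ × E => G ((p.2, s), Fin.snoc y p.1) :=
      hG.comp ((measurable_snd.prodMk measurable_const).prodMk
        ((measurable_finSnoc n).comp (measurable_const.prodMk measurable_fst)))
    have hswap := lintegral_lintegral_swap (μ := volume) (ν := P.map g)
      (f := fun u e => gaussLik v F (policyDesign π s y) y e *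
        gaussianPDF (F (π n (s, y)) e) v u * G ((e, s), Fin.snoc y u))
      ((hA.mul hB).mul hC).aemeasurable
    rw [hswap]
    refine lintegral_congr fun e => ?_
    simp_rw [mul_assoc]
    exact (lintegral_const_mul _ ((hB.mul hC).comp (measurable_id.prodMk measurable_const))).symm

end IsNoisyModel

end AdaptiveLaw

/-! ### Gaussian conditioning for a fixed design -/

section FixedDesign

variable {X E S Ω : Type*} {n : ℕ}

/-- The values of a Gaussian process at finitely many points, possibly with repetitions, are jointly
Gaussian. -/
lemma hasGaussianLaw_comp [MeasurableSpace Ω] {P : Measure Ω} {f : X → Ω → ℝ}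
    (hf : IsGaussianProcess f P) {ι : Type*} [Finite ι] (b : ι → X) :
    HasGaussianLaw (fun ω i => f (b i) ω) P := by
  classical
  have := Fintype.ofFinite ι
  let L : (Finset.univ.image b → ℝ) →L[ℝ] (ι → ℝ) :=
    { toFun := fun x i => x ⟨b i, Finset.mem_image_of_mem b (Finset.mem_univ i)⟩
      map_add' := fun x y => rfl
      map_smul' := fun c x => rfl
      cont := by fun_prop }
  exact (hf.hasGaussianLaw _).map L

/-- The policy that queries the points `a` whatever it observes. -/
def constPolicy [Nonempty X] (S : Type*) (a : Fin n → X) (i : ℕ) : S × (Fin i → ℝ) → X :=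
  fun _ => if h : i < n then a ⟨i, h⟩ else Classical.arbitrary X

lemma policyDesign_constPolicy [Nonempty X] (a : Fin n → X) (s : S) (y : Fin n → ℝ) :
    policyDesign (constPolicy S a) s y = a := by
  funext i
  simp [policyDesign, constPolicy]

lemma policyHist_constPolicy [Nonempty X] (F : X → E → ℝ) (a : Fin n → X) (g : Ω → E) (ξ : Ω → S)
    (ε : ℕ → Ω → ℝ) (ω : Ω) :
    policyHist F (constPolicy S a) g ξ ε n ω = fun i : Fin n => F (a i) (g ω) + ε i ω := by
  funext i
  rw [policyHist, policyObs]
  simp [constPolicy]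

variable [MeasurableSpace X] [MeasurableSpace E] [MeasurableSpace S] [MeasurableSpace Ω]
  {P : Measure Ω} [IsProbabilityMeasure P] {v : ℝ≥0} {g : Ω → E} {ξ : Ω → S} {ε : ℕ → Ω → ℝ}
  {F : X → E → ℝ} {k : X → X → ℝ}

namespace IsNoisyModel

/-- A fixed design is an adaptive policy that ignores its data. -/
lemma lintegral_fixedDesign [Nonempty X] (h : IsNoisyModel P v g ξ ε) (hv : v ≠ 0)
    (hF : Measurable (Function.uncurry F)) (a : Fin n → X)
    {G : E × (Fin n → ℝ) → ℝ≥0∞} (hG : Measurable G) :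
    ∫⁻ ω, G (g ω, fun i => F (a i) (g ω) + ε i ω) ∂P =
      ∫⁻ y, ∫⁻ e, gaussLik v F a y e * G (e, y) ∂(P.map g) := by
  have := Measure.isProbabilityMeasure_map (μ := P) h.measurable_seed.aemeasurable
  have hG' : Measurable fun p : (E × S) × (Fin n → ℝ) => G (p.1.1, p.2) :=
    hG.comp ((measurable_fst.comp measurable_fst).prodMk measurable_snd)
  have := h.lintegral_policyHist hv hF (π := constPolicy S a) (fun _ => measurable_const) n hG'
  simp only [policyHist_constPolicy, policyDesign_constPolicy] at this
  rw [this, lintegral_const, measure_univ, mul_one]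

/-- The residual of the posterior mean is a centered Gaussian variable, with variance the posterior
variance, independent of the observations. -/
lemma residual_law (h : IsNoisyModel P v g ξ ε) (hv : 0 < v)
    (hgp : IsCenteredGP P k fun z ω => F z (g ω)) (hF : Measurable (Function.uncurry F))
    (a : Fin n → X) (z : X) :
    IndepFun (fun ω => F z (g ω) - postMean k v a (fun i => F (a i) (g ω) + ε i ω) z)
        (fun ω (i : Fin n) => F (a i) (g ω) + ε i ω) P ∧
      P.map (fun ω => F z (g ω) - postMean k v a (fun i => F (a i) (g ω) + ε i ω) z) =
        (gaussianReal 0 1).map fun ζ => postSd k v a z * ζ := by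
  set w := postWeight k v a z with hw
  set f : X → Ω → ℝ := fun z ω => F z (g ω) with hf
  set Y : Fin n → Ω → ℝ := fun i ω => F (a i) (g ω) + ε i ω with hY
  set R : Ω → ℝ := fun ω => f z ω - ∑ i, w i * Y i ω with hR
  have hRe : (fun ω => F z (g ω) - postMean k v a (fun i => F (a i) (g ω) + ε i ω) z) = R := by
    funext ω
    rw [hgp.postMean_eq_sum hv]
  rw [hRe]
  have hεg : ∀ i, HasGaussianLaw (ε i) P := fun i => by
    have : IsGaussian (P.map (ε i)) := by rw [h.noise_law]; infer_instance
    exact IsGaussian.hasGaussianLaw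
  have hε2 : ∀ i, MemLp (ε i) 2 P := fun i => (hεg i).memLp_two
  have hf2 : ∀ x, MemLp (f x) 2 P := hgp.memLp_two
  have hY2 : ∀ i, MemLp (Y i) 2 P := fun i => (hf2 _).add (hε2 i)
  have hwY2 : ∀ i, MemLp (fun ω => w i * Y i ω) 2 P := fun i => (hY2 i).const_mul _
  have hFx : ∀ x, Measurable fun e => F x e := fun x =>
    hF.comp (measurable_const.prodMk measurable_id)
  -- joint Gaussianity of residual and observations
  have hjoint : HasGaussianLaw (fun ω => ((fun (_ : Unit) => R ω), fun i => Y i ω)) P := by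
    let b : Option (Fin n) → X := fun o => o.elim z a
    have h1 : HasGaussianLaw (fun ω o => f (b o) ω) P := hasGaussianLaw_comp hgp.gaussian b
    have h2 : HasGaussianLaw (fun ω (i : Fin n) => ε i ω) P :=
      iIndepFun.hasGaussianLaw (fun i : Fin n => hεg i)
        (h.iIndep_noise.precomp (g := fun i : Fin n => (i : ℕ)) Fin.val_injective)
    have h3 : IndepFun (fun ω o => f (b o) ω) (fun ω (i : Fin n) => ε i ω) P :=
      h.indep_obj_noise.comp (φ := fun e o => F (b o) e) (ψ := fun (η : ℕ → ℝ) (i : Fin n) => η i)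
        (measurable_pi_lambda _ fun o => hFx _)
        (measurable_pi_lambda _ fun i => measurable_pi_apply _)
    have h4 := h3.hasGaussianLaw h1 h2
    let L : (Option (Fin n) → ℝ) × (Fin n → ℝ) →L[ℝ] (Unit → ℝ) × (Fin n → ℝ) :=
      { toFun := fun p => ((fun _ => p.1 none - ∑ i, w i * (p.1 (some i) + p.2 i)),
          fun i => p.1 (some i) + p.2 i)
        map_add' := fun p q => by
          refine Prod.ext (funext fun _ => ?_) (funext fun i => ?_)
          · simp only [Prod.fst_add, Prod.snd_add, Pi.add_apply]
            rw [sub_add_sub_comm, ← Finset.sum_add_distrib]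
            congr 1
            exact Finset.sum_congr rfl fun i _ => by ring
          · simp only [Prod.fst_add, Prod.snd_add, Pi.add_apply]; ring
        map_smul' := fun c p => by
          refine Prod.ext (funext fun _ => ?_) (funext fun i => ?_)
          · simp only [Prod.smul_fst, Prod.smul_snd, Pi.smul_apply, smul_eq_mul, RingHom.id_apply]
            rw [mul_sub, Finset.mul_sum]
            congr 1
            exact Finset.sum_congr rfl fun i _ => by ring
          · simp only [Prod.smul_fst, Prod.smul_snd, Pi.smul_apply, smul_eq_mul, RingHom.id_apply]
            ring
        cont := by fun_prop }
    exact h4.map L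
  -- covariances
  have hcfε : ∀ x i, cov[f x, ε i; P] = 0 := fun x i =>
    (h.indep_obj_noise.comp (φ := fun e => F x e) (ψ := fun η : ℕ → ℝ => η i) (hFx x)
      (measurable_pi_apply i)).covariance_eq_zero (hf2 x) (hε2 i)
  have hcfY : ∀ x j, cov[f x, Y j; P] = k x (a j) := fun x j => by
    have : cov[f x, Y j; P] = cov[f x, f (a j); P] + cov[f x, ε j; P] :=
      covariance_add_right (hf2 x) (hf2 _) (hε2 _)
    rw [this, hcfε, add_zero]
    exact hgp.covariance x (a j)
  have hcεY : ∀ i j : Fin n, cov[ε i, Y j; P] = if i = j then (v : ℝ) else 0 := fun i j => by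
    have : cov[ε i, Y j; P] = cov[ε i, f (a j); P] + cov[ε i, ε j; P] :=
      covariance_add_right (hε2 i) (hf2 _) (hε2 _)
    rw [this, covariance_comm, hcfε, zero_add]
    split_ifs with hij
    · subst hij
      rw [covariance_self (h.measurable_noise _).aemeasurable]
      have := variance_id_gaussianReal (μ := 0) (v := v)
      rwa [← h.noise_law i, variance_map aemeasurable_id
        (h.measurable_noise _).aemeasurable] at this
    · exact (h.iIndep_noise.indepFun (fun hc => hij (Fin.val_injective hc))).covariance_eq_zero
        (hε2 i) (hε2 j)
  have hcYY : ∀ i j, cov[Y i, Y j; P] = k (a i) (a j) + if i = j then (v : ℝ) else 0 :=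
    fun i j => by
    have : cov[Y i, Y j; P] = cov[f (a i), Y j; P] + cov[ε i, Y j; P] :=
      covariance_add_left (hf2 _) (hε2 _) (hY2 j)
    rw [this, hcfY, hcεY]
  have hcR : ∀ {W : Ω → ℝ}, MemLp W 2 P →
      cov[R, W; P] = cov[f z, W; P] - ∑ i, w i * cov[Y i, W; P] := fun {W} hW => by
    rw [hR, covariance_fun_sub_left (hf2 z) (memLp_finsetSum _ fun i _ => hwY2 i) hW,
      covariance_fun_sum_left hwY2 hW]
    simp_rw [covariance_const_mul_left]
  have hcRY : ∀ j, cov[R, Y j; P] = 0 := fun j => by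
    rw [hcR (hY2 j), hcfY, ← hgp.noisyMat_mulVec_postWeight hv a z j]
    simp_rw [hcYY, mul_add, Finset.sum_add_distrib]
    simp [← hw, mul_comm]
  have hRL2 : MemLp R 2 P := (hf2 z).sub (memLp_finsetSum _ fun i _ => hwY2 i)
  refine ⟨?_, ?_⟩
  · have := hjoint.indepFun_of_covariance_eval (X := fun _ => R) (Y := Y) fun _ j => hcRY j
    exact this.comp (φ := fun r : Unit → ℝ => r ()) (ψ := id) (measurable_pi_apply _) measurable_id
  · have hRG : HasGaussianLaw R P := hjoint.fst.eval ()
    have hmean : ∫ ω, R ω ∂P = 0 := by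
      have hεm : ∀ i, ∫ ω, ε i ω ∂P = 0 := fun i => by
        have := integral_id_gaussianReal (μ := 0) (v := v)
        rwa [← h.noise_law i, integral_map (h.measurable_noise _).aemeasurable
          (by fun_prop)] at this
      have hYm : ∀ i, ∫ ω, Y i ω ∂P = 0 := fun i => by
        rw [hY, integral_add (hgp.integrable _) (hεg _).integrable, hgp.mean_zero, hεm, add_zero]
      rw [hR, integral_sub (hgp.integrable z) (integrable_finsetSum _ fun i _ =>
        (hwY2 i).integrable one_le_two), integral_finsetSum _ fun i _ =>
        (hwY2 i).integrable one_le_two, hgp.mean_zero]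
      simp [integral_const_mul, hYm]
    have hvar : Var[R; P] = postVar k v a z := by
      rw [← covariance_self hRG.aemeasurable, hcR hRL2, covariance_comm, hcR (hf2 z)]
      have : ∀ i, cov[Y i, R; P] = 0 := fun i => by rw [covariance_comm, hcRY]
      simp_rw [this, mul_zero, Finset.sum_const_zero, sub_zero]
      have h5 : ∀ i, cov[Y i, f z; P] = k (a i) z := fun i => by
        rw [covariance_comm, hcfY, hgp.kernel_comm]
      simp_rw [h5]
      rw [hgp.postVar_eq a z]
      congr 1
      exact hgp.covariance z z
    rw [hRG.map_eq_gaussianReal, hmean, hvar, gaussianReal_map_const_mul, mul_zero, mul_one]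
    congr 1
    ext
    simp only [NNReal.coe_mk]
    rw [postSd, Real.sq_sqrt (hgp.postVar_nonneg hv a z), Real.coe_toNNReal _
      (hgp.postVar_nonneg hv a z)]

end IsNoisyModel

end FixedDesign

/-! ### The posterior law under an adaptive design -/

section Bayes

variable {X E S Ω : Type*} {n : ℕ}

lemma continuous_gaussianPDFReal (m : ℝ) (v : ℝ≥0) : Continuous (gaussianPDFReal m v) := by
  rw [gaussianPDFReal_def]
  fun_prop

lemma gaussianPDFReal_le (m : ℝ) (v : ℝ≥0) (x : ℝ) :
    gaussianPDFReal m v x ≤ (√(2 * Real.pi * v))⁻¹ := by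
  rw [gaussianPDFReal]
  refine mul_le_of_le_one_right (by positivity) (Real.exp_le_one_iff.2 ?_)
  exact div_nonpos_of_nonpos_of_nonneg (neg_nonpos.2 (sq_nonneg _)) (by positivity)

lemma gaussLik_eq_ofReal (v : ℝ≥0) (F : X → E → ℝ) (a : Fin n → X) (y : Fin n → ℝ) (e : E) :
    gaussLik v F a y e = ENNReal.ofReal (∏ i, gaussianPDFReal (F (a i) e) v (y i)) := by
  rw [ENNReal.ofReal_prod_of_nonneg fun i _ => gaussianPDFReal_nonneg _ _ _]
  rfl

lemma gaussLik_le (v : ℝ≥0) (F : X → E → ℝ) (a : Fin n → X) (y : Fin n → ℝ) (e : E) :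
    gaussLik v F a y e ≤ ENNReal.ofReal ((√(2 * Real.pi * v))⁻¹ ^ n) := by
  rw [gaussLik_eq_ofReal]
  refine ENNReal.ofReal_le_ofReal ?_
  calc ∏ i, gaussianPDFReal (F (a i) e) v (y i) ≤ ∏ _i : Fin n, (√(2 * Real.pi * v))⁻¹ :=
        Finset.prod_le_prod (fun i _ => gaussianPDFReal_nonneg _ _ _)
          fun i _ => gaussianPDFReal_le _ _ _
    _ = _ := by simp

lemma continuous_gaussLik (v : ℝ≥0) (F : X → E → ℝ) (a : Fin n → X) (e : E) :
    Continuous fun y => gaussLik v F a y e := by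
  simp_rw [gaussLik_eq_ofReal]
  exact ENNReal.continuous_ofReal.comp (continuous_finsetProd _ fun i _ =>
    (continuous_gaussianPDFReal _ _).comp (continuous_apply i))

variable [MeasurableSpace E]

lemma lintegral_gaussLik_ne_top {v : ℝ≥0} (F : X → E → ℝ) (Θ : Measure E) [IsFiniteMeasure Θ]
    (a : Fin n → X) (y : Fin n → ℝ) : ∫⁻ e, gaussLik v F a y e ∂Θ ≠ ∞ := by
  refine ((lintegral_mono fun e => gaussLik_le v F a y e).trans_lt ?_).ne
  rw [lintegral_const]
  exact ENNReal.mul_lt_top ENNReal.ofReal_lt_top (measure_lt_top _ _)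

variable [MeasurableSpace X] [MeasurableSpace S] [MeasurableSpace Ω]

lemma measurable_gaussLik_right {v : ℝ≥0} {F : X → E → ℝ} (hF : Measurable (Function.uncurry F))
    (a : Fin n → X) (y : Fin n → ℝ) : Measurable (gaussLik v F a y) :=
  measurable_gaussLik (a := fun _ => a) (y := fun _ => y) hF (fun _ => measurable_const)
    measurable_const measurable_id

lemma continuous_lintegral_gaussLik {v : ℝ≥0} {F : X → E → ℝ}
    (hF : Measurable (Function.uncurry F)) (Θ : Measure E) [IsFiniteMeasure Θ] (a : Fin n → X)
    {h : E → ℝ≥0} (hh : Measurable h) {M : ℝ≥0} (hM : ∀ e, h e ≤ M) :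
    Continuous fun y => ∫⁻ e, gaussLik v F a y e * h e ∂Θ := by
  refine continuous_iff_continuousAt.2 fun y => ?_
  refine tendsto_lintegral_filter_of_dominated_convergence
    (fun _ => ENNReal.ofReal ((√(2 * Real.pi * v))⁻¹ ^ n) * M) (Eventually.of_forall fun y => ?_)
    (Eventually.of_forall fun y => Eventually.of_forall fun e => ?_) ?_
    (Eventually.of_forall fun e => ?_)
  · exact (measurable_gaussLik_right hF a y).mul hh.coe_nnreal_ennreal
  · exact mul_le_mul' (gaussLik_le v F a y e) (ENNReal.coe_le_coe.2 (hM e))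
  · rw [lintegral_const]
    exact (ENNReal.mul_lt_top (ENNReal.mul_lt_top ENNReal.ofReal_lt_top ENNReal.coe_lt_top)
      (measure_lt_top _ _)).ne
  · exact ENNReal.Tendsto.mul_const ((continuous_gaussLik v F a e).tendsto y)
      (Or.inr ENNReal.coe_ne_top)

variable {P : Measure Ω} [IsProbabilityMeasure P] {v : ℝ≥0} {g : Ω → E} {ξ : Ω → S} {ε : ℕ → Ω → ℝ}
  {F : X → E → ℝ} {k : X → X → ℝ}

namespace IsNoisyModel

/-- Bayes' formula for a fixed design and bounded continuous test functions. It holds for almost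
every `y` because the residual is independent of the observations, and both sides are continuous
in `y`. -/
lemma bayes_boundedContinuous [Nonempty X] (h : IsNoisyModel P v g ξ ε) (hv : 0 < v)
    (hgp : IsCenteredGP P k fun z ω => F z (g ω)) (hF : Measurable (Function.uncurry F))
    (a : Fin n → X) (z : X) (H : BoundedContinuousFunction ℝ ℝ≥0) (y : Fin n → ℝ) :
    ∫⁻ e, gaussLik v F a y e * H (F z e) ∂(P.map g) =
      (∫⁻ e, gaussLik v F a y e ∂(P.map g)) *
        ∫⁻ ζ, H (postMean k v a y z + postSd k v a z * ζ) ∂(gaussianReal 0 1) := by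
  have := Measure.isProbabilityMeasure_map (μ := P) h.measurable_obj.aemeasurable
  obtain ⟨M, hM⟩ : ∃ M : ℝ≥0, ∀ x, H x ≤ M := by
    obtain ⟨M, hM⟩ := H.isBounded_range.bddAbove
    exact ⟨M, fun x => hM ⟨x, rfl⟩⟩
  have hFz : Measurable fun e => F z e := hF.comp (measurable_const.prodMk measurable_id)
  have hHm : Measurable H := H.continuous.measurable
  have hmean : Continuous fun y : Fin n → ℝ => postMean k v a y z := by
    simp_rw [hgp.postMean_eq_sum hv]; fun_prop
  set L : (Fin n → ℝ) → ℝ≥0∞ := fun y => ∫⁻ e, gaussLik v F a y e * H (F z e) ∂(P.map g) with hL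
  set p : (Fin n → ℝ) → ℝ≥0∞ := fun y => ∫⁻ e, gaussLik v F a y e ∂(P.map g) with hp
  set J : (Fin n → ℝ) → ℝ≥0∞ :=
    fun y => ∫⁻ ζ, H (postMean k v a y z + postSd k v a z * ζ) ∂(gaussianReal 0 1) with hJ
  have hLc : Continuous L := continuous_lintegral_gaussLik hF _ a (hHm.comp hFz) fun e => hM _
  have hpc : Continuous p := by
    have := continuous_lintegral_gaussLik (v := v) hF (P.map g) a (h := fun _ => 1)
      measurable_const (M := 1) fun e => le_rfl
    simpa using this
  have hJle : ∀ y, J y ≤ M := fun y =>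
    (lintegral_mono fun ζ => ENNReal.coe_le_coe.2 (hM _)).trans (by simp)
  have hJc : Continuous J := by
    refine continuous_iff_continuousAt.2 fun y => ?_
    refine tendsto_lintegral_filter_of_dominated_convergence (fun _ => (M : ℝ≥0∞))
      (Eventually.of_forall fun y => ?_)
      (Eventually.of_forall fun y => Eventually.of_forall fun e => ENNReal.coe_le_coe.2 (hM _))
      (by simp) (Eventually.of_forall fun ζ => ?_)
    · exact (hHm.comp (by fun_prop)).coe_nnreal_ennreal
    · exact (ENNReal.continuous_coe.comp (H.continuous.comp
        (hmean.add continuous_const))).tendsto y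
  have hpJc : Continuous fun y => p y * J y := by
    refine continuous_iff_continuousAt.2 fun y => ?_
    exact ENNReal.Tendsto.mul (hpc.tendsto y) (Or.inr ((hJle y).trans_lt ENNReal.coe_lt_top).ne)
      (hJc.tendsto y) (Or.inr (lintegral_gaussLik_ne_top F _ a y))
  suffices hae : L =ᵐ[volume] fun y => p y * J y from
    congrFun ((Continuous.ae_eq_iff_eq volume hLc hpJc).1 hae) y
  refine ae_eq_of_forall_setLIntegral_eq_of_sigmaFinite hLc.measurable hpJc.measurable
    fun B hB _ => ?_
  have hind : Measurable fun y : Fin n → ℝ => B.indicator (1 : (Fin n → ℝ) → ℝ≥0∞) y :=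
    measurable_one.indicator hB
  -- both sides are the expectation of `1_B(Y) H(f(z))`
  have e1 := h.lintegral_fixedDesign hv.ne' hF a
    (G := fun q => B.indicator 1 q.2 * H (F z q.1))
    ((hind.comp measurable_snd).mul (hHm.comp (hFz.comp measurable_fst)).coe_nnreal_ennreal)
  have e2 := h.lintegral_fixedDesign hv.ne' hF a
    (G := fun q => B.indicator 1 q.2 * J q.2)
    ((hind.comp measurable_snd).mul (hJc.measurable.comp measurable_snd))
  have hYm : Measurable fun ω (i : Fin n) => F (a i) (g ω) + ε i ω :=
    measurable_pi_lambda _ fun i => (hF.comp (measurable_const.prodMk h.measurable_obj)).add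
      (h.measurable_noise i)
  obtain ⟨hind2, hlaw⟩ := h.residual_law hv hgp hF a z
  set Y : Ω → Fin n → ℝ := fun ω i => F (a i) (g ω) + ε i ω with hY
  set R : Ω → ℝ := fun ω => F z (g ω) - postMean k v a (Y ω) z with hR
  have hRm : Measurable R := (hFz.comp h.measurable_obj).sub (hmean.measurable.comp hYm)
  have e3 : ∫⁻ ω, B.indicator 1 (Y ω) * H (F z (g ω)) ∂P =
      ∫⁻ ω, B.indicator 1 (Y ω) * J (Y ω) ∂P := by
    have hm : Measurable fun q : ℝ × (Fin n → ℝ) =>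
        (B.indicator 1 q.2 * H (postMean k v a q.2 z + q.1) : ℝ≥0∞) :=
      (hind.comp measurable_snd).mul (hHm.comp
        ((hmean.measurable.comp measurable_snd).add measurable_fst)).coe_nnreal_ennreal
    have hmap := (indepFun_iff_map_prod_eq_prod_map_map hRm.aemeasurable hYm.aemeasurable).1 hind2
    have h1 : ∫⁻ ω, B.indicator 1 (Y ω) * H (F z (g ω)) ∂P =
        ∫⁻ ω, (fun q : ℝ × (Fin n → ℝ) =>
        (B.indicator 1 q.2 * H (postMean k v a q.2 z + q.1) : ℝ≥0∞)) (R ω, Y ω) ∂P :=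
      lintegral_congr fun ω => by simp [hR]
    have := Measure.isProbabilityMeasure_map (μ := P) hYm.aemeasurable
    rw [h1, ← lintegral_map hm (hRm.prodMk hYm), hmap, hlaw, lintegral_prod_symm _ hm.aemeasurable,
      lintegral_map hm.lintegral_prod_left' hYm]
    refine lintegral_congr fun ω => ?_
    have hmω : Measurable fun r : ℝ =>
        (B.indicator 1 (Y ω) * H (postMean k v a (Y ω) z + r) : ℝ≥0∞) :=
      hm.comp (measurable_id.prodMk measurable_const)
    have hHω : Measurable fun ζ : ℝ => (H (postMean k v a (Y ω) z + postSd k v a z * ζ) : ℝ≥0∞) :=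
      (hHm.comp (by fun_prop)).coe_nnreal_ennreal
    exact (lintegral_map hmω (by fun_prop)).trans (lintegral_const_mul _ hHω)
  have e4 := e1.symm.trans (e3.trans e2)
  have f1 : ∀ y, ∫⁻ e, gaussLik v F a y e * (B.indicator 1 y * H (F z e)) ∂(P.map g) =
      B.indicator L y := fun y => by
    by_cases hy : y ∈ B <;> simp [hy, hL]
  have f2 : ∀ y, ∫⁻ e, gaussLik v F a y e * (B.indicator 1 y * J y) ∂(P.map g) =
      B.indicator (fun y => p y * J y) y := fun y => by
    rw [lintegral_mul_const _ (measurable_gaussLik_right hF a y)]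
    by_cases hy : y ∈ B <;> simp [hy, hp]
  simp_rw [f1, f2] at e4
  rwa [lintegral_indicator hB, lintegral_indicator hB] at e4

/-- Bayes' formula for a fixed design: weighted by the likelihood of `y`, the value `f(z)` has a
Gaussian law whose mean and standard deviation are the posterior ones. -/
theorem bayes [Nonempty X] (h : IsNoisyModel P v g ξ ε) (hv : 0 < v)
    (hgp : IsCenteredGP P k fun z ω => F z (g ω)) (hF : Measurable (Function.uncurry F))
    (a : Fin n → X) (z : X) {H : ℝ → ℝ≥0∞} (hH : Measurable H) (y : Fin n → ℝ) :
    ∫⁻ e, gaussLik v F a y e * H (F z e) ∂(P.map g) =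
      (∫⁻ e, gaussLik v F a y e ∂(P.map g)) *
        ∫⁻ ζ, H (postMean k v a y z + postSd k v a z * ζ) ∂(gaussianReal 0 1) := by
  have := Measure.isProbabilityMeasure_map (μ := P) h.measurable_obj.aemeasurable
  have hFz : Measurable fun e => F z e := hF.comp (measurable_const.prodMk measurable_id)
  have hlik := measurable_gaussLik_right (v := v) hF a y
  have htop := lintegral_gaussLik_ne_top (v := v) F (P.map g) a y
  have hmap : Measurable fun ζ : ℝ => postMean k v a y z + postSd k v a z * ζ := by fun_prop
  have : IsFiniteMeasure ((P.map g).withDensity (gaussLik v F a y)) :=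
    isFiniteMeasure_withDensity htop
  have hEq : ((P.map g).withDensity (gaussLik v F a y)).map (fun e => F z e) =
      (∫⁻ e, gaussLik v F a y e ∂(P.map g)) •
        (gaussianReal 0 1).map fun ζ => postMean k v a y z + postSd k v a z * ζ := by
    refine ext_of_forall_lintegral_eq_of_IsFiniteMeasure fun T => ?_
    have hT : Measurable fun x => (T x : ℝ≥0∞) := T.continuous.measurable.coe_nnreal_ennreal
    rw [lintegral_map hT hFz, lintegral_smul_measure, lintegral_map hT hmap]
    exact (lintegral_withDensity_eq_lintegral_mul _ hlik (hT.comp hFz)).trans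
      (h.bayes_boundedContinuous hv hgp hF a z T y)
  have h1 : ∫⁻ x, H x ∂((P.map g).withDensity (gaussLik v F a y)).map (fun e => F z e) = _ :=
    congrArg (fun μ : Measure ℝ => ∫⁻ x, H x ∂μ) hEq
  rw [lintegral_map hH hFz, lintegral_smul_measure, lintegral_map hH hmap] at h1
  exact (lintegral_withDensity_eq_lintegral_mul _ hlik (hH.comp hFz)).symm.trans h1

variable {π : ∀ n : ℕ, S × (Fin n → ℝ) → X}

/-- Conditionally on the seed and on the observations collected by an adaptive policy, the value of
the objective at a point chosen from these data is Gaussian, with the posterior mean and standard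
deviation computed as if the design had been fixed beforehand. -/
theorem lintegral_posterior [Nonempty X] (h : IsNoisyModel P v g ξ ε) (hv : 0 < v)
    (hgp : IsCenteredGP P k fun z ω => F z (g ω)) (hF : Measurable (Function.uncurry F))
    (hk : Measurable (Function.uncurry k)) (hπ : ∀ n, Measurable (π n)) (n : ℕ)
    {w : S × (Fin n → ℝ) → X} (hw : Measurable w) {H : ℝ × (S × (Fin n → ℝ)) → ℝ≥0∞}
    (hH : Measurable H) :
    ∫⁻ ω, H (F (w (ξ ω, policyHist F π g ξ ε n ω)) (g ω), (ξ ω, policyHist F π g ξ ε n ω)) ∂P =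
      ∫⁻ ω, ∫⁻ ζ, H (postMean k v (policyDesign π (ξ ω) (policyHist F π g ξ ε n ω))
          (policyHist F π g ξ ε n ω) (w (ξ ω, policyHist F π g ξ ε n ω)) +
        postSd k v (policyDesign π (ξ ω) (policyHist F π g ξ ε n ω))
          (w (ξ ω, policyHist F π g ξ ε n ω)) * ζ, (ξ ω, policyHist F π g ξ ε n ω))
        ∂(gaussianReal 0 1) ∂P := by
  have := Measure.isProbabilityMeasure_map (μ := P) h.measurable_obj.aemeasurable
  have hG1 : Measurable fun q : (E × S) × (Fin n → ℝ) =>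
      H (F (w (q.1.2, q.2)) q.1.1, (q.1.2, q.2)) := by
    have hsy : Measurable fun q : (E × S) × (Fin n → ℝ) => (q.1.2, q.2) :=
      (measurable_snd.comp measurable_fst).prodMk measurable_snd
    exact hH.comp ((hF.comp ((hw.comp hsy).prodMk (measurable_fst.comp measurable_fst))).prodMk hsy)
  have hm : Measurable fun p : S × (Fin n → ℝ) =>
      postMean k v (policyDesign π p.1 p.2) p.2 (w p) :=
    measurable_postMean hk (measurable_policyDesign hπ) measurable_snd hw
  have hs : Measurable fun p : S × (Fin n → ℝ) => postSd k v (policyDesign π p.1 p.2) (w p) :=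
    measurable_postSd hk (measurable_policyDesign hπ) hw
  have hG2 : Measurable fun p : S × (Fin n → ℝ) =>
      ∫⁻ ζ, H (postMean k v (policyDesign π p.1 p.2) p.2 (w p) +
        postSd k v (policyDesign π p.1 p.2) (w p) * ζ, p) ∂(gaussianReal 0 1) :=
    Measurable.lintegral_prod_right' (f := fun q : (S × (Fin n → ℝ)) × ℝ =>
      H (postMean k v (policyDesign π q.1.1 q.1.2) q.1.2 (w q.1) +
        postSd k v (policyDesign π q.1.1 q.1.2) (w q.1) * q.2, q.1))
      (hH.comp (((hm.comp measurable_fst).add ((hs.comp measurable_fst).mul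
        measurable_snd)).prodMk measurable_fst))
  have e1 := h.lintegral_policyHist hv.ne' hF hπ n hG1
  have e2 := h.lintegral_policyHist hv.ne' hF hπ n (G := fun q => ∫⁻ ζ, H (postMean k v
    (policyDesign π q.1.2 q.2) q.2 (w (q.1.2, q.2)) + postSd k v (policyDesign π q.1.2 q.2)
      (w (q.1.2, q.2)) * ζ, (q.1.2, q.2)) ∂(gaussianReal 0 1))
    (hG2.comp ((measurable_snd.comp measurable_fst).prodMk measurable_snd))
  rw [e1, e2]
  refine lintegral_congr fun s => lintegral_congr fun y => ?_
  exact (h.bayes hv hgp hF (policyDesign π s y) (w (s, y)) (H := fun u => H (u, (s, y)))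
    (hH.comp (measurable_id.prodMk measurable_const)) y).trans
    (lintegral_mul_const _ (measurable_gaussLik_right hF _ y)).symm

end IsNoisyModel

end Bayes

/-! ### Information gain -/

section MutualInformation

variable {X E S Ω : Type*} {n : ℕ}

/-- The first `i` points of the design `a`. -/
def designPrefix {α : Type*} (a : Fin n → α) (i : Fin n) : Fin i → α :=
  fun j => a (Fin.castLE i.2.le j)

/-- The posterior variance of `f(aᵢ)` given noisy observations at the points preceding `aᵢ`. -/
def seqPostVar (k : X → X → ℝ) (v : ℝ≥0) (a : Fin n → X) (i : Fin n) : ℝ :=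
  postVar k v (designPrefix a i) (a i)

/-- The posterior mean of `f(aᵢ)` given the observations preceding `yᵢ`. -/
def seqPostMean (k : X → X → ℝ) (v : ℝ≥0) (a : Fin n → X) (y : Fin n → ℝ) (i : Fin n) : ℝ :=
  postMean k v (designPrefix a i) (designPrefix y i) (a i)

/-- Averaging the Gaussian density of variance `v` over a Gaussian mean with standard deviation `s`
adds the variances. -/
lemma lintegral_gaussianPDF_affine {v : ℝ≥0} (hv : v ≠ 0) (m s u : ℝ) :
    ∫⁻ ζ, gaussianPDF (m + s * ζ) v u ∂(gaussianReal 0 1) =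
      gaussianPDF m ((s ^ 2).toNNReal + v) u := by
  set w : ℝ≥0 := (s ^ 2).toNNReal with hw
  have hwv : w + v ≠ 0 := by positivity
  have hmeas : Measurable fun p : ℝ × ℝ => gaussianPDF (m + s * p.2) v p.1 :=
    measurable_gaussianPDF_comp (by fun_prop) measurable_fst
  have hLc : Continuous fun u => ∫⁻ ζ, gaussianPDF (m + s * ζ) v u ∂(gaussianReal 0 1) := by
    have hF : Measurable (Function.uncurry fun (_ : Unit) ζ => m + s * ζ) := by
      have : Measurable fun p : Unit × ℝ => m + s * p.2 := by fun_prop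
      exact this
    have h1 := continuous_lintegral_gaussLik (v := v) hF (gaussianReal 0 1)
      (fun _ : Fin 1 => ()) (h := fun _ => 1) measurable_const (M := 1) fun e => le_rfl
    have h2 := h1.comp (continuous_pi fun _ => continuous_id :
      Continuous fun (u : ℝ) (_ : Fin 1) => u)
    simpa [gaussLik, Function.comp_def] using h2
  have hRc : Continuous (gaussianPDF m (w + v)) :=
    ENNReal.continuous_ofReal.comp (continuous_gaussianPDFReal _ _)
  refine congrFun ((Continuous.ae_eq_iff_eq volume hLc hRc).1 ?_) u
  refine ae_eq_of_forall_setLIntegral_eq_of_sigmaFinite hLc.measurable hRc.measurable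
    fun B hB _ => ?_
  have hconv := gaussianReal_conv_gaussianReal (m₁ := m) (m₂ := 0) (v₁ := w) (v₂ := v)
  rw [add_zero] at hconv
  have haff : (gaussianReal 0 1).map (fun ζ => m + s * ζ) = gaussianReal m w := by
    have h1 : (gaussianReal 0 1).map (fun ζ => s * ζ) = gaussianReal 0 w := by
      rw [gaussianReal_map_const_mul, mul_zero, mul_one]
      congr 1
      ext
      rw [hw, Real.coe_toNNReal _ (sq_nonneg s)]
      rfl
    have h2 := gaussianReal_map_const_add (μ := 0) (v := w) m
    rw [zero_add] at h2
    rw [← h2, ← h1, Measure.map_map (by fun_prop) (by fun_prop)]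
    rfl
  rw [← gaussianReal_apply m hwv, ← hconv, ← haff, Measure.conv]
  rw [Measure.map_apply (by fun_prop) hB, Measure.prod_apply (measurable_add hB),
    lintegral_map (measurable_measure_prodMk_left (measurable_add hB)) (by fun_prop),
    lintegral_lintegral_swap hmeas.aemeasurable]
  refine lintegral_congr fun ζ => ?_
  rw [← gaussianReal_apply _ hv]
  have h3 := gaussianReal_map_const_add (μ := 0) (v := v) (m + s * ζ)
  rw [zero_add] at h3
  rw [← h3, Measure.map_apply (by fun_prop) hB]
  rfl

lemma log_gaussianPDFReal (m : ℝ) {w : ℝ≥0} (hw : w ≠ 0) (u : ℝ) :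
    Real.log (gaussianPDFReal m w u) =
      -(Real.log (2 * Real.pi * w) / 2) - (u - m) ^ 2 / (2 * w) := by
  have hw' : (0 : ℝ) < w := by positivity
  rw [gaussianPDFReal, Real.log_mul (by positivity) (Real.exp_pos _).ne', Real.log_exp,
    Real.log_inv, Real.log_sqrt (by positivity)]
  ring

lemma moments_of_map_eq_gaussianReal [MeasurableSpace Ω] {P : Measure Ω} {W : Ω → ℝ} {u : ℝ≥0}
    (hW : Measurable W) (hl : P.map W = gaussianReal 0 u) :
    MemLp W 2 P ∧ ∫ ω, W ω ∂P = 0 ∧ ∫ ω, W ω ^ 2 ∂P = u := by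
  have hG : HasGaussianLaw W P := by
    have : IsGaussian (P.map W) := by rw [hl]; infer_instance
    exact IsGaussian.hasGaussianLaw
  have hm : ∫ ω, W ω ∂P = 0 := by
    have := integral_id_gaussianReal (μ := 0) (v := u)
    rwa [← hl, integral_map hW.aemeasurable (by fun_prop)] at this
  refine ⟨hG.memLp_two, hm, ?_⟩
  have h2 := variance_id_gaussianReal (μ := 0) (v := u)
  rwa [← hl, variance_map aemeasurable_id hW.aemeasurable, Function.id_comp,
    variance_of_integral_eq_zero hW.aemeasurable hm] at h2

variable [MeasurableSpace X] [MeasurableSpace E] [MeasurableSpace S] [MeasurableSpace Ω]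
  {P : Measure Ω} [IsProbabilityMeasure P] {v : ℝ≥0} {g : Ω → E} {ξ : Ω → S} {ε : ℕ → Ω → ℝ}
  {F : X → E → ℝ} {k : X → X → ℝ}

namespace IsNoisyModel

/-- The density of the observations at a fixed design factors into the predictive densities of the
successive observations. -/
lemma lintegral_gaussLik_eq_prod [Nonempty X] (h : IsNoisyModel P v g ξ ε) (hv : 0 < v)
    (hgp : IsCenteredGP P k fun z ω => F z (g ω)) (hF : Measurable (Function.uncurry F))
    (a : Fin n → X) (y : Fin n → ℝ) :
    ∫⁻ e, gaussLik v F a y e ∂(P.map g) =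
      ∏ i, gaussianPDF (seqPostMean k v a y i) ((seqPostVar k v a i).toNNReal + v) (y i) := by
  have := Measure.isProbabilityMeasure_map (μ := P) h.measurable_obj.aemeasurable
  induction n with
  | zero => simp [gaussLik]
  | succ n ih =>
    have hH : Measurable fun u => gaussianPDF u v (y (Fin.last n)) :=
      measurable_gaussianPDF_comp measurable_id measurable_const
    have h1 := h.bayes hv hgp hF (fun i : Fin n => a i.castSucc) (a (Fin.last n)) hH
      (fun i => y i.castSucc)
    rw [lintegral_gaussianPDF_affine hv.ne', ih] at h1
    simp only [gaussLik] at h1 ⊢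
    simp_rw [Fin.prod_univ_castSucc]
    rw [h1]
    have hvar : (postSd k v (fun i : Fin n => a i.castSucc) (a (Fin.last n)) ^ 2).toNNReal =
        (seqPostVar k v a (Fin.last n)).toNNReal :=
      congrArg Real.toNNReal (Real.sq_sqrt (hgp.postVar_nonneg hv _ _))
    rw [hvar]
    rfl

/-- The one-step prediction errors have second moment `σᵢ² + v`. -/
lemma integral_sq_innovation (h : IsNoisyModel P v g ξ ε) (hv : 0 < v)
    (hgp : IsCenteredGP P k fun z ω => F z (g ω)) (hF : Measurable (Function.uncurry F))
    (a : Fin n → X) (i : Fin n) :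
    Integrable (fun ω => (F (a i) (g ω) + ε i ω -
        seqPostMean k v a (fun j => F (a j) (g ω) + ε j ω) i) ^ 2) P ∧
      ∫ ω, (F (a i) (g ω) + ε i ω -
        seqPostMean k v a (fun j => F (a j) (g ω) + ε j ω) i) ^ 2 ∂P = seqPostVar k v a i + v := by
  obtain ⟨-, hlaw⟩ := h.residual_law hv hgp hF (designPrefix a i) (a i)
  set R : Ω → ℝ := fun ω => F (a i) (g ω) - postMean k v (designPrefix a i)
    (fun j => F (designPrefix a i j) (g ω) + ε j ω) (a i) with hR
  have hgm : ∀ x, Measurable fun e => F x e := fun x =>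
    hF.comp (measurable_const.prodMk measurable_id)
  have hΨ : Measurable fun p : (E × S) × (Fin i → ℝ) => F (a i) p.1.1 -
      postMean k v (designPrefix a i) (fun j => F (designPrefix a i j) p.1.1 + p.2 j) (a i) := by
    simp_rw [hgp.postMean_eq_sum hv]
    refine ((hgm _).comp (measurable_fst.comp measurable_fst)).sub
      (Finset.measurable_sum _ fun j _ => Measurable.const_mul
        (((hgm _).comp (measurable_fst.comp measurable_fst)).add
          ((measurable_pi_apply j).comp measurable_snd)) _)
  have hind : IndepFun R (ε i) P :=
    (h.indep_noise i).comp (φ := fun p : (E × S) × (Fin i → ℝ) => F (a i) p.1.1 -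
      postMean k v (designPrefix a i) (fun j => F (designPrefix a i j) p.1.1 + p.2 j) (a i))
      hΨ measurable_id
  have hRm : Measurable R := hΨ.comp ((h.measurable_obj.prodMk h.measurable_seed).prodMk
    (measurable_pi_lambda _ fun j => h.measurable_noise j))
  have hεm := h.measurable_noise i
  have hRlaw : P.map R = gaussianReal 0 (seqPostVar k v a i).toNNReal := by
    rw [hlaw, gaussianReal_map_const_mul, mul_zero, mul_one]
    congr 1
    ext
    rw [seqPostVar, Real.coe_toNNReal _ (hgp.postVar_nonneg hv _ _)]
    exact Real.sq_sqrt (hgp.postVar_nonneg hv _ _)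
  obtain ⟨hR2, hR0, hRv⟩ := moments_of_map_eq_gaussianReal hRm hRlaw
  obtain ⟨hε2, hε0, hεv⟩ := moments_of_map_eq_gaussianReal hεm (h.noise_law i)
  have hRε : ∫ ω, R ω * ε i ω ∂P = 0 := by
    rw [hind.integral_fun_mul_eq_mul_integral hRm.aestronglyMeasurable hεm.aestronglyMeasurable,
      hR0, zero_mul]
  have hiRε : Integrable (fun ω => R ω * ε i ω) P := hR2.integrable_mul hε2
  have hsum : ∀ ω, (F (a i) (g ω) + ε i ω -
      seqPostMean k v a (fun j => F (a j) (g ω) + ε j ω) i) ^ 2 =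
      R ω ^ 2 + 2 * (R ω * ε i ω) + ε i ω ^ 2 := fun ω => by
    have : F (a i) (g ω) + ε i ω - seqPostMean k v a (fun j => F (a j) (g ω) + ε j ω) i =
        R ω + ε i ω := by
      exact add_sub_right_comm _ _ _
    rw [this]; ring
  simp_rw [hsum]
  have hi : Integrable (fun ω => R ω ^ 2 + 2 * (R ω * ε i ω)) P :=
    hR2.integrable_sq.add (hiRε.const_mul 2)
  refine ⟨hi.add hε2.integrable_sq, ?_⟩
  rw [integral_add hi hε2.integrable_sq, integral_add hR2.integrable_sq (hiRε.const_mul 2),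
    integral_const_mul, hRε, hRv, hεv, seqPostVar, Real.coe_toNNReal _ (hgp.postVar_nonneg hv _ _)]
  ring

/-- The mutual information between the noisy and the noise-free values at a fixed design: the joint
law has density `lik(y | z) / p(y)` with respect to the product of the marginals, and `p` is the
product of the predictive densities. -/
theorem mutualInfo_eq [Nonempty X] (h : IsNoisyModel P v g ξ ε) (hv : 0 < v)
    (hgp : IsCenteredGP P k fun z ω => F z (g ω)) (hF : Measurable (Function.uncurry F))
    (a : Fin n → X) :
    mutualInfo P (fun ω i => F (a i) (g ω) + ε i ω) (fun ω i => F (a i) (g ω)) =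
      ENNReal.ofReal (∑ i, Real.log (1 + seqPostVar k v a i / v) / 2) := by
  have := Measure.isProbabilityMeasure_map (μ := P) h.measurable_obj.aemeasurable
  have hv' : (0 : ℝ) < v := by exact_mod_cast hv
  set Y : Ω → Fin n → ℝ := fun ω i => F (a i) (g ω) + ε i ω with hY
  set Z : Ω → Fin n → ℝ := fun ω i => F (a i) (g ω) with hZ
  have hgm : ∀ x, Measurable fun e => F x e := fun x =>
    hF.comp (measurable_const.prodMk measurable_id)
  have hZe : Measurable fun e (i : Fin n) => F (a i) e := measurable_pi_lambda _ fun i => hgm _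
  have hZm : Measurable Z := hZe.comp h.measurable_obj
  have hYm : Measurable Y := measurable_pi_lambda _ fun i =>
    ((hgm _).comp h.measurable_obj).add (h.measurable_noise i)
  have := Measure.isProbabilityMeasure_map (μ := P) hYm.aemeasurable
  have := Measure.isProbabilityMeasure_map (μ := P) hZm.aemeasurable
  have := Measure.isProbabilityMeasure_map (μ := P) (hYm.prodMk hZm).aemeasurable
  -- `q (y, z)` is the likelihood of `y` given the values `z`, and `p y` the marginal density
  set q : (Fin n → ℝ) × (Fin n → ℝ) → ℝ≥0∞ := fun p => ∏ i, gaussianPDF (p.2 i) v (p.1 i) with hq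
  set p : (Fin n → ℝ) → ℝ≥0∞ := fun y => ∫⁻ e, gaussLik v F a y e ∂(P.map g) with hp
  have hpe : ∀ y, p y = ∏ i, gaussianPDF (seqPostMean k v a y i)
      ((seqPostVar k v a i).toNNReal + v) (y i) := h.lintegral_gaussLik_eq_prod hv hgp hF a
  have hwv : ∀ i, (seqPostVar k v a i).toNNReal + v ≠ 0 := fun i => by positivity
  have hp0 : ∀ y, p y ≠ 0 := fun y => by
    rw [hpe]; exact Finset.prod_ne_zero_iff.2 fun i _ => (gaussianPDF_pos _ (hwv i) _).ne'
  have hpt : ∀ y, p y ≠ ∞ := fun y => lintegral_gaussLik_ne_top F _ a y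
  have hqm : Measurable q := Finset.measurable_prod _ fun i _ => measurable_gaussianPDF_comp
    ((measurable_pi_apply i).comp measurable_snd) ((measurable_pi_apply i).comp measurable_fst)
  have hpm : Measurable p := Measurable.lintegral_prod_right' (f := fun r : (Fin n → ℝ) × E =>
    gaussLik v F a r.1 r.2) (measurable_gaussLik (a := fun _ => a) hF (fun _ => measurable_const)
      measurable_fst measurable_snd)
  have hdm : Measurable fun r : (Fin n → ℝ) × (Fin n → ℝ) => q r / p r.1 :=
    hqm.div (hpm.comp measurable_fst)
  have hdens : P.map (fun ω => (Y ω, Z ω)) =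
      ((P.map Y).prod (P.map Z)).withDensity fun r => q r / p r.1 := by
    refine Measure.ext fun B hB => ?_
    set G : (Fin n → ℝ) × (Fin n → ℝ) → ℝ≥0∞ := B.indicator 1 with hG
    have hGm : Measurable G := measurable_one.indicator hB
    have e0 : P.map (fun ω => (Y ω, Z ω)) B = ∫⁻ ω, G (Y ω, Z ω) ∂P := by
      rw [← lintegral_map hGm (hYm.prodMk hZm), hG, lintegral_indicator_one hB]
    have e1 := h.lintegral_fixedDesign hv.ne' hF a (G := fun r => G (r.2, fun i => F (a i) r.1))
      (hGm.comp (measurable_snd.prodMk (hZe.comp measurable_fst)))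
    have hGd : Measurable fun r => q r / p r.1 * G r := hdm.mul hGm
    have e2 : ((P.map Y).prod (P.map Z)).withDensity (fun r => q r / p r.1) B =
        ∫⁻ ω, ∫⁻ e, q (Y ω, fun i => F (a i) e) / p (Y ω) * G (Y ω, fun i => F (a i) e) ∂(P.map g)
          ∂P := by
      rw [withDensity_apply _ hB, ← lintegral_indicator hB]
      have : (B.indicator fun r => q r / p r.1) = fun r => q r / p r.1 * G r := by
        funext r
        by_cases hr : r ∈ B <;> simp [hG, hr]
      rw [this, lintegral_prod _ hGd.aemeasurable, lintegral_map hGd.lintegral_prod_right' hYm]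
      refine lintegral_congr fun ω => ?_
      have hZmap : P.map Z = (P.map g).map fun e (i : Fin n) => F (a i) e :=
        (Measure.map_map hZe h.measurable_obj).symm
      rw [hZmap]
      exact lintegral_map (hGd.comp (measurable_const.prodMk measurable_id)) hZe
    have hin : Measurable fun y : Fin n → ℝ => ∫⁻ e, q (y, fun i => F (a i) e) / p y *
        G (y, fun i => F (a i) e) ∂(P.map g) :=
      Measurable.lintegral_prod_right' (f := fun r : (Fin n → ℝ) × E =>
        q (r.1, fun i => F (a i) r.2) / p r.1 * G (r.1, fun i => F (a i) r.2))
        (hGd.comp (measurable_fst.prodMk (hZe.comp measurable_snd)))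
    have e3 := h.lintegral_fixedDesign hv.ne' hF a
      (G := fun r => ∫⁻ e, q (r.2, fun i => F (a i) e) / p r.2 * G (r.2, fun i => F (a i) e)
        ∂(P.map g)) (hin.comp measurable_snd)
    rw [e0, e2]
    refine e1.trans (Eq.trans ?_ e3.symm)
    refine lintegral_congr fun y => ?_
    have hm3 : Measurable fun e => q (y, fun i => F (a i) e) / p y * G (y, fun i => F (a i) e) :=
      hGd.comp (measurable_const.prodMk hZe)
    change _ = ∫⁻ e, gaussLik v F a y e * (∫⁻ e, q (y, fun i => F (a i) e) / p y *
      G (y, fun i => F (a i) e) ∂(P.map g)) ∂(P.map g)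
    rw [lintegral_mul_const _ (measurable_gaussLik_right hF a y), ← lintegral_const_mul _ hm3]
    refine lintegral_congr fun e => ?_
    rw [← mul_assoc, ENNReal.mul_div_cancel (hp0 y) (hpt y)]
    rfl
  have hac : P.map (fun ω => (Y ω, Z ω)) ≪ (P.map Y).prod (P.map Z) := by
    rw [hdens]; exact withDensity_absolutelyContinuous _ _
  have hrn : (P.map fun ω => (Y ω, Z ω)).rnDeriv ((P.map Y).prod (P.map Z)) =ᵐ[P.map fun ω =>
      (Y ω, Z ω)] fun r => q r / p r.1 := by
    have h1 := Measure.rnDeriv_withDensity ((P.map Y).prod (P.map Z)) hdm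
    rw [← hdens] at h1
    exact hac.ae_le h1
  -- the logarithm of the `i`-th factor of the density `q / p`
  set ℓ : Fin n → Ω → ℝ := fun i ω =>
    (Real.log (2 * Real.pi * ((seqPostVar k v a i).toNNReal + v : ℝ≥0)) / 2 -
      Real.log (2 * Real.pi * v) / 2) + ((Y ω i - seqPostMean k v a (Y ω) i) ^ 2 /
      (2 * ((seqPostVar k v a i).toNNReal + v : ℝ≥0)) - ε i ω ^ 2 / (2 * v)) with hℓ
  have hllr : ∀ᵐ ω ∂P, llr (P.map fun ω => (Y ω, Z ω)) ((P.map Y).prod (P.map Z)) (Y ω, Z ω) =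
      ∑ i, ℓ i ω := by
    filter_upwards [ae_of_ae_map (hYm.prodMk hZm).aemeasurable hrn] with ω hω
    have hq' : (q (Y ω, Z ω)).toReal = ∏ i, gaussianPDFReal (Z ω i) v (Y ω i) := by
      simp [hq, ENNReal.toReal_prod]
    have hp' : (p (Y ω)).toReal = ∏ i, gaussianPDFReal (seqPostMean k v a (Y ω) i)
        ((seqPostVar k v a i).toNNReal + v) (Y ω i) := by
      simp [hpe, ENNReal.toReal_prod]
    rw [llr, hω, ENNReal.toReal_div, hq', hp', Real.log_div, Real.log_prod, Real.log_prod,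
      ← Finset.sum_sub_distrib]
    · refine Finset.sum_congr rfl fun i _ => ?_
      simp only [hℓ]
      rw [log_gaussianPDFReal _ hv.ne', log_gaussianPDFReal _ (hwv i)]
      have : Y ω i - Z ω i = ε i ω := by simp [hY, hZ]
      rw [this]; ring
    · exact fun i _ => (gaussianPDFReal_pos _ _ _ (hwv i)).ne'
    · exact fun i _ => (gaussianPDFReal_pos _ _ _ hv.ne').ne'
    · exact Finset.prod_ne_zero_iff.2 fun i _ => (gaussianPDFReal_pos _ _ _ hv.ne').ne'
    · exact Finset.prod_ne_zero_iff.2 fun i _ => (gaussianPDFReal_pos _ _ _ (hwv i)).ne'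
  -- both quadratic terms have expectation `1 / 2`, so that only the logarithms remain
  have hterm : ∀ i : Fin n, Integrable (ℓ i) P ∧
      ∫ ω, ℓ i ω ∂P = Real.log (1 + seqPostVar k v a i / v) / 2 := fun i => by
    obtain ⟨i1, i2⟩ := h.integral_sq_innovation hv hgp hF a i
    obtain ⟨hε2, -, i4⟩ := moments_of_map_eq_gaussianReal (h.measurable_noise i) (h.noise_law i)
    have hs0 : 0 ≤ seqPostVar k v a i := hgp.postVar_nonneg hv _ _
    have j1 := i1.div_const (2 * ((seqPostVar k v a i).toNNReal + v : ℝ≥0) : ℝ)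
    have j2 := hε2.integrable_sq.div_const (2 * (v : ℝ))
    have j3 : Integrable (fun ω => (Y ω i - seqPostMean k v a (Y ω) i) ^ 2 /
      (2 * ((seqPostVar k v a i).toNNReal + v : ℝ≥0)) - ε i ω ^ 2 / (2 * v)) P := j1.sub j2
    refine ⟨(integrable_const _).add j3, ?_⟩
    simp only [hℓ]
    rw [integral_add (integrable_const _) j3, integral_sub j1 j2, integral_div,
      integral_div, i2, i4, integral_const]
    simp only [probReal_univ, smul_eq_mul, one_mul, NNReal.coe_add, Real.coe_toNNReal _ hs0]
    have h3 : (seqPostVar k v a i + v) / (2 * (seqPostVar k v a i + v)) = 1 / 2 := by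
      have : seqPostVar k v a i + v ≠ 0 := by positivity
      field_simp
    have h4 : (v : ℝ) / (2 * v) = 1 / 2 := by field_simp
    rw [h3, h4, sub_self, add_zero, ← sub_div, ← Real.log_div (by positivity) (by positivity)]
    congr 2
    field_simp
    ring
  have hℓi : Integrable (fun ω => ∑ i, ℓ i ω) P := integrable_finsetSum _ fun i _ => (hterm i).1
  have hllm : Measurable (llr (P.map fun ω => (Y ω, Z ω)) ((P.map Y).prod (P.map Z))) :=
    measurable_llr _ _
  have hint : Integrable (llr (P.map fun ω => (Y ω, Z ω)) ((P.map Y).prod (P.map Z)))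
      (P.map fun ω => (Y ω, Z ω)) := by
    rw [integrable_map_measure hllm.aestronglyMeasurable (hYm.prodMk hZm).aemeasurable]
    exact hℓi.congr (hllr.mono fun ω hω => hω.symm)
  rw [mutualInfo, InformationTheory.klDiv_of_ac_of_integrable hac hint]
  congr 1
  rw [integral_map (hYm.prodMk hZm).aemeasurable hllm.aestronglyMeasurable, integral_congr_ae hllr,
    integral_finsetSum _ fun i _ => (hterm i).1]
  simp_rw [fun i => (hterm i).2]
  simp

end IsNoisyModel

end MutualInformation

/-! ### Maximizers of the expected improvement -/

section ExpectedImprovement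

lemma expImprovement_of_pos {m s b : ℝ} (hs : 0 < s) :
    expImprovement m s b = s * tau ((m - b) / s) := if_pos hs

/-- A competitor with mean equal to the reference value `b` and standard deviation `s₁` bounds how
far below `b` the mean of a maximizer of the expected improvement can be. -/
lemma sq_le_of_expImprovement_le {m₀ s₀ s₁ b : ℝ} (hs₀ : 0 < s₀) (hs₁ : 0 < s₁)
    (hEI : expImprovement b s₁ b ≤ expImprovement m₀ s₀ b) (hm : m₀ ≤ b) :
    ((m₀ - b) / s₀) ^ 2 ≤ 2 * Real.log (s₀ / s₁) := by
  rw [expImprovement_of_pos hs₀, expImprovement_of_pos hs₁, sub_self, zero_div, tau_zero] at hEI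
  set c := (m₀ - b) / s₀ with hc
  have hc0 : c ≤ 0 := div_nonpos_of_nonpos_of_nonneg (by linarith) hs₀.le
  have h1 : s₁ * gaussianPDFReal 0 1 0 ≤ s₀ * gaussianPDFReal 0 1 c :=
    hEI.trans (mul_le_mul_of_nonneg_left (tau_le_of_nonpos hc0) hs₀.le)
  rw [gaussianPDFReal_std_zero, gaussianPDFReal_std] at h1
  have hpi : 0 < (√(2 * Real.pi))⁻¹ := by positivity
  have h2 : s₁ ≤ s₀ * Real.exp (-c ^ 2 / 2) := by
    refine le_of_mul_le_mul_right ?_ hpi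
    linarith
  have h3 : Real.exp (c ^ 2 / 2) ≤ s₀ / s₁ := by
    rw [le_div_iff₀ hs₁]
    calc Real.exp (c ^ 2 / 2) * s₁ ≤ Real.exp (c ^ 2 / 2) * (s₀ * Real.exp (-c ^ 2 / 2)) :=
          mul_le_mul_of_nonneg_left h2 (Real.exp_pos _).le
      _ = s₀ * (Real.exp (c ^ 2 / 2) * Real.exp (-c ^ 2 / 2)) := by ring
      _ = s₀ := by rw [← Real.exp_add]; ring_nf; simp
  have h4 := (Real.le_log_iff_exp_le (by positivity)).2 h3
  linarith

/-- If a point with mean `m₀` and standard deviation `s₀` has at least the expected improvement of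
another point, then the upper confidence bound `m + s` of the latter exceeds `m₀` by at most a
multiple of `s₀`, up to the improvement `(m₀ - b)₊` of the mean over the reference value. -/
lemma ucb_le_of_expImprovement_le {m s m₀ s₀ b Λ : ℝ} (hs : 0 < s) (hs₀ : 0 < s₀)
    (hEI : expImprovement m s b ≤ expImprovement m₀ s₀ b)
    (hΛ : m₀ ≤ b → ((m₀ - b) / s₀) ^ 2 ≤ Λ) :
    m + s - m₀ ≤ s₀ * (gaussianPDFReal 0 1 0 / upperTail + √Λ) + max (m₀ - b) 0 / upperTail := by
  have hp := upperTail_pos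
  rw [expImprovement_of_pos hs, expImprovement_of_pos hs₀] at hEI
  have h1 : upperTail * (m - b + s) ≤ s₀ * tau ((m₀ - b) / s₀) := by
    refine le_trans ?_ hEI
    have := mul_le_mul_of_nonneg_left (upperTail_mul_le_tau ((m - b) / s)) hs.le
    calc upperTail * (m - b + s) = s * (upperTail * ((m - b) / s + 1)) := by field_simp
      _ ≤ _ := this
  have hφ := gaussianPDFReal_nonneg 0 1 0
  rcases le_or_gt m₀ b with hm | hm
  · have hc0 : (m₀ - b) / s₀ ≤ 0 := div_nonpos_of_nonpos_of_nonneg (by linarith) hs₀.le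
    have h2 : s₀ * tau ((m₀ - b) / s₀) ≤ s₀ * gaussianPDFReal 0 1 0 :=
      mul_le_mul_of_nonneg_left ((tau_le_of_nonpos hc0).trans (gaussianPDFReal_std_le _)) hs₀.le
    have h3 : m - b + s ≤ s₀ * gaussianPDFReal 0 1 0 / upperTail := by
      rw [le_div_iff₀ hp]; linarith
    have h4 : -((m₀ - b) / s₀) ≤ √Λ := Real.le_sqrt_of_sq_le (by rw [neg_sq]; exact hΛ hm)
    have h5 : b - m₀ ≤ s₀ * √Λ := by
      calc b - m₀ = s₀ * -((m₀ - b) / s₀) := by field_simp; ring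
        _ ≤ _ := mul_le_mul_of_nonneg_left h4 hs₀.le
    rw [max_eq_right (by linarith), zero_div, mul_add, ← mul_div_assoc]
    linarith
  · have hc0 : 0 ≤ (m₀ - b) / s₀ := div_nonneg (by linarith) hs₀.le
    have h2 : s₀ * tau ((m₀ - b) / s₀) ≤ (m₀ - b) + s₀ * gaussianPDFReal 0 1 0 := by
      calc s₀ * tau ((m₀ - b) / s₀) ≤ s₀ * ((m₀ - b) / s₀ + gaussianPDFReal 0 1 0) :=
            mul_le_mul_of_nonneg_left (tau_le_of_nonneg hc0) hs₀.le
        _ = _ := by field_simp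
    have h3 : m - b + s ≤ ((m₀ - b) + s₀ * gaussianPDFReal 0 1 0) / upperTail := by
      rw [le_div_iff₀ hp]; linarith
    rw [max_eq_left (by linarith), mul_add, ← mul_div_assoc]
    rw [add_div] at h3
    have := mul_nonneg hs₀.le (Real.sqrt_nonneg Λ)
    linarith

variable {X Ω : Type*} [MeasurableSpace Ω] {P : Measure Ω} {k : X → X → ℝ} {v : ℝ≥0}
  {f : X → Ω → ℝ} {n : ℕ}

lemma postMean_le_evaluatedMeanMax (k : X → X → ℝ) (v : ℝ≥0) (pts : Fin n → X) (y : Fin n → ℝ)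
    (i : Fin n) : postMean k v pts y (pts i) ≤ evaluatedMeanMax k v pts y := by
  rw [evaluatedMeanMax, if_neg (Nat.ne_of_gt i.pos)]
  exact le_ciSup (f := fun i => postMean k v pts y (pts i)) (Set.finite_range _).bddAbove i

lemma exists_evaluatedMeanMax_eq (k : X → X → ℝ) (v : ℝ≥0) (hn : n ≠ 0) (pts : Fin n → X)
    (y : Fin n → ℝ) : ∃ i, evaluatedMeanMax k v pts y = postMean k v pts y (pts i) := by
  have : Nonempty (Fin n) := ⟨⟨0, Nat.pos_of_ne_zero hn⟩⟩
  obtain ⟨i, hi⟩ := exists_eq_ciSup_of_finite (f := fun i => postMean k v pts y (pts i))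
  exact ⟨i, by rw [evaluatedMeanMax, if_neg hn, ← hi]⟩

lemma postMean_zero (k : X → X → ℝ) (v : ℝ≥0) (pts : Fin 0 → X) (y : Fin 0 → ℝ) (z : X) :
    postMean k v pts y z = 0 := by
  simp [postMean]

namespace IsCenteredGP

lemma postSd_pos (h : IsCenteredGP P k f) (hv : 0 < v) {κ : ℝ} (hκ : 0 < κ)
    (hk : ∀ z, κ ≤ k z z ∧ k z z ≤ 1) (pts : Fin n → X) (z : X) : 0 < postSd k v pts z := by
  have hv' : (0 : ℝ) < v := by exact_mod_cast hv
  refine Real.sqrt_pos.2 (lt_of_lt_of_le ?_ (h.le_postVar hv (fun z => (hk z).2) pts z))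
  have := hκ.trans_le (hk z).1
  positivity

lemma postSd_le_one (h : IsCenteredGP P k f) (hv : 0 < v) (hk : ∀ z, k z z ≤ 1)
    (pts : Fin n → X) (z : X) : postSd k v pts z ≤ 1 :=
  Real.sqrt_le_one.2 ((h.postVar_le hv pts z).trans (hk z))

/-- The upper confidence bound of every point exceeds the posterior mean of a maximizer of the
expected improvement by a multiple of the posterior standard deviation of that maximizer. The
logarithmic factor comes from the lower bound on the posterior variance of the evaluated points. -/
theorem ucb_sub_postMean_le (h : IsCenteredGP P k f) (hv : 0 < v) {κ : ℝ} (hκ : 0 < κ)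
    (hk : ∀ z, κ ≤ k z z ∧ k z z ≤ 1) {β : ℝ} (hβ : 0 < β) (pts : Fin n → X) (y : Fin n → ℝ)
    {x : X} (hx : ∀ z, scaledEI k v β pts y z ≤ scaledEI k v β pts y x) (z : X) :
    postMean k v pts y z + √β * postSd k v pts z - postMean k v pts y x ≤
      √β * postSd k v pts x *
        (gaussianPDFReal 0 1 0 / upperTail + √(Real.log ((v + n) / (κ * v)))) +
      max (postMean k v pts y x - evaluatedMeanMax k v pts y) 0 / upperTail := by
  have hv' : (0 : ℝ) < v := by exact_mod_cast hv
  have hsd := fun z => h.postSd_pos hv hκ hk pts z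
  have hs : ∀ z, 0 < √β * postSd k v pts z := fun z => mul_pos (Real.sqrt_pos.2 hβ) (hsd z)
  have hκ1 : κ ≤ 1 := (hk x).1.trans (hk x).2
  refine ucb_le_of_expImprovement_le (hs z) (hs x) (hx z) fun hm => ?_
  rcases Nat.eq_zero_or_pos n with hn | hn
  · subst hn
    rw [postMean_zero, evaluatedMeanMax, if_pos rfl, sub_zero, zero_div, Nat.cast_zero, add_zero]
    simp only [ne_eq, OfNat.ofNat_ne_zero, not_false_eq_true, zero_pow]
    refine Real.log_nonneg ?_
    rw [le_div_iff₀ (by positivity)]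
    nlinarith
  · obtain ⟨i, hi⟩ := exists_evaluatedMeanMax_eq k v hn.ne' pts y
    have h1 := hx (pts i)
    rw [scaledEI, ← hi] at h1
    refine (sq_le_of_expImprovement_le (hs x) (hs (pts i)) h1 hm).trans ?_
    rw [mul_div_mul_left _ _ (Real.sqrt_pos.2 hβ).ne']
    have h2 : 2 * Real.log (postSd k v pts x / postSd k v pts (pts i)) =
        Real.log ((postSd k v pts x / postSd k v pts (pts i)) ^ 2) := by
      rw [Real.log_pow]; norm_num
    rw [h2]
    refine Real.log_le_log (pow_pos (div_pos (hsd _) (hsd _)) 2) ?_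
    have h3 : postSd k v pts x ^ 2 ≤ 1 := pow_le_one₀ (hsd x).le
      (h.postSd_le_one hv (fun z => (hk z).2) pts x)
    have h4 : κ * v / (v + n) ≤ postSd k v pts (pts i) ^ 2 := by
      rw [postSd, Real.sq_sqrt (h.postVar_nonneg hv _ _)]
      refine le_trans ?_ (h.le_postVar hv (fun z => (hk z).2) pts (pts i))
      have := (hk (pts i)).1
      gcongr
    rw [div_pow, div_le_iff₀ (pow_pos (hsd _) 2)]
    calc postSd k v pts x ^ 2 ≤ 1 := h3
      _ = (v + n) / (κ * v) * (κ * v / (v + n)) := by field_simp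
      _ ≤ _ := mul_le_mul_of_nonneg_left h4 (by positivity)

end IsCenteredGP

end ExpectedImprovement

/-! ### Posterior expectations along the queries -/

section PolicyPosterior

/-- A maximizing index among finitely many measurable functions can be chosen measurably. -/
lemma exists_measurable_argmax {T ι : Type*} [MeasurableSpace T] [MeasurableSpace ι]
    {m : ι → T → ℝ} (hm : ∀ i, Measurable (m i)) {s : Finset ι} (hs : s.Nonempty) :
    ∃ j : T → ι, Measurable j ∧ ∀ t, j t ∈ s ∧ ∀ i ∈ s, m i t ≤ m (j t) t := by
  classical
  induction hs using Finset.Nonempty.cons_induction with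
  | singleton a => exact ⟨fun _ => a, measurable_const, fun t => by simp⟩
  | cons a s ha hs ih =>
    obtain ⟨j, hj, hjs⟩ := ih
    have hmj : Measurable fun t => s.sup' hs fun i => m i t := by
      convert Finset.measurable_sup' hs fun i _ => hm i using 1
      exact funext fun t => (Finset.sup'_apply hs m t).symm
    have hset : MeasurableSet {t | m a t ≤ s.sup' hs fun i => m i t} :=
      measurableSet_le (hm a) hmj
    refine ⟨fun t => if m a t ≤ s.sup' hs fun i => m i t then j t else a,
      Measurable.ite hset hj measurable_const, fun t => ?_⟩
    have hle : ∀ i ∈ s, m i t ≤ s.sup' hs fun i => m i t := fun i hi =>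
      Finset.le_sup' (fun i => m i t) hi
    have hge : (s.sup' hs fun i => m i t) ≤ m (j t) t := Finset.sup'_le _ _ (hjs t).2
    by_cases hc : m a t ≤ s.sup' hs fun i => m i t <;> simp only [hc, if_true, if_false]
    · refine ⟨Finset.mem_cons_of_mem (hjs t).1, fun i hi => ?_⟩
      rcases Finset.mem_cons.1 hi with rfl | hi
      · exact hc.trans hge
      · exact (hjs t).2 i hi
    · refine ⟨Finset.mem_cons_self _ _, fun i hi => ?_⟩
      rcases Finset.mem_cons.1 hi with rfl | hi
      · exact le_rfl
      · exact (hle i hi).trans (not_le.1 hc).le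

variable {X E S Ω : Type*}

/-- The seed together with the first `n` observations. -/
def policyData (F : X → E → ℝ) (π : ∀ n : ℕ, S × (Fin n → ℝ) → X) (g : Ω → E) (ξ : Ω → S)
    (ε : ℕ → Ω → ℝ) (n : ℕ) (ω : Ω) : S × (Fin n → ℝ) :=
  (ξ ω, policyHist F π g ξ ε n ω)

/-- The posterior mean at the point `w p`, given the data `p`. -/
def policyMean (k : X → X → ℝ) (v : ℝ≥0) (π : ∀ n : ℕ, S × (Fin n → ℝ) → X) {n : ℕ}
    (w : S × (Fin n → ℝ) → X) (p : S × (Fin n → ℝ)) : ℝ :=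
  postMean k v (policyDesign π p.1 p.2) p.2 (w p)

/-- The posterior standard deviation at the point `w p`, given the data `p`. -/
def policySd (k : X → X → ℝ) (v : ℝ≥0) (π : ∀ n : ℕ, S × (Fin n → ℝ) → X) {n : ℕ}
    (w : S × (Fin n → ℝ) → X) (p : S × (Fin n → ℝ)) : ℝ :=
  postSd k v (policyDesign π p.1 p.2) (w p)

/-- The largest posterior mean at the points evaluated so far, given the data `p`. -/
def policyBest (k : X → X → ℝ) (v : ℝ≥0) (π : ∀ n : ℕ, S × (Fin n → ℝ) → X) {n : ℕ}
    (p : S × (Fin n → ℝ)) : ℝ :=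
  evaluatedMeanMax k v (policyDesign π p.1 p.2) p.2

lemma policySd_nonneg (k : X → X → ℝ) (v : ℝ≥0) (π : ∀ n : ℕ, S × (Fin n → ℝ) → X) {n : ℕ}
    (w : S × (Fin n → ℝ) → X) (p : S × (Fin n → ℝ)) : 0 ≤ policySd k v π w p :=
  Real.sqrt_nonneg _

variable [MeasurableSpace X] [MeasurableSpace E] [MeasurableSpace S] [MeasurableSpace Ω]

/-- Noisy observations of a centered Gaussian process on `X` with jointly measurable evaluations,
whose variances lie between `κ > 0` and `1`. -/
structure IsGPModel (P : Measure Ω) (k : X → X → ℝ) (v : ℝ≥0) (κ : ℝ) (F : X → E → ℝ) (g : Ω → E)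
    (ξ : Ω → S) (ε : ℕ → Ω → ℝ) : Prop extends IsNoisyModel P v g ξ ε where
  v_pos : 0 < v
  gp : IsCenteredGP P k fun z ω => F z (g ω)
  measurable_eval : Measurable (Function.uncurry F)
  measurable_kernel : Measurable (Function.uncurry k)
  κ_pos : 0 < κ
  kernel_mem : ∀ z, κ ≤ k z z ∧ k z z ≤ 1

variable {P : Measure Ω} {k : X → X → ℝ} {v : ℝ≥0} {κ : ℝ}
  {F : X → E → ℝ} {g : Ω → E} {ξ : Ω → S} {ε : ℕ → Ω → ℝ} {π : ∀ n : ℕ, S × (Fin n → ℝ) → X}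
  {n : ℕ} {w : S × (Fin n → ℝ) → X}

namespace IsGPModel

lemma measurable_policyData (h : IsGPModel P k v κ F g ξ ε) (hπ : ∀ n, Measurable (π n)) (n : ℕ) :
    Measurable (policyData F π g ξ ε n) :=
  h.measurable_seed.prodMk (h.measurable_policyHist h.measurable_eval hπ n)

lemma measurable_policyMean (h : IsGPModel P k v κ F g ξ ε) (hπ : ∀ n, Measurable (π n))
    (hw : Measurable w) : Measurable (policyMean k v π w) :=
  measurable_postMean h.measurable_kernel (measurable_policyDesign hπ) measurable_snd hw

lemma measurable_policySd (h : IsGPModel P k v κ F g ξ ε) (hπ : ∀ n, Measurable (π n))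
    (hw : Measurable w) : Measurable (policySd k v π w) :=
  measurable_postSd h.measurable_kernel (measurable_policyDesign hπ) hw

lemma policySd_le_one (h : IsGPModel P k v κ F g ξ ε) (p : S × (Fin n → ℝ)) :
    policySd k v π w p ≤ 1 :=
  h.gp.postSd_le_one h.v_pos (fun z => (h.kernel_mem z).2) _ _

lemma measurable_eval_comp (h : IsGPModel P k v κ F g ξ ε) (hπ : ∀ n, Measurable (π n))
    (hw : Measurable w) : Measurable fun ω => F (w (policyData F π g ξ ε n ω)) (g ω) :=
  h.measurable_eval.comp ((hw.comp (h.measurable_policyData hπ n)).prodMk h.measurable_obj)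

variable [IsProbabilityMeasure P]

/-- The value at a point chosen from the data is distributed as its posterior mean plus its
posterior standard deviation times an independent standard Gaussian variable. -/
lemma map_eval_eq [Nonempty X] (h : IsGPModel P k v κ F g ξ ε) (hπ : ∀ n, Measurable (π n))
    (hw : Measurable w) :
    P.map (fun ω => F (w (policyData F π g ξ ε n ω)) (g ω)) =
      (P.prod (gaussianReal 0 1)).map fun q => policyMean k v π w (policyData F π g ξ ε n q.1) +
        policySd k v π w (policyData F π g ξ ε n q.1) * q.2 := by
  have hd := h.measurable_policyData hπ n
  have hq : Measurable fun q : Ω × ℝ => policyMean k v π w (policyData F π g ξ ε n q.1) +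
      policySd k v π w (policyData F π g ξ ε n q.1) * q.2 :=
    (((h.measurable_policyMean hπ hw).comp hd).comp measurable_fst).add
      ((((h.measurable_policySd hπ hw).comp hd).comp measurable_fst).mul measurable_snd)
  refine Measure.ext fun B hB => ?_
  have hind : Measurable (B.indicator (1 : ℝ → ℝ≥0∞)) := measurable_one.indicator hB
  have hindq : Measurable fun q : Ω × ℝ => B.indicator (1 : ℝ → ℝ≥0∞)
      (policyMean k v π w (policyData F π g ξ ε n q.1) +
        policySd k v π w (policyData F π g ξ ε n q.1) * q.2) := hind.comp hq
  rw [← lintegral_indicator_one hB, ← lintegral_indicator_one hB,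
    lintegral_map hind (h.measurable_eval_comp hπ hw), lintegral_map hind hq,
    lintegral_prod _ hindq.aemeasurable]
  exact h.toIsNoisyModel.lintegral_posterior h.v_pos h.gp h.measurable_eval h.measurable_kernel hπ n
    hw (H := fun q => B.indicator 1 q.1) (hind.comp measurable_fst)

/-- The value at a point chosen from the data and its posterior mean have the same expectation. -/
lemma integral_policyMean [Nonempty X] (h : IsGPModel P k v κ F g ξ ε)
    (hπ : ∀ n, Measurable (π n)) (hw : Measurable w)
    (hi : Integrable (fun ω => F (w (policyData F π g ξ ε n ω)) (g ω)) P) :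
    Integrable (fun ω => policyMean k v π w (policyData F π g ξ ε n ω)) P ∧
      ∫ ω, policyMean k v π w (policyData F π g ξ ε n ω) ∂P =
        ∫ ω, F (w (policyData F π g ξ ε n ω)) (g ω) ∂P := by
  have hd := h.measurable_policyData hπ n
  have hm := h.map_eval_eq hπ hw
  have hfm := h.measurable_eval_comp hπ hw
  have hq : Measurable fun q : Ω × ℝ => policyMean k v π w (policyData F π g ξ ε n q.1) +
      policySd k v π w (policyData F π g ξ ε n q.1) * q.2 :=
    (((h.measurable_policyMean hπ hw).comp hd).comp measurable_fst).add
      ((((h.measurable_policySd hπ hw).comp hd).comp measurable_fst).mul measurable_snd)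
  have h1 : Integrable (fun x : ℝ => x) (P.map fun ω => F (w (policyData F π g ξ ε n ω)) (g ω)) :=
    (integrable_map_measure (by fun_prop) hfm.aemeasurable).2 hi
  have h2 : ∫ x, x ∂(P.map fun ω => F (w (policyData F π g ξ ε n ω)) (g ω)) =
      ∫ ω, F (w (policyData F π g ξ ε n ω)) (g ω) ∂P :=
    integral_map hfm.aemeasurable (by fun_prop)
  rw [hm] at h1 h2
  rw [integral_map hq.aemeasurable (by fun_prop)] at h2
  have h3 := (integrable_map_measure (by fun_prop) hq.aemeasurable).1 h1
  have h4 : Integrable (fun ζ : ℝ => ζ) (gaussianReal 0 1) :=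
    (memLp_id_gaussianReal 1).integrable le_rfl
  have h5 : ∀ ω, ∫ ζ, (policyMean k v π w (policyData F π g ξ ε n ω) +
      policySd k v π w (policyData F π g ξ ε n ω) * ζ) ∂(gaussianReal 0 1) =
      policyMean k v π w (policyData F π g ξ ε n ω) := fun ω => by
    rw [integral_add (integrable_const _) (h4.const_mul _), integral_const_mul,
      integral_id_gaussianReal]
    simp
  have h6 := h3.integral_prod_left
  have h7 := integral_prod _ h3
  simp only [Function.comp_def, h5] at h6 h7
  exact ⟨h6, h7.symm.trans h2⟩

/-- The expected excess of `f(z)` over its upper confidence bound. -/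
lemma lintegral_excess_ucb_le [Nonempty X] (h : IsGPModel P k v κ F g ξ ε)
    (hπ : ∀ n, Measurable (π n)) (n : ℕ) (z : X) {β : ℝ} :
    ∫⁻ ω, ENNReal.ofReal (F z (g ω) - (policyMean k v π (fun _ => z) (policyData F π g ξ ε n ω) +
        √β * policySd k v π (fun _ => z) (policyData F π g ξ ε n ω))) ∂P ≤
      ENNReal.ofReal (gaussianPDFReal 0 1 √β) := by
  have hw : Measurable fun _ : S × (Fin n → ℝ) => z := measurable_const
  have h1 := h.toIsNoisyModel.lintegral_posterior h.v_pos h.gp h.measurable_eval h.measurable_kernel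
    hπ n hw (H := fun q => ENNReal.ofReal (q.1 - (policyMean k v π (fun _ => z) q.2 +
      √β * policySd k v π (fun _ => z) q.2)))
    (measurable_fst.sub (((h.measurable_policyMean hπ hw).comp measurable_snd).add
      (((h.measurable_policySd hπ hw).comp measurable_snd).const_mul _))).ennreal_ofReal
  refine (h1.trans_le (lintegral_mono fun ω => lintegral_excess_le _ (Real.sqrt_nonneg _)
    (Real.sqrt_nonneg β))).trans ?_
  refine (lintegral_mono fun ω => ENNReal.ofReal_le_ofReal
    (mul_le_of_le_one_left (gaussianPDFReal_nonneg _ _ _)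
      (h.policySd_le_one (π := π) (w := fun _ => z) (policyData F π g ξ ε n ω)))).trans ?_
  simp

/-- The bound of `lintegral_excess_ucb_le` for the Bochner integral. -/
lemma integral_excess_ucb_le [Nonempty X] (h : IsGPModel P k v κ F g ξ ε)
    (hπ : ∀ n, Measurable (π n)) (n : ℕ) (z : X) {β : ℝ} :
    Integrable (fun ω => max (F z (g ω) -
        (policyMean k v π (fun _ => z) (policyData F π g ξ ε n ω) +
          √β * policySd k v π (fun _ => z) (policyData F π g ξ ε n ω))) 0) P ∧
      ∫ ω, max (F z (g ω) - (policyMean k v π (fun _ => z) (policyData F π g ξ ε n ω) +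
        √β * policySd k v π (fun _ => z) (policyData F π g ξ ε n ω))) 0 ∂P ≤
      gaussianPDFReal 0 1 √β := by
  have h1 := h.lintegral_excess_ucb_le hπ n z (β := β)
  have hw : Measurable fun _ : S × (Fin n → ℝ) => z := measurable_const
  have hd := h.measurable_policyData hπ n
  have hm : Measurable fun ω => max (F z (g ω) -
        (policyMean k v π (fun _ => z) (policyData F π g ξ ε n ω) +
          √β * policySd k v π (fun _ => z) (policyData F π g ξ ε n ω))) 0 :=
    ((h.gp.measurable z).sub (((h.measurable_policyMean hπ hw).comp hd).add
      (((h.measurable_policySd hπ hw).comp hd).const_mul _))).max measurable_const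
  have hmax : ∀ r : ℝ, ENNReal.ofReal r = ENNReal.ofReal (max r 0) := fun r => by
    rcases le_total r 0 with hr | hr
    · rw [max_eq_right hr, ENNReal.ofReal_of_nonpos hr, ENNReal.ofReal_zero]
    · rw [max_eq_left hr]
  rw [lintegral_congr fun ω => hmax _] at h1
  have h0 := fun ω => le_max_right (F z (g ω) -
        (policyMean k v π (fun _ => z) (policyData F π g ξ ε n ω) +
          √β * policySd k v π (fun _ => z) (policyData F π g ξ ε n ω))) 0
  refine ⟨(lintegral_ofReal_ne_top_iff_integrable hm.aestronglyMeasurable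
    (Eventually.of_forall h0)).1 (h1.trans_lt ENNReal.ofReal_lt_top).ne, ?_⟩
  rw [integral_eq_lintegral_of_nonneg_ae (Eventually.of_forall h0) hm.aestronglyMeasurable]
  exact ENNReal.toReal_le_of_le_ofReal (gaussianPDFReal_nonneg _ _ _) h1

end IsGPModel

namespace IsGPModel

/-- The reference value is the posterior mean at an evaluated point that depends measurably on the
data. -/
lemma exists_measurable_policyBest (h : IsGPModel P k v κ F g ξ ε) (hπ : ∀ n, Measurable (π n))
    (hn : n ≠ 0) :
    ∃ w : S × (Fin n → ℝ) → X, Measurable w ∧ ∀ p, (∃ i, w p = policyDesign π p.1 p.2 i) ∧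
      policyBest k v π p = policyMean k v π w p := by
  have : Nonempty (Fin n) := ⟨⟨0, Nat.pos_of_ne_zero hn⟩⟩
  obtain ⟨j, hj, hmax⟩ := exists_measurable_argmax
    (m := fun (i : Fin n) => policyMean k v π fun p => policyDesign π p.1 p.2 i)
    (fun i => h.measurable_policyMean hπ (measurable_policyDesign hπ i)) Finset.univ_nonempty
  refine ⟨fun p => policyDesign π p.1 p.2 (j p), ?_, fun p => ⟨⟨j p, rfl⟩, ?_⟩⟩
  · have : Measurable fun q : (S × (Fin n → ℝ)) × Fin n => policyDesign π q.1.1 q.1.2 q.2 :=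
      measurable_from_prod_countable_left fun i => measurable_policyDesign hπ i
    exact this.comp (measurable_id.prodMk hj)
  · obtain ⟨i, hi⟩ := exists_evaluatedMeanMax_eq k v hn (policyDesign π p.1 p.2) p.2
    refine le_antisymm ?_ (postMean_le_evaluatedMeanMax _ _ _ _ _)
    rw [policyBest, hi]
    exact (hmax p).2 i (Finset.mem_univ i)

variable [IsProbabilityMeasure P]

/-- In expectation, the reference value `bₙ` grows at each step by at least the improvement
`(μₙ(xₙ) - bₙ)₊` of the posterior mean at the next query: the larger of `bₙ` and `μₙ(xₙ)` is the
posterior mean at a point `u` that has been evaluated by time `n + 1`, and the posterior mean at `u`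
keeps its expectation when new data arrive. -/
lemma integral_max_le_integral_policyBest [Nonempty X] (h : IsGPModel P k v κ F g ξ ε)
    (hπ : ∀ n, Measurable (π n)) {B : Ω → ℝ} (hB : Integrable B P)
    (hfB : ∀ᵐ ω ∂P, ∀ z, |F z (g ω)| ≤ B ω) (n : ℕ) :
    Integrable (fun ω => policyBest k v π (policyData F π g ξ ε n ω)) P ∧
      Integrable (fun ω => policyMean k v π (π n) (policyData F π g ξ ε n ω)) P ∧
      ∫ ω, max (policyMean k v π (π n) (policyData F π g ξ ε n ω))
          (policyBest k v π (policyData F π g ξ ε n ω)) ∂P ≤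
        ∫ ω, policyBest k v π (policyData F π g ξ ε (n + 1) ω) ∂P := by
  have hfi : ∀ {m : ℕ} {w : S × (Fin m → ℝ) → X}, Measurable w →
      Integrable (fun ω => F (w (policyData F π g ξ ε m ω)) (g ω)) P := fun {m w} hw =>
    hB.mono' (h.measurable_eval_comp hπ hw).aestronglyMeasurable
      (hfB.mono fun ω hω => hω _)
  have hbi : ∀ m, Integrable (fun ω => policyBest k v π (policyData F π g ξ ε m ω)) P := fun m => by
    rcases eq_or_ne m 0 with rfl | hm
    · simp [policyBest, evaluatedMeanMax]
    · obtain ⟨w, hw, hwp⟩ := h.exists_measurable_policyBest (n := m) hπ hm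
      simp_rw [fun p => (hwp p).2]
      exact (h.integral_policyMean hπ hw (hfi hw)).1
  refine ⟨hbi n, (h.integral_policyMean hπ (hπ n) (hfi (hπ n))).1, ?_⟩
  -- a point among the first `n + 1` queries at which the posterior mean is the maximum
  obtain ⟨u, hu, hup⟩ : ∃ u : S × (Fin n → ℝ) → X, Measurable u ∧ ∀ p,
      ((∃ i, u p = policyDesign π p.1 p.2 i) ∨ u p = π n p) ∧
      max (policyMean k v π (π n) p) (policyBest k v π p) = policyMean k v π u p := by
    rcases eq_or_ne n 0 with rfl | hn
    · refine ⟨π 0, hπ 0, fun p => ⟨Or.inr rfl, ?_⟩⟩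
      simp [policyBest, evaluatedMeanMax, policyMean, postMean_zero]
    · obtain ⟨w, hw, hwp⟩ := h.exists_measurable_policyBest (n := n) hπ hn
      refine ⟨fun p => if policyMean k v π w p ≤ policyMean k v π (π n) p then π n p else w p,
        Measurable.ite (measurableSet_le (h.measurable_policyMean hπ hw)
          (h.measurable_policyMean hπ (hπ n))) (hπ n) hw, fun p => ?_⟩
      rw [(hwp p).2]
      by_cases hc : policyMean k v π w p ≤ policyMean k v π (π n) p
      · refine ⟨Or.inr (if_pos hc), ?_⟩
        rw [max_eq_left hc]
        exact congrArg (postMean k v (policyDesign π p.1 p.2) p.2) (if_pos hc).symm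
      · refine ⟨Or.inl ?_, ?_⟩
        · obtain ⟨i, hi⟩ := (hwp p).1
          exact ⟨i, (if_neg hc).trans hi⟩
        · rw [max_eq_right (not_le.1 hc).le]
          exact congrArg (postMean k v (policyDesign π p.1 p.2) p.2) (if_neg hc).symm
  set u' : S × (Fin (n + 1) → ℝ) → X := fun p => u (p.1, fun i : Fin n => p.2 i.castSucc) with hu'
  have hu'm : Measurable u' := hu.comp (measurable_fst.prodMk (measurable_pi_lambda _ fun i =>
    (measurable_pi_apply _).comp measurable_snd))
  have hdata : ∀ ω, u' (policyData F π g ξ ε (n + 1) ω) = u (policyData F π g ξ ε n ω) :=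
    fun ω => rfl
  simp_rw [fun p => (hup p).2]
  rw [(h.integral_policyMean hπ hu (hfi hu)).2]
  have h1 := h.integral_policyMean hπ hu'm (hfi hu'm)
  simp_rw [hdata] at h1
  rw [← h1.2]
  refine integral_mono h1.1 (hbi (n + 1)) fun ω => ?_
  have hmem : ∃ i : Fin (n + 1), u' (policyData F π g ξ ε (n + 1) ω) =
      policyDesign π (policyData F π g ξ ε (n + 1) ω).1 (policyData F π g ξ ε (n + 1) ω).2 i := by
    rcases (hup (policyData F π g ξ ε n ω)).1 with ⟨i, hi⟩ | hi
    · exact ⟨i.castSucc, hi⟩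
    · exact ⟨Fin.last n, hi⟩
  obtain ⟨i, hi⟩ := hmem
  simp only [policyMean, hi]
  exact postMean_le_evaluatedMeanMax _ _ _ _ i

/-- The improvements of the posterior mean over the reference value telescope. -/
lemma sum_integral_improvement_le [Nonempty X] (h : IsGPModel P k v κ F g ξ ε)
    (hπ : ∀ n, Measurable (π n)) {B : Ω → ℝ} (hB : Integrable B P)
    (hfB : ∀ᵐ ω ∂P, ∀ z, |F z (g ω)| ≤ B ω) {M : Ω → ℝ} (hM : Integrable M P)
    (hfM : ∀ᵐ ω ∂P, ∀ z, F z (g ω) ≤ M ω) {T : ℕ} (hT : T ≠ 0) :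
    ∑ n ∈ Finset.range T, ∫ ω, max (policyMean k v π (π n) (policyData F π g ξ ε n ω) -
      policyBest k v π (policyData F π g ξ ε n ω)) 0 ∂P ≤ ∫ ω, M ω ∂P := by
  have hb := h.integral_max_le_integral_policyBest hπ hB hfB
  have h1 : ∀ n, ∫ ω, max (policyMean k v π (π n) (policyData F π g ξ ε n ω) -
      policyBest k v π (policyData F π g ξ ε n ω)) 0 ∂P ≤
      ∫ ω, policyBest k v π (policyData F π g ξ ε (n + 1) ω) ∂P -
        ∫ ω, policyBest k v π (policyData F π g ξ ε n ω) ∂P := fun n => by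
    obtain ⟨i1, i2, i3⟩ := hb n
    have : ∀ ω, max (policyMean k v π (π n) (policyData F π g ξ ε n ω) -
        policyBest k v π (policyData F π g ξ ε n ω)) 0 =
        max (policyMean k v π (π n) (policyData F π g ξ ε n ω))
          (policyBest k v π (policyData F π g ξ ε n ω)) -
          policyBest k v π (policyData F π g ξ ε n ω) := fun ω => by
      rw [← max_sub_sub_right, sub_self]
    simp_rw [this]
    refine (integral_sub (i2.sup i1) i1).trans_le ?_
    exact sub_le_sub_right i3 _
  refine (Finset.sum_le_sum fun n _ => h1 n).trans ?_
  rw [Finset.sum_range_sub fun n => ∫ ω, policyBest k v π (policyData F π g ξ ε n ω) ∂P]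
  have h0 : ∫ ω, policyBest k v π (policyData F π g ξ ε 0 ω) ∂P = 0 := by
    simp [policyBest, evaluatedMeanMax]
  obtain ⟨w, hw, hwp⟩ := h.exists_measurable_policyBest (n := T) hπ hT
  have hi : Integrable (fun ω => F (w (policyData F π g ξ ε T ω)) (g ω)) P :=
    hB.mono' (h.measurable_eval_comp hπ hw).aestronglyMeasurable (hfB.mono fun ω hω => hω _)
  rw [h0, sub_zero]
  simp_rw [fun p => (hwp p).2]
  rw [(h.integral_policyMean hπ hw hi).2]
  exact integral_mono_ae hi hM (hfM.mono fun ω hω => hω _)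

end IsGPModel

end PolicyPosterior

/-! ### Regret -/

section Regret

/-- The finite set `A` discretizes the domain of the random function `f` up to the random error `D`,
whose expectation is at most `δ`. -/
structure IsRounding {X Ω : Type*} [MeasurableSpace Ω] (P : Measure Ω) (f : X → Ω → ℝ)
    (A : Finset X) (D : Ω → ℝ) (δ : ℝ) : Prop where
  integrable : Integrable D P
  integral_le : ∫ ω, D ω ∂P ≤ δ
  approx : ∀ᵐ ω ∂P, ∀ z, ∃ z' ∈ A, |f z ω - f z' ω| ≤ D ω

lemma IsRounding.exists_integrable_bound {X Ω : Type*} [MeasurableSpace Ω] {P : Measure Ω}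
    {f : X → Ω → ℝ} {A : Finset X} {D : Ω → ℝ} {δ : ℝ} (h : IsRounding P f A D δ)
    (hf : ∀ z, Integrable (f z) P) :
    ∃ B : Ω → ℝ, Integrable B P ∧ ∀ᵐ ω ∂P, ∀ z, |f z ω| ≤ B ω := by
  refine ⟨fun ω => ∑ z ∈ A, |f z ω| + D ω,
    (integrable_finsetSum _ fun z _ => (hf z).abs).add h.integrable, h.approx.mono fun ω hω z => ?_⟩
  obtain ⟨z', hz', hle⟩ := hω z
  have h1 : |f z' ω| ≤ ∑ z ∈ A, |f z ω| :=
    Finset.single_le_sum (f := fun z => |f z ω|) (fun _ _ => abs_nonneg _) hz'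
  have h2 := abs_sub_abs_le_abs_sub (f z ω) (f z' ω)
  linarith

lemma sum_range_inv_sq_le (T : ℕ) : ∑ n ∈ Finset.range T, 1 / ((n : ℝ) + 1) ^ 2 ≤ 2 := by
  have h : ∀ T : ℕ, ∑ n ∈ Finset.range (T + 1), 1 / ((n : ℝ) + 1) ^ 2 ≤ 2 - 1 / ((T : ℝ) + 1) := by
    intro T
    induction T with
    | zero => norm_num
    | succ T ih =>
      rw [Finset.sum_range_succ]
      have : 1 / (((T + 1 : ℕ) : ℝ) + 1) ^ 2 ≤ 1 / ((T : ℝ) + 1) - 1 / (((T + 1 : ℕ) : ℝ) + 1) := by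
        push_cast
        rw [div_sub_div _ _ (by positivity) (by positivity),
          div_le_div_iff₀ (by positivity) (by positivity)]
        nlinarith [(Nat.cast_nonneg T : (0 : ℝ) ≤ T)]
      linarith
  rcases T with _ | T
  · simp
  · exact (h T).trans (sub_le_self _ (by positivity))

variable {X E S Ω : Type*} [MeasurableSpace X] [MeasurableSpace E] [MeasurableSpace S]
  [MeasurableSpace Ω] {P : Measure Ω} {k : X → X → ℝ} {v : ℝ≥0} {κ : ℝ}
  {F : X → E → ℝ} {g : Ω → E} {ξ : Ω → S} {ε : ℕ → Ω → ℝ} {π : ∀ n : ℕ, S × (Fin n → ℝ) → X}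

namespace IsGPModel

lemma seqPostVar_nonneg (h : IsGPModel P k v κ F g ξ ε) {T : ℕ} (a : Fin T → X) (i : Fin T) :
    0 ≤ seqPostVar k v a i := h.gp.postVar_nonneg h.v_pos _ _

lemma seqPostVar_le_one (h : IsGPModel P k v κ F g ξ ε) {T : ℕ} (a : Fin T → X) (i : Fin T) :
    seqPostVar k v a i ≤ 1 :=
  (h.gp.postVar_le h.v_pos _ _).trans (h.kernel_mem _).2

variable [IsProbabilityMeasure P]

/-- The maximum information gain is finite, so it dominates the information gain of each design. -/
lemma sum_log_le_maxInfoGain [Nonempty X] (h : IsGPModel P k v κ F g ξ ε) {T : ℕ} (a : Fin T → X) :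
    ∑ i, Real.log (1 + seqPostVar k v a i / v) / 2 ≤
      maxInfoGain P (fun z ω => F z (g ω)) ε T := by
  have hv : (0 : ℝ) < v := by exact_mod_cast h.v_pos
  have hMI := fun A : Fin T → X =>
    h.toIsNoisyModel.mutualInfo_eq h.v_pos h.gp h.measurable_eval A
  have hterm : ∀ (A : Fin T → X) (i : Fin T), Real.log (1 + seqPostVar k v A i / v) / 2 ≤
      Real.log (1 + 1 / v) / 2 := fun A i => by
    have h0 := h.seqPostVar_nonneg A i
    have h1 := h.seqPostVar_le_one A i
    gcongr
  have hfin : (⨆ A : Fin T → X, mutualInfo P (fun ω (i : Fin T) => F (A i) (g ω) + ε i ω)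
      (fun ω i => F (A i) (g ω))) ≠ ∞ := by
    refine ne_top_of_le_ne_top (ENNReal.ofReal_ne_top (r := ∑ _i : Fin T, Real.log (1 + 1 / v) / 2))
      (iSup_le fun A => ?_)
    rw [hMI]
    exact ENNReal.ofReal_le_ofReal (Finset.sum_le_sum fun i _ => hterm A i)
  rw [maxInfoGain, ← ENNReal.ofReal_le_iff_le_toReal hfin, ← hMI]
  exact le_iSup (fun A : Fin T → X => mutualInfo P (fun ω (i : Fin T) => F (A i) (g ω) + ε i ω)
      (fun ω i => F (A i) (g ω))) a

lemma log_one_add_div_le_maxInfoGain [Nonempty X] (h : IsGPModel P k v κ F g ξ ε) {T : ℕ}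
    (hT : 0 < T) :
    Real.log (1 + κ / v) / 2 ≤ maxInfoGain P (fun z ω => F z (g ω)) ε T := by
  have hv : (0 : ℝ) < v := by exact_mod_cast h.v_pos
  have hκ := h.κ_pos
  set a : Fin T → X := fun _ => Classical.arbitrary X
  refine le_trans ?_ (h.sum_log_le_maxInfoGain a)
  have h0 : κ ≤ seqPostVar k v a ⟨0, hT⟩ := by
    have := h.gp.le_postVar h.v_pos (fun z => (h.kernel_mem z).2) (designPrefix a ⟨0, hT⟩)
      (a ⟨0, hT⟩)
    rw [Nat.cast_zero, add_zero, mul_div_cancel_right₀ _ hv.ne'] at this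
    exact (h.kernel_mem _).1.trans this
  refine le_trans ?_ (Finset.single_le_sum
    (f := fun i => Real.log (1 + seqPostVar k v a i / v) / 2) (fun i _ => ?_)
    (Finset.mem_univ (⟨0, hT⟩ : Fin T)))
  · gcongr
  · have := h.seqPostVar_nonneg a i
    exact div_nonneg (Real.log_nonneg (le_add_of_nonneg_right (by positivity))) zero_le_two

/-- The posterior variances at the queries sum to at most a multiple of the maximum information
gain, whatever the data. -/
lemma sum_sq_policySd_le [Nonempty X] (h : IsGPModel P k v κ F g ξ ε) (T : ℕ) (ω : Ω) :
    ∑ n ∈ Finset.range T, policySd k v π (π n) (policyData F π g ξ ε n ω) ^ 2 ≤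
      2 * (v + 1) * maxInfoGain P (fun z ω => F z (g ω)) ε T := by
  have hv : (0 : ℝ) < v := by exact_mod_cast h.v_pos
  set a : Fin T → X := fun i => π i (policyData F π g ξ ε i ω) with ha
  have h1 : ∀ i : Fin T, policySd k v π (π i) (policyData F π g ξ ε i ω) ^ 2 =
      seqPostVar k v a i := fun i => by
    rw [policySd, postSd, Real.sq_sqrt (h.gp.postVar_nonneg h.v_pos _ _)]
    rfl
  rw [← Fin.sum_univ_eq_sum_range fun n => policySd k v π (π n) (policyData F π g ξ ε n ω) ^ 2]
  refine le_trans ?_ (mul_le_mul_of_nonneg_left (h.sum_log_le_maxInfoGain a) (by positivity))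
  rw [Finset.mul_sum]
  refine Finset.sum_le_sum fun i _ => ?_
  rw [h1]
  have h0 := h.seqPostVar_nonneg a i
  have hle := h.seqPostVar_le_one a i
  have hpos : 0 < 1 + seqPostVar k v a i / v := by positivity
  have hlog := Real.one_sub_inv_le_log_of_pos hpos
  have hinv : 1 - (1 + seqPostVar k v a i / v)⁻¹ =
      seqPostVar k v a i / (v + seqPostVar k v a i) := by
    field_simp
    ring
  rw [hinv] at hlog
  have h2 : seqPostVar k v a i / (v + 1) ≤ seqPostVar k v a i / (v + seqPostVar k v a i) := by
    gcongr
  have h3 := (div_le_iff₀ (by positivity)).1 (h2.trans hlog)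
  linarith

lemma sum_policySd_le [Nonempty X] (h : IsGPModel P k v κ F g ξ ε) (T : ℕ) (ω : Ω) :
    ∑ n ∈ Finset.range T, policySd k v π (π n) (policyData F π g ξ ε n ω) ≤
      √(2 * (v + 1) * maxInfoGain P (fun z ω => F z (g ω)) ε T * T) := by
  refine Real.le_sqrt_of_sq_le ((sq_sum_le_card_mul_sum_sq (s := Finset.range T)
    (f := fun n => policySd k v π (π n) (policyData F π g ξ ε n ω))).trans ?_)
  rw [Finset.card_range, mul_comm]
  exact mul_le_mul_of_nonneg_right (h.sum_sq_policySd_le T ω) (Nat.cast_nonneg T)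

/-- If all upper confidence bounds lie below `R`, then up to discretization the expected maximum of
the objective is at most the expectation of `R`. -/
lemma integral_max_le [Nonempty X] (h : IsGPModel P k v κ F g ξ ε) (hπ : ∀ n, Measurable (π n))
    {M : Ω → ℝ} (hM : Integrable M P) (hfM : ∀ᵐ ω ∂P, ∃ z, M ω = F z (g ω)) {A : Finset X}
    {D : Ω → ℝ} {δ β : ℝ} (hA : IsRounding P (fun z ω => F z (g ω)) A D δ)
    (hAβ : A.card * gaussianPDFReal 0 1 √β ≤ δ) (n : ℕ) {R : Ω → ℝ} (hR : Integrable R P)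
    (hUR : ∀ᵐ ω ∂P, ∀ z, policyMean k v π (fun _ => z) (policyData F π g ξ ε n ω) +
      √β * policySd k v π (fun _ => z) (policyData F π g ξ ε n ω) ≤ R ω) :
    ∫ ω, M ω ∂P ≤ ∫ ω, R ω ∂P + 2 * δ := by
  set e : X → Ω → ℝ := fun z ω => max (F z (g ω) -
    (policyMean k v π (fun _ => z) (policyData F π g ξ ε n ω) +
      √β * policySd k v π (fun _ => z) (policyData F π g ξ ε n ω))) 0 with he
  have hei := fun z => h.integral_excess_ucb_le hπ n z (β := β)
  have hsum : Integrable (fun ω => ∑ z ∈ A, e z ω) P := integrable_finsetSum _ fun z _ => (hei z).1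
  have hle : ∀ᵐ ω ∂P, M ω ≤ R ω + (D ω + ∑ z ∈ A, e z ω) := by
    filter_upwards [hfM, hUR, hA.approx] with ω ⟨z, hz⟩ hU hap
    obtain ⟨z', hz', hD⟩ := hap z
    have h1 := (le_abs_self _).trans hD
    have h2 : e z' ω ≤ ∑ z ∈ A, e z ω :=
      Finset.single_le_sum (f := fun z => e z ω) (fun _ _ => le_max_right _ _) hz'
    have h3 : _ ≤ e z' ω := le_max_left _ _
    have h4 := hU z'
    rw [hz]
    linarith
  refine (integral_mono_ae hM (hR.add (hA.integrable.add hsum)) hle).trans ?_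
  have hadd : ∫ ω, (R ω + (D ω + ∑ z ∈ A, e z ω)) ∂P =
      ∫ ω, R ω ∂P + (∫ ω, D ω ∂P + ∑ z ∈ A, ∫ ω, e z ω ∂P) := by
    have i1 : Integrable (fun ω => D ω + ∑ z ∈ A, e z ω) P := hA.integrable.add hsum
    rw [integral_add hR i1, integral_add hA.integrable hsum,
      integral_finsetSum _ fun z _ => (hei z).1]
  refine hadd.trans_le ?_
  have h5 : ∑ z ∈ A, ∫ ω, e z ω ∂P ≤ A.card * gaussianPDFReal 0 1 √β := by
    rw [← nsmul_eq_mul]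
    exact Finset.sum_le_card_nsmul _ _ _ fun z _ => (hei z).2
  have := hA.integral_le
  linarith

/-- The expected maximum, bounded by means of the prior: without data the posterior mean is `0`. -/
lemma integral_max_le_sqrt [Nonempty X] (h : IsGPModel P k v κ F g ξ ε)
    (hπ : ∀ n, Measurable (π n)) {M : Ω → ℝ} (hM : Integrable M P)
    (hfM : ∀ᵐ ω ∂P, ∃ z, M ω = F z (g ω)) {A : Finset X} {D : Ω → ℝ} {δ β : ℝ}
    (hA : IsRounding P (fun z ω => F z (g ω)) A D δ)
    (hAβ : A.card * gaussianPDFReal 0 1 √β ≤ δ) :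
    ∫ ω, M ω ∂P ≤ √β + 2 * δ := by
  refine (h.integral_max_le hπ hM hfM hA hAβ 0 (integrable_const √β)
    (Eventually.of_forall fun ω z => ?_)).trans_eq (by simp)
  rw [policyMean, postMean_zero, zero_add]
  exact mul_le_of_le_one_right (Real.sqrt_nonneg β)
    (h.policySd_le_one (π := π) (w := fun _ => z) (policyData F π g ξ ε 0 ω))

/-- The expected regret of a single query that maximizes the expected improvement. -/
lemma integral_regret_le [Nonempty X] (h : IsGPModel P k v κ F g ξ ε) (hπ : ∀ n, Measurable (π n))
    {M : Ω → ℝ} (hM : Integrable M P) (hfM : ∀ᵐ ω ∂P, ∃ z, M ω = F z (g ω)) {B : Ω → ℝ}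
    (hB : Integrable B P) (hfB : ∀ᵐ ω ∂P, ∀ z, |F z (g ω)| ≤ B ω) {A : Finset X} {D : Ω → ℝ}
    {δ β : ℝ} (hβ : 0 < β) (hA : IsRounding P (fun z ω => F z (g ω)) A D δ)
    (hAβ : A.card * gaussianPDFReal 0 1 √β ≤ δ) {n : ℕ}
    (hmax : ∀ᵐ ω ∂P, ∀ z, scaledEI k v β
      (policyDesign π (ξ ω) (policyHist F π g ξ ε n ω)) (policyHist F π g ξ ε n ω) z ≤
      scaledEI k v β (policyDesign π (ξ ω) (policyHist F π g ξ ε n ω)) (policyHist F π g ξ ε n ω)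
        (π n (policyData F π g ξ ε n ω))) :
    ∫ ω, (M ω - F (π n (policyData F π g ξ ε n ω)) (g ω)) ∂P ≤ 2 * δ +
      √β * (gaussianPDFReal 0 1 0 / upperTail + √(Real.log ((v + n) / (κ * v)))) *
        ∫ ω, policySd k v π (π n) (policyData F π g ξ ε n ω) ∂P +
      (∫ ω, max (policyMean k v π (π n) (policyData F π g ξ ε n ω) -
        policyBest k v π (policyData F π g ξ ε n ω)) 0 ∂P) / upperTail := by
  set q := gaussianPDFReal 0 1 0 / upperTail + √(Real.log ((v + n) / (κ * v))) with hq
  obtain ⟨ib, im, -⟩ := h.integral_max_le_integral_policyBest hπ hB hfB n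
  have hfi : Integrable (fun ω => F (π n (policyData F π g ξ ε n ω)) (g ω)) P :=
    hB.mono' (h.measurable_eval_comp hπ (hπ n)).aestronglyMeasurable (hfB.mono fun ω hω => hω _)
  have hsd : Integrable (fun ω => policySd k v π (π n) (policyData F π g ξ ε n ω)) P := by
    refine (integrable_const (1 : ℝ)).mono' ((h.measurable_policySd hπ (hπ n)).comp
      (h.measurable_policyData hπ n)).aestronglyMeasurable (Eventually.of_forall fun ω => ?_)
    rw [Real.norm_of_nonneg (policySd_nonneg _ _ _ _ _)]
    exact h.policySd_le_one _
  have himp : Integrable (fun ω => max (policyMean k v π (π n) (policyData F π g ξ ε n ω) -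
      policyBest k v π (policyData F π g ξ ε n ω)) 0) P := (im.sub ib).pos_part
  have i1 : Integrable (fun ω => √β * q * policySd k v π (π n) (policyData F π g ξ ε n ω)) P :=
    hsd.const_mul _
  have i2 := himp.div_const upperTail
  have i3 : Integrable (fun ω => √β * q * policySd k v π (π n) (policyData F π g ξ ε n ω) +
      max (policyMean k v π (π n) (policyData F π g ξ ε n ω) -
        policyBest k v π (policyData F π g ξ ε n ω)) 0 / upperTail) P := i1.add i2
  have hmain := h.integral_max_le hπ hM hfM hA hAβ n (im.add i3) <| by
    filter_upwards [hmax] with ω hω z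
    have := h.gp.ucb_sub_postMean_le h.v_pos h.κ_pos h.kernel_mem hβ _ _ hω z
    simp only [Pi.add_apply, policyMean, policySd, policyBest, policyData] at this ⊢
    rw [← hq] at this
    linarith
  have hadd : ∫ ω, (policyMean k v π (π n) (policyData F π g ξ ε n ω) +
      (√β * q * policySd k v π (π n) (policyData F π g ξ ε n ω) +
        max (policyMean k v π (π n) (policyData F π g ξ ε n ω) -
          policyBest k v π (policyData F π g ξ ε n ω)) 0 / upperTail)) ∂P =
      ∫ ω, policyMean k v π (π n) (policyData F π g ξ ε n ω) ∂P +
      (√β * q * ∫ ω, policySd k v π (π n) (policyData F π g ξ ε n ω) ∂P +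
        (∫ ω, max (policyMean k v π (π n) (policyData F π g ξ ε n ω) -
          policyBest k v π (policyData F π g ξ ε n ω)) 0 ∂P) / upperTail) := by
    rw [integral_add im i3, integral_add i1 i2, integral_const_mul, integral_div]
  have hmain' := hmain.trans_eq (congrArg (· + 2 * δ) hadd)
  rw [(h.integral_policyMean hπ (hπ n) hfi).2] at hmain'
  rw [integral_sub hM hfi]
  linarith

/-- The cumulative regret, with explicit constants. -/
theorem sum_integral_regret_le [Nonempty X] (h : IsGPModel P k v κ F g ξ ε)
    (hπ : ∀ n, Measurable (π n)) {M : Ω → ℝ} (hM : Integrable M P)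
    (hfM : ∀ᵐ ω ∂P, ∃ z, M ω = F z (g ω)) (hMf : ∀ᵐ ω ∂P, ∀ z, F z (g ω) ≤ M ω) {β : ℕ → ℝ}
    (hβ : ∀ n, 0 < β (n + 1)) (hβm : ∀ m n, m ≤ n → β (m + 1) ≤ β (n + 1))
    (hA : ∀ n : ℕ, ∃ A D, IsRounding P (fun z ω => F z (g ω)) A D (1 / ((n : ℝ) + 1) ^ 2) ∧
      A.card * gaussianPDFReal 0 1 √(β (n + 1)) ≤ 1 / ((n : ℝ) + 1) ^ 2)
    (hmax : ∀ n, ∀ᵐ ω ∂P, ∀ z, scaledEI k v (β (n + 1))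
      (policyDesign π (ξ ω) (policyHist F π g ξ ε n ω)) (policyHist F π g ξ ε n ω) z ≤
      scaledEI k v (β (n + 1)) (policyDesign π (ξ ω) (policyHist F π g ξ ε n ω))
        (policyHist F π g ξ ε n ω) (π n (policyData F π g ξ ε n ω))) (T : ℕ) :
    ∑ n ∈ Finset.range (T + 1), ∫ ω, (M ω - F (π n (policyData F π g ξ ε n ω)) (g ω)) ∂P ≤ 4 +
      √(β (T + 1)) * (gaussianPDFReal 0 1 0 / upperTail +
          √(Real.log ((v + (T + 1 : ℕ)) / (κ * v)))) *
        √(2 * (v + 1) * maxInfoGain P (fun z ω => F z (g ω)) ε (T + 1) * (T + 1 : ℕ)) +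
      (√(β (T + 1)) + 2) / upperTail := by
  have hv : (0 : ℝ) < v := by exact_mod_cast h.v_pos
  have hκ := h.κ_pos
  have hp := upperTail_pos
  obtain ⟨A₀, D₀, hA₀, hA₀β⟩ := hA 0
  obtain ⟨B, hB, hfB⟩ := hA₀.exists_integrable_bound h.gp.integrable
  set q : ℕ → ℝ := fun n => gaussianPDFReal 0 1 0 / upperTail + √(Real.log ((v + n) / (κ * v)))
    with hq
  have hq0 : ∀ n, 0 ≤ q n := fun n =>
    add_nonneg (div_nonneg (gaussianPDFReal_nonneg _ _ _) hp.le) (Real.sqrt_nonneg _)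
  have hqm : ∀ n ≤ T, q n ≤ q (T + 1) := fun n hn => by
    have : (n : ℝ) ≤ (T + 1 : ℕ) := by exact_mod_cast hn.trans T.le_succ
    refine add_le_add_right (Real.sqrt_le_sqrt (Real.log_le_log (by positivity) ?_)) _
    gcongr
  have hsd0 : ∀ n, 0 ≤ ∫ ω, policySd k v π (π n) (policyData F π g ξ ε n ω) ∂P := fun n =>
    integral_nonneg fun ω => policySd_nonneg _ _ _ _ _
  have hsd : ∀ n, Integrable (fun ω => policySd k v π (π n) (policyData F π g ξ ε n ω)) P :=
    fun n => by
    refine (integrable_const (1 : ℝ)).mono' ((h.measurable_policySd hπ (hπ n)).comp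
      (h.measurable_policyData hπ n)).aestronglyMeasurable (Eventually.of_forall fun ω => ?_)
    rw [Real.norm_of_nonneg (policySd_nonneg _ _ _ _ _)]
    exact h.policySd_le_one _
  have hstep : ∀ n ∈ Finset.range (T + 1),
      ∫ ω, (M ω - F (π n (policyData F π g ξ ε n ω)) (g ω)) ∂P ≤ 2 * (1 / ((n : ℝ) + 1) ^ 2) +
      √(β (T + 1)) * q (T + 1) * ∫ ω, policySd k v π (π n) (policyData F π g ξ ε n ω) ∂P +
      (∫ ω, max (policyMean k v π (π n) (policyData F π g ξ ε n ω) -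
        policyBest k v π (policyData F π g ξ ε n ω)) 0 ∂P) / upperTail := fun n hn => by
    have hnT : n ≤ T := Nat.lt_succ_iff.1 (Finset.mem_range.1 hn)
    obtain ⟨A, D, hAD, hAβ⟩ := hA n
    refine (h.integral_regret_le hπ hM hfM hB hfB (hβ n) hAD hAβ (hmax n)).trans ?_
    have h1 : √(β (n + 1)) * q n ≤ √(β (T + 1)) * q (T + 1) :=
      mul_le_mul (Real.sqrt_le_sqrt (hβm n T hnT)) (hqm n hnT) (hq0 n) (Real.sqrt_nonneg _)
    have h2 := mul_le_mul_of_nonneg_right h1 (hsd0 n)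
    simp only [hq] at h2 ⊢
    linarith
  refine (Finset.sum_le_sum hstep).trans ?_
  rw [Finset.sum_add_distrib, Finset.sum_add_distrib, ← Finset.mul_sum, ← Finset.mul_sum,
    ← Finset.sum_div]
  have h1 := sum_range_inv_sq_le (T + 1)
  have h2 : ∑ n ∈ Finset.range (T + 1), ∫ ω, policySd k v π (π n) (policyData F π g ξ ε n ω) ∂P ≤
      √(2 * (v + 1) * maxInfoGain P (fun z ω => F z (g ω)) ε (T + 1) * (T + 1 : ℕ)) := by
    rw [← integral_finsetSum _ fun n _ => hsd n]
    refine (integral_mono (integrable_finsetSum _ fun n _ => hsd n) (integrable_const _)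
      fun ω => h.sum_policySd_le (T + 1) ω).trans_eq (by simp)
  have h3 := h.sum_integral_improvement_le hπ hB hfB hM hMf T.succ_ne_zero
  have h4 := h.integral_max_le_sqrt hπ hM hfM hA₀ hA₀β
  have h5 := Real.sqrt_le_sqrt (hβm 0 T T.zero_le)
  have h6 := mul_le_mul_of_nonneg_left h2 (mul_nonneg (Real.sqrt_nonneg (β (T + 1))) (hq0 (T + 1)))
  have h7 : (∑ n ∈ Finset.range (T + 1), ∫ ω, max
      (policyMean k v π (π n) (policyData F π g ξ ε n ω) -
        policyBest k v π (policyData F π g ξ ε n ω)) 0 ∂P) / upperTail ≤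
      (√(β (T + 1)) + 2) / upperTail := by
    refine div_le_div_of_nonneg_right (h3.trans (h4.trans ?_)) hp.le
    norm_num at h5 ⊢
    linarith
  simp only [hq] at h6 ⊢
  linarith

end IsGPModel

/-- The constant of the regret bound, for noise variance `v`, variances at least `κ`, and a scale
parameter `β ≥ c`. -/
def regretConst (v : ℝ≥0) (κ c : ℝ) : ℝ :=
  4 / √(c * (Real.log (1 + κ / v) / 2) * Real.log 2) +
    (gaussianPDFReal 0 1 0 / upperTail / √(Real.log 2) +
      √(1 + |Real.log ((v + 1) / (κ * v))| / Real.log 2)) * √(2 * (v + 1)) +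
    (1 / √(Real.log (1 + κ / v) / 2 * Real.log 2) +
      2 / √(c * (Real.log (1 + κ / v) / 2) * Real.log 2)) / upperTail

/-- All terms of the regret bound are at most of the order `√(β γ T log T)`. -/
lemma le_regretConst_mul {v : ℝ≥0} (hv : 0 < v) {κ c β γ : ℝ} (hκ : 0 < κ) (hc : 0 < c)
    (hβ : c ≤ β) (hγ : Real.log (1 + κ / v) / 2 ≤ γ) {T : ℕ} (hT : 2 ≤ T) :
    4 + √β * (gaussianPDFReal 0 1 0 / upperTail + √(Real.log ((v + T) / (κ * v)))) *
        √(2 * (v + 1) * γ * T) + (√β + 2) / upperTail ≤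
      regretConst v κ c * √(β * γ * T * Real.log T) := by
  have hv' : (0 : ℝ) < v := by exact_mod_cast hv
  have hp := upperTail_pos
  have hT2 : (2 : ℝ) ≤ T := by exact_mod_cast hT
  have hT0 : (0 : ℝ) < T := by linarith
  have hl2 : 0 < Real.log 2 := Real.log_pos one_lt_two
  have hlT : Real.log 2 ≤ Real.log T := Real.log_le_log two_pos hT2
  have hlT0 : 0 < Real.log T := hl2.trans_le hlT
  set g := Real.log (1 + κ / v) / 2 with hg
  have hg0 : 0 < g := by
    have : 0 < κ / v := by positivity
    exact div_pos (Real.log_pos (by linarith)) two_pos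
  have hγ0 : 0 < γ := hg0.trans_le hγ
  have hβ0 : 0 < β := hc.trans_le hβ
  set Q := √(β * γ * T * Real.log T) with hQ
  have hprod : g * Real.log 2 ≤ γ * T * Real.log T := by
    have : g ≤ γ * T := by nlinarith
    gcongr
  have h1 : 1 ≤ Q / √(c * g * Real.log 2) := by
    rw [one_le_div (Real.sqrt_pos.2 (by positivity))]
    refine Real.sqrt_le_sqrt ?_
    calc c * g * Real.log 2 = c * (g * Real.log 2) := by ring
      _ ≤ β * (γ * T * Real.log T) := by gcongr
      _ = _ := by ring
  have h2 : √β ≤ Q / √(g * Real.log 2) := by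
    rw [le_div_iff₀ (Real.sqrt_pos.2 (by positivity)), ← Real.sqrt_mul hβ0.le]
    refine Real.sqrt_le_sqrt ?_
    calc β * (g * Real.log 2) ≤ β * (γ * T * Real.log T) := by gcongr
      _ = _ := by ring
  have hQsplit : √β * √(2 * (v + 1) * γ * T) * √(Real.log T) = √(2 * (v + 1)) * Q := by
    rw [← Real.sqrt_mul hβ0.le, ← Real.sqrt_mul (by positivity), ← Real.sqrt_mul (by positivity)]
    congr 1
    ring
  have h3 : gaussianPDFReal 0 1 0 / upperTail ≤
      gaussianPDFReal 0 1 0 / upperTail / √(Real.log 2) * √(Real.log T) := by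
    rw [div_mul_eq_mul_div, le_div_iff₀ (Real.sqrt_pos.2 hl2)]
    exact mul_le_mul_of_nonneg_left (Real.sqrt_le_sqrt hlT)
      (div_nonneg (gaussianPDFReal_nonneg _ _ _) hp.le)
  have h4 : √(Real.log ((v + T) / (κ * v))) ≤
      √(1 + |Real.log ((v + 1) / (κ * v))| / Real.log 2) * √(Real.log T) := by
    rw [← Real.sqrt_mul (by positivity)]
    refine Real.sqrt_le_sqrt ?_
    calc Real.log ((v + T) / (κ * v)) ≤ Real.log (T * ((v + 1) / (κ * v))) := by
          refine Real.log_le_log (by positivity) ?_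
          rw [← mul_div_assoc]
          gcongr
          nlinarith
      _ = Real.log T + Real.log ((v + 1) / (κ * v)) := Real.log_mul (by positivity) (by positivity)
      _ ≤ Real.log T + |Real.log ((v + 1) / (κ * v))| / Real.log 2 * Real.log T := by
          gcongr
          refine (le_abs_self _).trans ?_
          rw [div_mul_eq_mul_div, le_div_iff₀ hl2]
          gcongr
      _ = _ := by ring
  have h5 : √β * (gaussianPDFReal 0 1 0 / upperTail + √(Real.log ((v + T) / (κ * v)))) *
      √(2 * (v + 1) * γ * T) ≤ (gaussianPDFReal 0 1 0 / upperTail / √(Real.log 2) +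
      √(1 + |Real.log ((v + 1) / (κ * v))| / Real.log 2)) * √(2 * (v + 1)) * Q := by
    rw [mul_assoc _ (√(2 * ((v : ℝ) + 1))), ← hQsplit]
    have := mul_le_mul_of_nonneg_right (add_le_add h3 h4)
      (mul_nonneg (Real.sqrt_nonneg β) (Real.sqrt_nonneg (2 * (v + 1) * γ * T)))
    linarith
  have h6 : (√β + 2) / upperTail ≤ (1 / √(g * Real.log 2) + 2 / √(c * g * Real.log 2)) /
      upperTail * Q := by
    rw [div_mul_eq_mul_div]
    refine div_le_div_of_nonneg_right ?_ hp.le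
    have e1 : (1 / √(g * Real.log 2) + 2 / √(c * g * Real.log 2)) * Q =
      Q / √(g * Real.log 2) + 2 * (Q / √(c * g * Real.log 2)) := by ring
    rw [e1]
    linarith
  have h7 : 4 / √(c * g * Real.log 2) * Q = 4 * (Q / √(c * g * Real.log 2)) := by ring
  rw [regretConst, ← hg, add_mul, add_mul, h7]
  linarith

end Regret

/-! ### Discretization of the domain -/

section GaussianTail

/-- A Gaussian tail bound with a factor `q` in front controls the mean: the tail probability is at
most `1` up to `b √(log q)`, where the bound drops below `1`. -/
lemma lintegral_le_of_gaussian_tail {Ω : Type*} [MeasurableSpace Ω] {P : Measure Ω}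
    [IsProbabilityMeasure P] {M : Ω → ℝ} (hM : Measurable M) (hM0 : ∀ ω, 0 ≤ M ω) {q b : ℝ}
    (hq : 1 ≤ q) (hb : 0 < b)
    (htail : ∀ c : ℝ, 0 < c → P {ω | c < M ω} ≤ ENNReal.ofReal (q * Real.exp (-(c / b) ^ 2))) :
    ∫⁻ ω, ENNReal.ofReal (M ω) ∂P ≤
      ENNReal.ofReal (b * (√(Real.log q) + √Real.pi / 2)) := by
  set s := b * √(Real.log q) with hs
  have hs0 : 0 ≤ s := by positivity
  have hlog : 0 ≤ Real.log q := Real.log_nonneg hq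
  rw [lintegral_eq_lintegral_meas_lt P (Eventually.of_forall hM0) hM.aemeasurable,
    ← Set.Ioc_union_Ioi_eq_Ioi hs0]
  refine (lintegral_union_le _ _ _).trans ?_
  rw [mul_add, ENNReal.ofReal_add hs0 (by positivity)]
  refine add_le_add ?_ ?_
  · calc ∫⁻ t in Set.Ioc 0 s, P {ω | t < M ω} ≤ ∫⁻ _t in Set.Ioc 0 s, 1 :=
          lintegral_mono fun t => prob_le_one
      _ = ENNReal.ofReal s := by simp
  · -- beyond `s` the bound is below the shifted Gaussian
    have hle : ∀ t ∈ Set.Ioi s, P {ω | t < M ω} ≤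
        ENNReal.ofReal (Real.exp (-(1 / b ^ 2) * (t - s) ^ 2)) := fun t ht => by
      have ht : s < t := ht
      refine (htail t (hs0.trans_lt ht)).trans (ENNReal.ofReal_le_ofReal ?_)
      rw [← Real.exp_log (zero_lt_one.trans_le hq), ← Real.exp_add]
      refine Real.exp_le_exp.2 ?_
      have hsq : s ^ 2 = b ^ 2 * Real.log q := by rw [hs, mul_pow, Real.sq_sqrt hlog]
      have hlq : Real.log q = s ^ 2 / b ^ 2 := by rw [hsq]; field_simp
      rw [hlq, div_pow]
      have : s ^ 2 / b ^ 2 + -(t ^ 2 / b ^ 2) - -(1 / b ^ 2) * (t - s) ^ 2 =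
          2 * s * (s - t) / b ^ 2 := by ring
      have h2 : 2 * s * (s - t) / b ^ 2 ≤ 0 :=
        div_nonpos_of_nonpos_of_nonneg
          (mul_nonpos_of_nonneg_of_nonpos (by positivity) (by linarith)) (by positivity)
      linarith
    refine (setLIntegral_mono' measurableSet_Ioi hle).trans ?_
    have hpre : (fun t : ℝ => t - s) ⁻¹' Set.Ioi 0 = Set.Ioi s := by
      ext t; simp
    have hshift := (measurePreserving_sub_right (volume : Measure ℝ) s).setLIntegral_comp_preimage
      (s := Set.Ioi 0) measurableSet_Ioi
      (f := fun u => ENNReal.ofReal (Real.exp (-(1 / b ^ 2) * u ^ 2))) (by fun_prop)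
    rw [hpre] at hshift
    rw [hshift, ← ofReal_integral_eq_lintegral_ofReal
      (integrable_exp_neg_mul_sq (by positivity)).integrableOn
      (Eventually.of_forall fun _ => (Real.exp_pos _).le), integral_gaussian_Ioi]
    refine ENNReal.ofReal_le_ofReal (le_of_eq ?_)
    rw [div_div_eq_mul_div, div_one, Real.sqrt_mul Real.pi_pos.le, Real.sqrt_sq hb.le]
    ring

end GaussianTail

section ScaleParameter

lemma one_div_sqrt_add_one_pos : 0 < 1 / √(2 * Real.pi) := by positivity

/-- The scale parameter is calibrated so that a union bound over `N` Gaussian tails costs at most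
`t⁻²`. -/
lemma card_mul_gaussianPDFReal_le {N t β : ℝ} (ht : 0 < t) (hβ0 : 0 ≤ β)
    (hβ : N * t ^ 2 / √(2 * Real.pi) ≤ Real.exp (β / 2)) :
    N * gaussianPDFReal 0 1 √β ≤ 1 / t ^ 2 := by
  rw [gaussianPDFReal_std, Real.sq_sqrt hβ0, le_div_iff₀ (by positivity)]
  rw [neg_div, Real.exp_neg]
  have he := Real.exp_pos (β / 2)
  calc N * ((√(2 * Real.pi))⁻¹ * (Real.exp (β / 2))⁻¹) * t ^ 2
      = N * t ^ 2 / √(2 * Real.pi) / Real.exp (β / 2) := by field_simp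
    _ ≤ 1 := (div_le_one he).2 hβ

/-- A lower bound for the first scale parameter. -/
def scaleMin : ℝ := 2 * Real.log (1 / √(2 * Real.pi) + 1)

lemma scaleMin_pos : 0 < scaleMin :=
  mul_pos two_pos (Real.log_pos (lt_add_of_pos_left _ one_div_sqrt_add_one_pos))

lemma betaFinite_mono {N m n : ℕ} (h : m ≤ n) : betaFinite N m ≤ betaFinite N n := by
  unfold betaFinite
  gcongr

lemma scaleMin_le_betaFinite {N : ℕ} (hN : 1 ≤ N) {t : ℕ} (ht : 1 ≤ t) :
    scaleMin ≤ betaFinite N t := by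
  have h1 : (1 : ℝ) ≤ N := by exact_mod_cast hN
  have h2 : (1 : ℝ) ≤ (t : ℝ) ^ 2 := one_le_pow₀ (by exact_mod_cast ht)
  unfold scaleMin betaFinite
  gcongr
  nlinarith

/-- The number of cells per axis. -/
def gridSize (d : ℕ) (r a b : ℝ) (t : ℕ) : ℕ :=
  ⌈b * d * r * (t : ℝ) ^ 2 * (√(Real.log (a * d)) + √Real.pi / 2)⌉₊

lemma betaContinuous_eq (d : ℕ) (r a b : ℝ) (t : ℕ) :
    betaContinuous d r a b t = 2 * d * Real.log (gridSize d r a b t) +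
      2 * Real.log ((t : ℝ) ^ 2 / √(2 * Real.pi) + 1) := rfl

variable {d : ℕ} {r a b : ℝ}

lemma gridSize_pos (hd : 1 ≤ d) (hr : 0 < r) (hb : 0 < b) {t : ℕ} (ht : 1 ≤ t) :
    0 < gridSize d r a b t := by
  have h1 : (0 : ℝ) < d := by exact_mod_cast hd
  have h2 : (0 : ℝ) < t := by exact_mod_cast ht
  exact Nat.ceil_pos.2 (by positivity)

lemma gridSize_mono (hr : 0 < r) (hb : 0 < b) {m n : ℕ} (h : m ≤ n) :
    gridSize d r a b m ≤ gridSize d r a b n := by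
  refine Nat.ceil_mono ?_
  gcongr

lemma betaContinuous_mono (hd : 1 ≤ d) (hr : 0 < r) (hb : 0 < b) {m n : ℕ} (hm : 1 ≤ m)
    (h : m ≤ n) : betaContinuous d r a b m ≤ betaContinuous d r a b n := by
  have h1 : (0 : ℝ) < gridSize d r a b m := by exact_mod_cast gridSize_pos hd hr hb hm
  have h2 : (gridSize d r a b m : ℝ) ≤ gridSize d r a b n := by
    exact_mod_cast gridSize_mono hr hb h
  rw [betaContinuous_eq, betaContinuous_eq]
  gcongr

lemma scaleMin_le_betaContinuous (hd : 1 ≤ d) (hr : 0 < r) (hb : 0 < b) {t : ℕ} (ht : 1 ≤ t) :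
    scaleMin ≤ betaContinuous d r a b t := by
  have h1 : (1 : ℝ) ≤ gridSize d r a b t := by exact_mod_cast gridSize_pos hd hr hb ht
  have h2 : (1 : ℝ) ≤ (t : ℝ) ^ 2 := one_le_pow₀ (by exact_mod_cast ht)
  rw [betaContinuous_eq, scaleMin]
  have h3 : 0 ≤ 2 * d * Real.log (gridSize d r a b t) := by
    have := Real.log_nonneg h1
    positivity
  have h4 : 2 * Real.log (1 / √(2 * Real.pi) + 1) ≤
      2 * Real.log ((t : ℝ) ^ 2 / √(2 * Real.pi) + 1) := by gcongr
  linarith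

lemma exp_betaContinuous_div_two (hd : 1 ≤ d) (hr : 0 < r) (hb : 0 < b) {t : ℕ} (ht : 1 ≤ t) :
    Real.exp (betaContinuous d r a b t / 2) =
      (gridSize d r a b t : ℝ) ^ d * ((t : ℝ) ^ 2 / √(2 * Real.pi) + 1) := by
  have h1 : (0 : ℝ) < gridSize d r a b t := by exact_mod_cast gridSize_pos hd hr hb ht
  have h2 : 0 < (t : ℝ) ^ 2 / √(2 * Real.pi) + 1 := by positivity
  rw [betaContinuous_eq]
  have : (2 * d * Real.log (gridSize d r a b t) +
      2 * Real.log ((t : ℝ) ^ 2 / √(2 * Real.pi) + 1)) / 2 =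
      d * Real.log (gridSize d r a b t) + Real.log ((t : ℝ) ^ 2 / √(2 * Real.pi) + 1) := by ring
  rw [this, Real.exp_add, Real.exp_log h2, ← Real.log_pow, Real.exp_log (pow_pos h1 d)]

end ScaleParameter

section Grid

/-- A map to a finite type has a finite set of representatives of its fibers. -/
lemma exists_finset_representatives {X Q : Type*} [Nonempty X] [Fintype Q] (c : X → Q) :
    ∃ A : Finset X, A.card ≤ Fintype.card Q ∧ ∀ x, ∃ x' ∈ A, c x' = c x := by
  classical
  exact ⟨Finset.univ.image (Function.invFun c), Finset.card_image_le, fun x =>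
    ⟨Function.invFun c (c x), Finset.mem_image_of_mem _ (Finset.mem_univ _),
      Function.invFun_eq ⟨x, rfl⟩⟩⟩

/-- An interval of length `r` splits into `m` cells of length `r / m`. -/
lemma exists_cell_map {m : ℕ} (hm : 0 < m) {r : ℝ} (hr : 0 < r) :
    ∃ c : ℝ → Fin m, ∀ s ∈ Set.Icc 0 r, ∀ t ∈ Set.Icc 0 r, c s = c t → |s - t| ≤ r / m := by
  have hm' : (0 : ℝ) < m := by exact_mod_cast hm
  refine ⟨fun s => if h : ⌈s * m / r⌉₊ - 1 < m then ⟨⌈s * m / r⌉₊ - 1, h⟩ else ⟨0, hm⟩,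
    fun s hs t ht hst => ?_⟩
  have hlt : ∀ u ∈ Set.Icc 0 r, ⌈u * m / r⌉₊ - 1 < m := fun u hu => by
    have : ⌈u * m / r⌉₊ ≤ m := Nat.ceil_le.2 (by
      rw [div_le_iff₀ hr, mul_comm (m : ℝ)]
      exact mul_le_mul_of_nonneg_right hu.2 hm'.le)
    omega
  simp only [dif_pos (hlt s hs), dif_pos (hlt t ht), Fin.mk.injEq] at hst
  have hcell : ∀ u ∈ Set.Icc 0 r, ((⌈u * m / r⌉₊ - 1 : ℕ) : ℝ) ≤ u * m / r ∧
      u * m / r ≤ ((⌈u * m / r⌉₊ - 1 : ℕ) : ℝ) + 1 := fun u hu => by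
    have hu0 : 0 ≤ u * m / r := div_nonneg (mul_nonneg hu.1 hm'.le) hr.le
    have h1 := Nat.le_ceil (u * m / r)
    have h2 := Nat.ceil_lt_add_one hu0
    rcases Nat.eq_zero_or_pos ⌈u * m / r⌉₊ with h | h
    · rw [h] at h1 ⊢
      simp only [Nat.cast_zero] at h1
      norm_num
      constructor <;> linarith
    · rw [Nat.cast_sub h]
      push_cast
      constructor <;> linarith
  have h1 := hcell s hs
  have h2 := hcell t ht
  rw [hst] at h1
  have h3 : |s * m / r - t * m / r| ≤ 1 := abs_le.2 ⟨by linarith, by linarith⟩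
  rw [← sub_div, ← sub_mul, abs_div, abs_mul, abs_of_pos hm', abs_of_pos hr, div_le_one hr] at h3
  rwa [le_div_iff₀ hm']

/-- A subset of the cube `[0, r]^d` contains `m ^ d` points such that each of its points is within
`ℓ¹` distance `d r / m` of one of them. -/
lemma exists_finset_net {d : ℕ} {X : Set (EuclideanSpace ℝ (Fin d))} [Nonempty X] {r : ℝ}
    (hr : 0 < r) (hX : ∀ x ∈ X, ∀ j, x j ∈ Set.Icc 0 r) {m : ℕ} (hm : 0 < m) :
    ∃ A : Finset X, A.card ≤ m ^ d ∧ ∀ x : X, ∃ x' ∈ A,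
      ∑ j, |(x : EuclideanSpace ℝ (Fin d)) j - (x' : EuclideanSpace ℝ (Fin d)) j| ≤ d * r / m := by
  obtain ⟨c, hc⟩ := exists_cell_map hm hr
  obtain ⟨A, hA, hrep⟩ := exists_finset_representatives
    fun (x : X) (j : Fin d) => c ((x : EuclideanSpace ℝ (Fin d)) j)
  refine ⟨A, by simpa using hA, fun x => ?_⟩
  obtain ⟨x', hx', hcx⟩ := hrep x
  refine ⟨x', hx', ?_⟩
  refine (Finset.sum_le_card_nsmul _ _ (r / m) fun j _ =>
    hc _ (hX x x.2 j) _ (hX x' x'.2 j) (congrFun hcx j).symm).trans_eq ?_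
  simp [mul_div_assoc]

end Grid

section SmoothPaths

variable {d : ℕ} {X : Set (EuclideanSpace ℝ (Fin d))}

/-- The extension by zero of a function on `X`. -/
def extendZero (h : X → ℝ) (z : EuclideanSpace ℝ (Fin d)) : ℝ :=
  open Classical in if hz : z ∈ X then h ⟨z, hz⟩ else 0

lemma extendZero_coe (h : X → ℝ) (z : X) : extendZero h z = h z := dif_pos z.2

/-- A gradient relative to `X` is a derivative within `X`. -/
lemma hasFDerivWithinAt_extendZero {h : X → ℝ} {x : X} {G : EuclideanSpace ℝ (Fin d)}
    (hG : (fun y : X => h y - h x - inner ℝ G ((y : EuclideanSpace ℝ (Fin d)) - x))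
        =o[𝓝 x] fun y : X => (y : EuclideanSpace ℝ (Fin d)) - x) :
    HasFDerivWithinAt (extendZero h) (innerSL ℝ G) X x := by
  rw [hasFDerivWithinAt_iff_isLittleO, nhdsWithin_eq_map_subtype_coe x.2, Asymptotics.isLittleO_map]
  simpa only [Function.comp_def, extendZero_coe, innerSL_apply_apply] using hG

variable {h : X → ℝ} {G : X → EuclideanSpace ℝ (Fin d)}

lemma continuous_of_gradient
    (hG : ∀ x : X, (fun y : X => h y - h x - inner ℝ (G x) ((y : EuclideanSpace ℝ (Fin d)) - x))
        =o[𝓝 x] fun y : X => (y : EuclideanSpace ℝ (Fin d)) - x) : Continuous h := by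
  have h1 : ContinuousOn (extendZero h) X := fun x hx =>
    (hasFDerivWithinAt_extendZero (hG ⟨x, hx⟩)).continuousWithinAt
  exact (continuousOn_iff_continuous_domRestrict.1 h1).congr fun x => extendZero_coe h x

/-- A bound on all partial derivatives is a Lipschitz constant for the `ℓ¹` distance. -/
lemma abs_sub_le_of_gradient (hX : Convex ℝ X)
    (hG : ∀ x : X, (fun y : X => h y - h x - inner ℝ (G x) ((y : EuclideanSpace ℝ (Fin d)) - x))
        =o[𝓝 x] fun y : X => (y : EuclideanSpace ℝ (Fin d)) - x)
    {c : ℝ} (hc : ∀ x j, |G x j| ≤ c) (x y : X) :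
    |h x - h y| ≤
      c * ∑ j, |(x : EuclideanSpace ℝ (Fin d)) j - (y : EuclideanSpace ℝ (Fin d)) j| := by
  classical
  obtain ⟨z, hz, hzeq⟩ := domain_mvt (f := extendZero h)
    (f' := fun z => if hz : z ∈ X then innerSL ℝ (G ⟨z, hz⟩) else 0)
    (fun z hz => by
      rw [dif_pos hz]
      exact hasFDerivWithinAt_extendZero (hG ⟨z, hz⟩)) hX y.2 x.2
  have hzX := hX.segment_subset y.2 x.2 hz
  rw [dif_pos hzX, extendZero_coe, extendZero_coe, innerSL_apply_apply, PiLp.inner_apply] at hzeq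
  rw [hzeq, Finset.mul_sum]
  refine (Finset.abs_sum_le_sum_abs _ _).trans (Finset.sum_le_sum fun j _ => ?_)
  simp only [PiLp.sub_apply, RCLike.inner_apply, conj_trivial]
  rw [abs_mul, mul_comm]
  exact mul_le_mul_of_nonneg_right (hc _ j) (abs_nonneg _)

/-- The `ℓ¹` distance. -/
def l1Dist (x y : X) : ℝ :=
  ∑ j, |(x : EuclideanSpace ℝ (Fin d)) j - (y : EuclideanSpace ℝ (Fin d)) j|

lemma l1Dist_nonneg (x y : X) : 0 ≤ l1Dist x y := Finset.sum_nonneg fun _ _ => abs_nonneg _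

lemma eq_of_l1Dist_eq_zero {x y : X} (hxy : l1Dist x y = 0) : x = y := by
  refine Subtype.ext (PiLp.ext fun j => ?_)
  have := (Finset.sum_eq_zero_iff_of_nonneg fun _ _ => abs_nonneg _).1 hxy j (Finset.mem_univ j)
  exact sub_eq_zero.1 (abs_eq_zero.1 this)

lemma continuous_l1Dist : Continuous fun p : X × X => l1Dist p.1 p.2 := by
  unfold l1Dist
  fun_prop

variable [Nonempty X]

/-- The best Lipschitz constant for the `ℓ¹` distance on a countable dense set of points. The
countable supremum makes it a measurable function of a random path. -/
def lipConst (h : X → ℝ) : ℝ≥0∞ :=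
  ⨆ (m : ℕ) (n : ℕ), ENNReal.ofReal |h (TopologicalSpace.denseSeq X m) -
    h (TopologicalSpace.denseSeq X n)| /
      ENNReal.ofReal (l1Dist (TopologicalSpace.denseSeq X m) (TopologicalSpace.denseSeq X n))

lemma measurable_lipConst {Ω : Type*} [MeasurableSpace Ω] {f : X → Ω → ℝ}
    (hf : ∀ z, Measurable (f z)) : Measurable fun ω => lipConst fun z => f z ω :=
  Measurable.iSup fun _ => Measurable.iSup fun _ =>
    (continuous_abs.measurable.comp ((hf _).sub (hf _))).ennreal_ofReal.div_const _

lemma lipConst_le {c : ℝ} (hc0 : 0 ≤ c) (hc : ∀ x y, |h x - h y| ≤ c * l1Dist x y) :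
    lipConst h ≤ ENNReal.ofReal c := by
  refine iSup_le fun m => iSup_le fun n => ENNReal.div_le_of_le_mul ?_
  rw [← ENNReal.ofReal_mul hc0]
  exact ENNReal.ofReal_le_ofReal (hc _ _)

lemma abs_sub_le_lipConst (hh : Continuous h) (hfin : lipConst h ≠ ∞) (x y : X) :
    |h x - h y| ≤ (lipConst h).toReal * l1Dist x y := by
  have hclosed : IsClosed {p : X × X | |h p.1 - h p.2| ≤ (lipConst h).toReal * l1Dist p.1 p.2} :=
    isClosed_le (by fun_prop) (continuous_const.mul continuous_l1Dist)
  have hdense : DenseRange (Prod.map (TopologicalSpace.denseSeq X) (TopologicalSpace.denseSeq X)) :=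
    (TopologicalSpace.denseRange_denseSeq X).prodMap (TopologicalSpace.denseRange_denseSeq X)
  refine hdense.induction_on (p := fun p : X × X =>
    |h p.1 - h p.2| ≤ (lipConst h).toReal * l1Dist p.1 p.2) (x, y) hclosed fun mn => ?_
  obtain ⟨m, n⟩ := mn
  simp only [Prod.map]
  rcases (l1Dist_nonneg (TopologicalSpace.denseSeq X m)
    (TopologicalSpace.denseSeq X n)).eq_or_lt with h0 | h0
  · rw [eq_of_l1Dist_eq_zero h0.symm, sub_self, abs_zero]
    exact mul_nonneg ENNReal.toReal_nonneg (l1Dist_nonneg _ _)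
  · have h1 : ENNReal.ofReal
        |h (TopologicalSpace.denseSeq X m) - h (TopologicalSpace.denseSeq X n)| /
        ENNReal.ofReal (l1Dist (TopologicalSpace.denseSeq X m) (TopologicalSpace.denseSeq X n)) ≤
        lipConst h :=
      le_iSup_of_le m (le_iSup (fun n => ENNReal.ofReal |h (TopologicalSpace.denseSeq X m) -
        h (TopologicalSpace.denseSeq X n)| / ENNReal.ofReal (l1Dist (TopologicalSpace.denseSeq X m)
          (TopologicalSpace.denseSeq X n))) n)
    rw [ENNReal.div_le_iff (ENNReal.ofReal_pos.2 h0).ne' ENNReal.ofReal_ne_top,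
      ← ENNReal.ofReal_toReal hfin, ← ENNReal.ofReal_mul ENNReal.toReal_nonneg] at h1
    exact (ENNReal.ofReal_le_ofReal_iff (mul_nonneg ENNReal.toReal_nonneg h0.le)).1 h1

end SmoothPaths

namespace SmoothDomain

variable {d : ℕ} {X : Set (EuclideanSpace ℝ (Fin d))} {Ω : Type*} [MeasurableSpace Ω]
  {P : Measure Ω} {f : X → Ω → ℝ} {r a b : ℝ}

lemma ae_continuous (h : SmoothDomain X P f r a b) : ∀ᵐ ω ∂P, Continuous fun z => f z ω := by
  obtain ⟨G, hG, -⟩ := h.smooth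
  exact hG.mono fun ω hω => continuous_of_gradient hω

variable [Nonempty X]

/-- The Lipschitz constant of the paths inherits the tail bound of the partial derivatives. -/
lemma measure_lt_lipConst_le (h : SmoothDomain X P f r a b) {c : ℝ} (hc : 0 < c) :
    P {ω | ENNReal.ofReal c < lipConst fun z => f z ω} ≤
      ENNReal.ofReal (a * d * Real.exp (-(c / b) ^ 2)) := by
  obtain ⟨G, hG, htail⟩ := h.smooth
  have hsub : {ω | ENNReal.ofReal c < lipConst fun z => f z ω} ≤ᵐ[P]
      ⋃ j : Fin d, {ω | ∃ x : X, c < |G ω x j|} := by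
    filter_upwards [hG] with ω hω hlt
    by_contra hcon
    have hle : ∀ x j, |G ω x j| ≤ c := fun x j => not_lt.1 fun hlt' =>
      hcon (Set.mem_iUnion.2 ⟨j, x, hlt'⟩)
    exact absurd hlt (not_lt.2 (lipConst_le hc.le (abs_sub_le_of_gradient h.convex hω hle)))
  refine (measure_mono_ae hsub).trans ((measure_iUnion_fintype_le P _).trans ?_)
  refine (Finset.sum_le_card_nsmul _ _ _ fun j _ => htail j c hc).trans_eq ?_
  rw [Finset.card_univ, Fintype.card_fin, nsmul_eq_mul, ← ENNReal.ofReal_natCast,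
    ← ENNReal.ofReal_mul (Nat.cast_nonneg d)]
  congr 1
  ring

lemma ae_lipConst_ne_top (h : SmoothDomain X P f r a b) :
    ∀ᵐ ω ∂P, lipConst (fun z => f z ω) ≠ ∞ := by
  have hlim : Tendsto (fun c : ℝ => ENNReal.ofReal (a * d * Real.exp (-(c / b) ^ 2))) atTop
      (𝓝 (ENNReal.ofReal (a * d * 0))) :=
    ENNReal.tendsto_ofReal ((Real.tendsto_exp_atBot.comp (tendsto_neg_atTop_atBot.comp
      ((tendsto_pow_atTop two_ne_zero).comp (tendsto_id.atTop_div_const h.b_pos)))).const_mul _)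
  rw [mul_zero, ENNReal.ofReal_zero] at hlim
  have hle : P {ω | lipConst (fun z => f z ω) = ∞} ≤ 0 := by
    refine ge_of_tendsto hlim ((eventually_gt_atTop 0).mono fun c hc => ?_)
    refine (measure_mono fun ω hω => ?_).trans (h.measure_lt_lipConst_le hc)
    have hω : lipConst (fun z => f z ω) = ∞ := hω
    simp [hω]
  rw [ae_iff]
  simpa using hle

variable [IsProbabilityMeasure P]

/-- A grid discretizes the domain up to an error of expectation at most `t⁻²`. -/
theorem exists_isRounding (h : SmoothDomain X P f r a b) (hf : ∀ z, Measurable (f z)) (hd : 1 ≤ d)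
    {t : ℕ} (ht : 1 ≤ t) :
    ∃ A D, IsRounding P f A D (1 / (t : ℝ) ^ 2) ∧ A.card ≤ gridSize d r a b t ^ d := by
  have hr := h.r_pos
  have hb := h.b_pos
  have hd0 : (1 : ℝ) ≤ d := by exact_mod_cast hd
  have ht0 : (0 : ℝ) < t := by exact_mod_cast ht
  have hm := gridSize_pos (a := a) hd hr hb ht
  set m := gridSize d r a b t with hmdef
  have hm' : (0 : ℝ) < m := by exact_mod_cast hm
  have hq : 1 ≤ a * d := one_le_mul_of_one_le_of_one_le h.one_le_a hd0
  obtain ⟨A, hA, hnet⟩ := exists_finset_net hr h.subset_cube hm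
  set L : Ω → ℝ := fun ω => (lipConst fun z => f z ω).toReal with hL
  have hLm : Measurable L := (measurable_lipConst hf).ennreal_toReal
  have hL0 : ∀ ω, 0 ≤ L ω := fun ω => ENNReal.toReal_nonneg
  have hLint : ∫⁻ ω, ENNReal.ofReal (L ω) ∂P ≤
      ENNReal.ofReal (b * (√(Real.log (a * d)) + √Real.pi / 2)) := by
    refine lintegral_le_of_gaussian_tail hLm hL0 hq hb fun c hc => ?_
    refine (measure_mono fun ω hω => ?_).trans (h.measure_lt_lipConst_le hc)
    have hω : c < L ω := hω
    exact (ENNReal.lt_ofReal_iff_toReal_lt ENNReal.ofReal_ne_top).2 (by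
      rwa [ENNReal.toReal_ofReal hc.le]) |>.trans_le ENNReal.ofReal_toReal_le
  have hLi : Integrable L P := (lintegral_ofReal_ne_top_iff_integrable hLm.aestronglyMeasurable
    (Eventually.of_forall hL0)).1 (hLint.trans_lt ENNReal.ofReal_lt_top).ne
  have hLE : ∫ ω, L ω ∂P ≤ b * (√(Real.log (a * d)) + √Real.pi / 2) := by
    rw [integral_eq_lintegral_of_nonneg_ae (Eventually.of_forall hL0) hLm.aestronglyMeasurable]
    exact ENNReal.toReal_le_of_le_ofReal (by positivity) hLint
  refine ⟨A, fun ω => L ω * (d * r / m), ⟨hLi.mul_const _, ?_, ?_⟩, hA⟩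
  · have hceil : b * d * r * (t : ℝ) ^ 2 * (√(Real.log (a * d)) + √Real.pi / 2) ≤ m :=
      Nat.le_ceil _
    rw [integral_mul_const, ← mul_div_assoc, div_le_div_iff₀ hm' (by positivity)]
    have := mul_le_mul_of_nonneg_right hLE (by positivity : 0 ≤ d * r * (t : ℝ) ^ 2)
    linarith
  · filter_upwards [h.ae_continuous, h.ae_lipConst_ne_top] with ω hω hfin z
    obtain ⟨z', hz', hdist⟩ := hnet z
    exact ⟨z', hz', (abs_sub_le_lipConst hω hfin z z').trans
      (mul_le_mul_of_nonneg_left hdist (hL0 ω))⟩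

end SmoothDomain

section Domain

variable {d : ℕ} {X : Set (EuclideanSpace ℝ (Fin d))} {Ω : Type*} [MeasurableSpace Ω]
  {P : Measure Ω} [IsProbabilityMeasure P] {f : X → Ω → ℝ} {β : ℕ → ℝ}

/-- Both kinds of domains have continuous paths, can be discretized at a cost that the scale
parameter compensates, and have a scale parameter that is increasing and bounded below. -/
theorem domain_properties [Nonempty X] (hf : ∀ z, Measurable (f z)) (hd : 1 ≤ d)
    (hβ : (X.Finite ∧ β = betaFinite X.ncard) ∨
      ∃ r a b : ℝ, SmoothDomain X P f r a b ∧ β = betaContinuous d r a b) :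
    (∀ᵐ ω ∂P, Continuous fun z => f z ω) ∧ (∀ n, scaleMin ≤ β (n + 1)) ∧
      (∀ m n, m ≤ n → β (m + 1) ≤ β (n + 1)) ∧
      ∀ n : ℕ, ∃ A D, IsRounding P f A D (1 / ((n : ℝ) + 1) ^ 2) ∧
        A.card * gaussianPDFReal 0 1 √(β (n + 1)) ≤ 1 / ((n : ℝ) + 1) ^ 2 := by
  rcases hβ with ⟨hfin, rfl⟩ | ⟨r, a, b, h, rfl⟩
  · have : Finite X := hfin
    have hcard : 1 ≤ X.ncard := (Set.ncard_pos hfin).2 (Set.nonempty_coe_sort.1 inferInstance)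
    refine ⟨Eventually.of_forall fun ω => continuous_of_discreteTopology,
      fun n => scaleMin_le_betaFinite hcard n.succ_pos,
      fun m n hmn => betaFinite_mono (Nat.succ_le_succ hmn), fun n => ?_⟩
    have := Fintype.ofFinite X
    refine ⟨Finset.univ, fun _ => 0, ⟨integrable_zero _ _ _, ?_,
      Eventually.of_forall fun ω z => ⟨z, Finset.mem_univ z, by simp⟩⟩, ?_⟩
    · rw [integral_zero]
      positivity
    · rw [Finset.card_univ, ← Nat.card_eq_fintype_card, Nat.card_coe_set_eq]
      have hpos : 0 < (X.ncard : ℝ) * ((n + 1 : ℕ) : ℝ) ^ 2 / √(2 * Real.pi) + 1 := by positivity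
      refine card_mul_gaussianPDFReal_le (by positivity)
        (scaleMin_pos.le.trans (scaleMin_le_betaFinite hcard n.succ_pos)) ?_
      rw [betaFinite, mul_div_cancel_left₀ _ two_ne_zero, Real.exp_log hpos]
      push_cast
      linarith
  · have hr := h.r_pos
    have hb := h.b_pos
    refine ⟨h.ae_continuous, fun n => scaleMin_le_betaContinuous hd hr hb n.succ_pos,
      fun m n hmn => betaContinuous_mono hd hr hb m.succ_pos (Nat.succ_le_succ hmn), fun n => ?_⟩
    obtain ⟨A, D, hA, hcard⟩ := h.exists_isRounding hf hd n.succ_pos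
    refine ⟨A, D, by simpa using hA, ?_⟩
    have hcard' : (A.card : ℝ) ≤ (gridSize d r a b (n + 1) : ℝ) ^ d := by exact_mod_cast hcard
    refine card_mul_gaussianPDFReal_le (by positivity)
      (scaleMin_pos.le.trans (scaleMin_le_betaContinuous hd hr hb n.succ_pos)) ?_
    rw [exp_betaContinuous_div_two hd hr hb n.succ_pos, mul_div_assoc]
    push_cast
    gcongr
    exact le_add_of_nonneg_right zero_le_one

end Domain

/-! ### Continuous paths and the algorithm -/

lemma indepFun_prodMk_left {Ω α β γ : Type*} [MeasurableSpace Ω] [MeasurableSpace α]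
    [MeasurableSpace β] [MeasurableSpace γ] {P : Measure Ω} [IsProbabilityMeasure P] {U : Ω → α}
    {V : Ω → β} {W : Ω → γ} (hU : Measurable U) (hV : Measurable V) (hW : Measurable W)
    (hUVW : IndepFun U (fun ω => (V ω, W ω)) P) (hVW : IndepFun V W P) :
    IndepFun (fun ω => (U ω, V ω)) W P := by
  have iU := Measure.isProbabilityMeasure_map (μ := P) hU.aemeasurable
  have iV := Measure.isProbabilityMeasure_map (μ := P) hV.aemeasurable
  have iW := Measure.isProbabilityMeasure_map (μ := P) hW.aemeasurable
  have h2 : P.map (fun ω => (U ω, V ω)) = (P.map U).prod (P.map V) :=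
    (hUVW.comp measurable_id measurable_fst).map_prod_eq_prod_map_map hU.aemeasurable
      hV.aemeasurable
  rw [indepFun_iff_map_prod_eq_prod_map_map (hU.prodMk hV).aemeasurable hW.aemeasurable, h2,
    ← (measurePreserving_prodAssoc (P.map U) (P.map V) (P.map W)).symm.map_eq,
    ← hVW.map_prod_eq_prod_map_map hV.aemeasurable hW.aemeasurable,
    ← hUVW.map_prod_eq_prod_map_map hU.aemeasurable (hV.prodMk hW).aemeasurable,
    Measure.map_map (MeasurableEquiv.measurable _) (hU.prodMk (hV.prodMk hW))]
  rfl

section Modification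

variable {X Ω S : Type*} [MeasurableSpace Ω] [MeasurableSpace S] {P : Measure Ω}
  {k : X → X → ℝ} {v : ℝ≥0} {f : X → Ω → ℝ} {ε : ℕ → Ω → ℝ} {ξ : Ω → S}

lemma IsCenteredGP.congr {f' : X → Ω → ℝ} (h : IsCenteredGP P k f) (hf' : ∀ z, Measurable (f' z))
    (hff' : ∀ z, f z =ᵐ[P] f' z) : IsCenteredGP P k f' where
  measurable := hf'
  gaussian := h.gaussian.congr hff'
  mean_zero z := by rw [← integral_congr_ae (hff' z), h.mean_zero z]
  covariance z z' := by
    rw [← h.covariance z z', ProbabilityTheory.covariance, ProbabilityTheory.covariance,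
      integral_congr_ae (hff' z), integral_congr_ae (hff' z')]
    refine integral_congr_ae ?_
    filter_upwards [hff' z, hff' z'] with ω h1 h2
    rw [h1, h2]

lemma maxInfoGain_congr {f' : X → Ω → ℝ} (hff' : ∀ z, f z =ᵐ[P] f' z) (T : ℕ) :
    maxInfoGain P f ε T = maxInfoGain P f' ε T := by
  unfold maxInfoGain
  congr 1
  refine iSup_congr fun A => ?_
  have h1 : (fun ω (i : Fin T) => f (A i) ω) =ᵐ[P] fun ω i => f' (A i) ω := by
    filter_upwards [ae_all_iff.2 fun i => hff' (A i)] with ω hω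
    exact funext hω
  have h2 : (fun ω (i : Fin T) => f (A i) ω + ε i ω) =ᵐ[P] fun ω i => f' (A i) ω + ε i ω := by
    filter_upwards [h1] with ω hω
    exact funext fun i => congrArg (· + ε i ω) (congrFun hω i)
  unfold mutualInfo
  rw [Measure.map_congr h1, Measure.map_congr h2, Measure.map_congr (h2.prodMk h1)]

/-- The value of a maximizer of the paths is measurable up to null sets, even if the maximizer
itself is not. -/
lemma aestronglyMeasurable_maximizer [PseudoEMetricSpace X]
    [TopologicalSpace.SeparableSpace X] [Nonempty X] {xstar : Ω → X} (hf : ∀ z, Measurable (f z))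
    (hc : ∀ᵐ ω ∂P, Continuous fun z => f z ω) (hmax : IsMaximizer P f xstar) :
    AEStronglyMeasurable (fun ω => f (xstar ω) ω) P := by
  have hm : Measurable fun ω => ⨆ m, f (TopologicalSpace.denseSeq X m) ω :=
    Measurable.iSup fun m => hf _
  refine hm.aestronglyMeasurable.congr ?_
  filter_upwards [hc, hmax] with ω hω hle
  have hbdd : BddAbove (Set.range fun m => f (TopologicalSpace.denseSeq X m) ω) :=
    ⟨_, Set.forall_mem_range.2 fun m => hle _⟩
  refine le_antisymm (ciSup_le fun m => hle _) ?_
  exact (TopologicalSpace.denseRange_denseSeq X).induction_on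
    (p := fun z => f z ω ≤ ⨆ m, f (TopologicalSpace.denseSeq X m) ω) (xstar ω)
    (isClosed_le hω continuous_const) fun m => le_ciSup hbdd m

variable [IsProbabilityMeasure P]

lemma IsCenteredGP.measurable_kernel [MeasurableSpace X] {F : X → Ω → ℝ} (h : IsCenteredGP P k F)
    (hF : Measurable fun q : X × Ω => F q.1 q.2) : Measurable (Function.uncurry k) := by
  have hker : Function.uncurry k = fun q : X × X => ∫ ω, F q.1 ω * F q.2 ω ∂P := by
    funext q
    have := h.covariance q.1 q.2
    rw [ProbabilityTheory.covariance] at this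
    simpa [h.mean_zero, Function.uncurry] using this.symm
  rw [hker]
  have h1 : Measurable fun p : (X × X) × Ω => F p.1.1 p.2 :=
    hF.comp ((measurable_fst.comp measurable_fst).prodMk measurable_snd)
  have h2 : Measurable fun p : (X × X) × Ω => F p.1.2 p.2 :=
    hF.comp ((measurable_snd.comp measurable_fst).prodMk measurable_snd)
  exact (h1.mul h2).stronglyMeasurable.integral_prod_right'.measurable

lemma IsModel.indepFun_noise (h : IsModel P k v f ε ξ) {E : Type*} [MeasurableSpace E]
    {Φ : (X → ℝ) → E} (hΦ : Measurable Φ) (n : ℕ) :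
    IndepFun (fun ω => ((Φ fun z => f z ω, ξ ω), fun i : Fin n => ε i ω)) (ε n) P := by
  have hg : Measurable fun ω => Φ fun z => f z ω :=
    hΦ.comp (measurable_pi_lambda _ h.gp.measurable)
  have hpast : Measurable fun ω (i : Fin n) => ε i ω :=
    measurable_pi_lambda _ fun i => h.noise_measurable i
  have hφ : Measurable fun p : (X → ℝ) × S => (Φ p.1, p.2) :=
    (hΦ.comp measurable_fst).prodMk measurable_snd
  have hψ : Measurable fun e : ℕ → ℝ => (fun i : Fin n => e i, e n) :=
    (measurable_pi_lambda _ fun i : Fin n => measurable_pi_apply (i : ℕ)).prodMk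
      (measurable_pi_apply n)
  refine indepFun_prodMk_left (hg.prodMk h.seed_measurable) hpast (h.noise_measurable n)
    (h.indep_noise_rest.symm.comp hφ hψ) ?_
  have h1 := h.indep_noise.indepFun_finset (Finset.range n) {n} (by simp) h.noise_measurable
  have hφ' : Measurable fun (e : Finset.range n → ℝ) (i : Fin n) => e ⟨i, Finset.mem_range.2 i.2⟩ :=
    measurable_pi_lambda _ fun i => measurable_pi_apply _
  have hψ' : Measurable fun e : ({n} : Finset ℕ) → ℝ => e ⟨n, Finset.mem_singleton_self n⟩ :=
    measurable_pi_apply _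
  exact h1.comp hφ' hψ'

end Modification

section Representation

variable {X : Type*} [PseudoEMetricSpace X] [TopologicalSpace.SeparableSpace X]
  [MeasurableSpace X] [OpensMeasurableSpace X] [Nonempty X]

/-- The value at `z` of the continuous function whose values on the dense sequence are `e`. It is
jointly measurable in `z` and `e`, which the evaluation of a sample path at a random point is not a
priori. -/
def denseEval (z : X) (e : ℕ → ℝ) : ℝ :=
  limsup (fun m => e (SimpleFunc.nearestPtInd (TopologicalSpace.denseSeq X) m z)) atTop

lemma measurable_denseEval : Measurable (Function.uncurry (denseEval (X := X))) := by
  refine Measurable.limsup fun m => ?_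
  have h1 : Measurable fun q : ℕ × (ℕ → ℝ) => q.2 q.1 :=
    measurable_from_prod_countable_right fun i => measurable_pi_apply i
  exact h1.comp (((SimpleFunc.nearestPtInd (TopologicalSpace.denseSeq X) m).measurable.comp
    measurable_fst).prodMk measurable_snd)

lemma denseEval_eq {h : X → ℝ} (hh : Continuous h) (z : X) :
    denseEval z (fun m => h (TopologicalSpace.denseSeq X m)) = h z :=
  ((hh.tendsto z).comp (SimpleFunc.tendsto_nearestPt
    ((TopologicalSpace.denseRange_denseSeq X).closure_range ▸ Set.mem_univ z))).limsup_eq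

attribute [irreducible] denseEval

/-- The values of the objective on the dense sequence. -/
def denseValues {Ω : Type*} (f : X → Ω → ℝ) (ω : Ω) : ℕ → ℝ :=
  fun m => f (TopologicalSpace.denseSeq X m) ω

variable {Ω S : Type*} [MeasurableSpace Ω] [MeasurableSpace S] {P : Measure Ω}
  {k : X → X → ℝ} {v : ℝ≥0} {κ : ℝ} {f : X → Ω → ℝ} {ε : ℕ → Ω → ℝ}
  {ξ : Ω → S}

/-- The queries of a run are those of a measurable policy. -/
lemma IsScaledEIRun.exists_policy {β : ℕ → ℝ} {x : ℕ → Ω → X}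
    (h : IsScaledEIRun P k v β f ε ξ x) (hc : ∀ᵐ ω ∂P, Continuous fun z => f z ω) :
    ∃ π : ∀ n : ℕ, S × (Fin n → ℝ) → X, (∀ n, Measurable (π n)) ∧
      ∀ᵐ ω ∂P, ∀ n, x n ω = π n (policyData denseEval π (denseValues f) ξ ε n ω) ∧
        obs f ε x n ω = policyObs denseEval π (denseValues f) ξ ε n ω := by
  choose π hπ hx using h.adapted
  refine ⟨π, hπ, ?_⟩
  filter_upwards [ae_all_iff.2 hx, hc] with ω hω hcω n
  induction n using Nat.strong_induction_on with
  | _ n ih =>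
    have h1 : (fun i : Fin n => obs f ε x i ω) =
        policyHist denseEval π (denseValues f) ξ ε n ω := funext fun i => (ih i i.2).2
    have h2 : x n ω = π n (policyData denseEval π (denseValues f) ξ ε n ω) := by
      rw [hω n, h1]
      rfl
    refine ⟨h2, ?_⟩
    rw [policyObs, obs, h2]
    exact congrArg (· + ε n ω) (denseEval_eq hcω _).symm

variable [IsProbabilityMeasure P]

/-- The model in terms of the values of the objective on a dense sequence. -/
theorem IsModel.isGPModel (h : IsModel P k v f ε ξ) (hv : 0 < v) (hκ : 0 < κ)
    (hk : ∀ z, κ ≤ k z z ∧ k z z ≤ 1) (hc : ∀ᵐ ω ∂P, Continuous fun z => f z ω) :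
    IsGPModel P k v κ denseEval (denseValues f) ξ ε := by
  have hg : Measurable (denseValues f) := measurable_pi_lambda _ fun m => h.gp.measurable _
  have hrestr : Measurable fun (p : X → ℝ) (m : ℕ) => p (TopologicalSpace.denseSeq X m) :=
    measurable_pi_lambda _ fun m => measurable_pi_apply _
  have hF : Measurable fun q : X × Ω => denseEval q.1 (denseValues f q.2) := by
    have hpair : Measurable fun q : X × Ω => (q.1, denseValues f q.2) :=
      measurable_fst.prodMk (hg.comp measurable_snd)
    simpa only [Function.comp_def, Function.uncurry_apply_pair] using
      measurable_denseEval.comp hpair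
  have hgp : IsCenteredGP P k fun z ω => denseEval z (denseValues f ω) :=
    h.gp.congr (fun z => hF.comp measurable_prodMk_left)
      fun z => hc.mono fun ω hω => (denseEval_eq hω z).symm
  have hnoisy : IsNoisyModel P v (denseValues f) ξ ε :=
    { measurable_obj := hg
      measurable_seed := h.seed_measurable
      measurable_noise := h.noise_measurable
      noise_law := h.noise_law
      indep_obj_seed := h.indep_obj_seed.comp hrestr measurable_id
      iIndep_noise := h.indep_noise
      indep_obj_noise := h.indep_noise_rest.symm.comp (hrestr.comp measurable_fst) measurable_id
      indep_noise := h.indepFun_noise hrestr }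
  exact ⟨hnoisy, hv, hgp, measurable_denseEval, hgp.measurable_kernel hF, hκ, hk⟩

/-- The regret bound for a run on a domain that can be discretized. -/
theorem IsScaledEIRun.bcr_le {β : ℕ → ℝ} {x : ℕ → Ω → X} (hrun : IsScaledEIRun P k v β f ε ξ x)
    (h : IsModel P k v f ε ξ) (hv : 0 < v) (hκ : 0 < κ) (hk : ∀ z, κ ≤ k z z ∧ k z z ≤ 1)
    (hc : ∀ᵐ ω ∂P, Continuous fun z => f z ω) {c : ℝ} (hc0 : 0 < c) (hβ : ∀ n, c ≤ β (n + 1))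
    (hβm : ∀ m n, m ≤ n → β (m + 1) ≤ β (n + 1))
    (hA : ∀ n : ℕ, ∃ A D, IsRounding P f A D (1 / ((n : ℝ) + 1) ^ 2) ∧
      A.card * gaussianPDFReal 0 1 √(β (n + 1)) ≤ 1 / ((n : ℝ) + 1) ^ 2)
    {xstar : Ω → X} (hmax : IsMaximizer P f xstar) :
    (∀ n, Integrable (fun ω => f (xstar ω) ω - f (x n ω) ω) P) ∧ ∀ T : ℕ, 2 ≤ T →
      bcr P f xstar x T ≤
        regretConst v κ c * √(β T * maxInfoGain P f ε T * T * Real.log T) := by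
  have hM := h.isGPModel hv hκ hk hc
  obtain ⟨π, hπ, hx⟩ := hrun.exists_policy hc
  have hev : ∀ᵐ ω ∂P, ∀ z, denseEval z (denseValues f ω) = f z ω :=
    hc.mono fun ω hω z => denseEval_eq hω z
  obtain ⟨A₀, D₀, hA₀, -⟩ := hA 0
  obtain ⟨B, hB, hfB⟩ := hA₀.exists_integrable_bound h.gp.integrable
  have hstar : Integrable (fun ω => f (xstar ω) ω) P :=
    hB.mono' (aestronglyMeasurable_maximizer h.gp.measurable hc hmax) (hfB.mono fun ω hω => hω _)
  have hxn : ∀ n, (fun ω => f (x n ω) ω) =ᵐ[P] fun ω =>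
      denseEval (π n (policyData denseEval π (denseValues f) ξ ε n ω)) (denseValues f ω) :=
    fun n => by
    filter_upwards [hev, hx] with ω h1 h2
    rw [h1, (h2 n).1]
  have hxi : ∀ n, Integrable (fun ω => f (x n ω) ω) P := fun n =>
    hB.mono' ((hM.measurable_eval_comp hπ (hπ n)).aestronglyMeasurable.congr (hxn n).symm)
      (hfB.mono fun ω hω => hω _)
  refine ⟨fun n => hstar.sub (hxi n), fun T hT => ?_⟩
  obtain ⟨T, rfl⟩ : ∃ T', T = T' + 1 := ⟨T - 1, by omega⟩
  have hbcr : bcr P f xstar x (T + 1) = ∑ n ∈ Finset.range (T + 1), ∫ ω, (f (xstar ω) ω -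
      denseEval (π n (policyData denseEval π (denseValues f) ξ ε n ω)) (denseValues f ω)) ∂P :=
    Finset.sum_congr rfl fun n _ => integral_congr_ae ((hxn n).mono fun ω hω => by
      simp only [hω])
  have hγ : maxInfoGain P f ε (T + 1) =
      maxInfoGain P (fun z ω => denseEval z (denseValues f ω)) ε (T + 1) :=
    maxInfoGain_congr (fun z => hev.mono fun ω hω => (hω z).symm) _
  rw [hbcr, hγ]
  refine (hM.sum_integral_regret_le hπ hstar ?_ ?_ (fun n => hc0.trans_le (hβ n)) hβm ?_ ?_
    T).trans (le_regretConst_mul hv hκ hc0 (hβ T)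
      (hM.log_one_add_div_le_maxInfoGain T.succ_pos) hT)
  · exact hev.mono fun ω hω => ⟨xstar ω, (hω _).symm⟩
  · filter_upwards [hev, hmax] with ω h1 h2 z
    rw [h1]
    exact h2 z
  · intro n
    obtain ⟨A, D, hAD, hcard⟩ := hA n
    refine ⟨A, D, ⟨hAD.integrable, hAD.integral_le, ?_⟩, hcard⟩
    filter_upwards [hev, hAD.approx] with ω h1 h2 z
    simpa only [h1] using h2 z
  · intro n
    filter_upwards [hrun.argmax n, hx] with ω h1 h2
    have e1 : (fun i : Fin n => x i ω) = policyDesign π (ξ ω)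
        (policyHist denseEval π (denseValues f) ξ ε n ω) := funext fun i => (h2 i).1
    have e2 : (fun i : Fin n => obs f ε x i ω) =
        policyHist denseEval π (denseValues f) ξ ε n ω := funext fun i => (h2 i).2
    rw [e1, e2, (h2 n).1] at h1
    exact h1

end Representation

end BayesOpt

end

theorem mainTheorem10 (v : ℝ≥0) (hv : 0 < v) (κ : ℝ) (hκ : 0 < κ) :
    ∃ C : ℝ, ∀ (d : ℕ) (_ : 1 ≤ d) (X : Set (EuclideanSpace ℝ (Fin d))) (k : X → X → ℝ)
      (_ : ∀ z, κ ≤ k z z ∧ k z z ≤ 1)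
      (Ω S : Type*) [MeasurableSpace Ω] [MeasurableSpace S]
      (P : Measure Ω) [IsProbabilityMeasure P]
      (f : X → Ω → ℝ) (ε : ℕ → Ω → ℝ) (ξ : Ω → S) (_ : BayesOpt.IsModel P k v f ε ξ)
      (β : ℕ → ℝ)
      (_ : (X.Finite ∧ β = BayesOpt.betaFinite X.ncard) ∨
        ∃ r a b : ℝ, BayesOpt.SmoothDomain X P f r a b ∧ β = BayesOpt.betaContinuous d r a b)
      (x : ℕ → Ω → X) (_ : BayesOpt.IsScaledEIRun P k v β f ε ξ x)
      (xstar : Ω → X) (_ : BayesOpt.IsMaximizer P f xstar),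
      (∀ n, Integrable (fun ω => f (xstar ω) ω - f (x n ω) ω) P) ∧
      ∀ T : ℕ, 2 ≤ T →
        BayesOpt.bcr P f xstar x T ≤
          C * Real.sqrt (β T * BayesOpt.maxInfoGain P f ε T * T * Real.log T) := by
  refine ⟨BayesOpt.regretConst v κ BayesOpt.scaleMin, ?_⟩
  intro d hd X k hk Ω S _ _ P _ f ε ξ h β hβ x hrun xstar hmax
  have : Nonempty X := (nonempty_of_isProbabilityMeasure P).map xstar
  obtain ⟨hc, hβ0, hβm, hA⟩ := BayesOpt.domain_properties h.gp.measurable hd hβ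
  exact hrun.bcr_le h hv hκ hk hc BayesOpt.scaleMin_pos hβ0 hβm hA hmax
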